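/- **Prize-collecting Steiner forest.** An instance $I$ consists of a finite undirected graph $G=(V,E)$ with $V=\{0,\dots,n-1\}$, edge costs $c:E\to\mathbb{R}_{\ge 0}$ and penalties $\pi(uv)\ge 0$ for all unordered pairs of distinct vertices. For a forest $F\subseteq E$ let $\mathrm{Cost}(F)=\sum_{e\in F}c(e)+\sum_{uv\text{ not connected by }F}\pi(uv)$, and let $\mathrm{OPT}$ be the minimum of $\mathrm{Cost}(F)$ over all forests $F\subseteq E$. A solution may also pay for pairs that it happens to connect: a *paying solution* is a forest $F'\subseteq E$ with a set $P$ of pairs such that $F'$ connects every pair outside $P$; its cost is $\sum_{e\in F'}c(e)+\sum_{uv\in P}\pi(uv)$, and the pairs outside $P$ are the pairs it is said to connect. **Theorem.** There are an absolute constant $C$ and one polynomial-time algorithm that, given an instance $I$ and a number $0<\varepsilon\le 1$, outputs a forest $F\subseteq E$ such that 1. $\mathrm{Cost}(F)\le \frac{C}{\varepsilon}\,\mathrm{OPT}$; 2. there is a paying solution $(F',P)$ of cost at most $(1+\varepsilon)\,\mathrm{OPT}$ such that every pair outside $P$ is connected by $F$; 3. $F$ is an output (for some resolution of ties) of the algorithm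 Primal-Dual Forest, described below, on the instance with the same graph and edge costs and with penalties $\frac{2}{\varepsilon}\pi$. Polynomial time means: on a random access machine with natural-number and real-number arrays, with addition, truncated subtraction and comparison of naturals and $+,-,\times,\div,\le$ on reals, the number of operations is bounded by a polynomial in $n$; and if $\varepsilon$ and all costs and penalties are rational, the total bit length of all values occurring in the computation (the logarithmic cost) is bounded by a polynomial in the bit length of the input. **Primal-Dual Forest.** Let $(s_i,t_i)$ be the pairs with penalty $\pi_i>0$. Each has two terminals, one at $s_i$ and one at $t_i$, initially alive. Start with $F=\emptyset$; the active components are the singletons of vertices carrying terminals, with $\mathrm{Potential}(\{v\})$ the sum of $\pi_i/2$ over the terminals at $v$, and $y=\mathrm{Uncharged}=0$. While there is an active component, raise $y(S)$ and $\mathrm{Uncharged}(S)$ and lower $\mathrm{Potential}(S)$ at unit rate for all active $S$, until one of the following occurs. * An edge $e$ between two different components $S_1,S_2$ of $F$, at least one of them active, is tight, i.e. $\sum_{S:e\in\delta(S)}y(S)=c(e)$. Then add $e$ to $F$ and replace $S_1,S_2$ by the active component $S=S_1\cup S_2$, with $y(S)=\mathrm{Uncharged}(S)=0$ and $\mathrm{Potential}(S)=\mathrm{Potential}(S_1)+\mathrm{Potential}(S_2)$.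 For each pair $i$ for which $S$ is the smallest component formed so far containing both endpoints: for each of its two terminals that is alive, subtract the value returned by ProcessHistory from $\mathrm{Potential}(S)$; then mark both terminals satisfied if both were alive, and dead otherwise. * $\mathrm{Potential}(S)=0$ for an active component $S$. Then make $S$ inactive, mark all alive terminals in $S$ dead and call ProcessHistory for each. ProcessHistory for a terminal of pair $i$ starts with remaining charge $r=\pi_i/2$ and runs, by increasing size, through the components formed so far that contain the terminal: if $\mathrm{Uncharged}(S)\le r$, it lowers $r$ by $\mathrm{Uncharged}(S)$, sets $y_{i,S}=\mathrm{Uncharged}(S)$ and $\mathrm{Uncharged}(S)=0$; otherwise it lowers $\mathrm{Uncharged}(S)$ by $r$, sets $y_{i,S}=r$ and returns $0$. At the end it returns $r$. When no component is active, go through the edges of $F$ one by one, deleting $e$ if $F-e$ does not separate any pair of satisfied terminals; output the remaining $F$. -/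

import Mathlib

/-! ## Prize-collecting Steiner forest -/

/-- An instance of prize-collecting Steiner forest on the vertex set `{0, …, n - 1}`: a finite
undirected graph, nonnegative edge costs, and a nonnegative penalty for every unordered pair of
vertices.  Values of `cost` off the edge set and of `penalty` on the diagonal are never used. -/
structure PCSF (n : ℕ) where
  graph : SimpleGraph (Fin n)
  cost : Sym2 (Fin n) → ℝ
  penalty : Sym2 (Fin n) → ℝ
  cost_nonneg : ∀ e, 0 ≤ cost e
  penalty_nonneg : ∀ p, 0 ≤ penalty p

/-- The endpoints of the pair `p` lie in one connected component of `F`. -/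
def Joins {n : ℕ} (F : SimpleGraph (Fin n)) (p : Sym2 (Fin n)) : Prop :=
  ∀ u ∈ p, ∀ v ∈ p, F.Reachable u v

namespace PCSF

variable {n : ℕ}

/-- `F` is (the edge set of) a forest in the graph of the instance. -/
def IsForest (I : PCSF n) (F : SimpleGraph (Fin n)) : Prop :=
  F ≤ I.graph ∧ F.IsAcyclic

open Classical in
/-- Total cost of the edges of `F`. -/
noncomputable def length (I : PCSF n) (F : SimpleGraph (Fin n)) : ℝ :=
  ∑ e with e ∈ F.edgeSet, I.cost e

open Classical in
/-- Total penalty of the pairs that are not connected by `F`. -/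
noncomputable def sepPenalty (I : PCSF n) (F : SimpleGraph (Fin n)) : ℝ :=
  ∑ p with ¬ Joins F p, I.penalty p

/-- The objective value of `F`. -/
noncomputable def totalCost (I : PCSF n) (F : SimpleGraph (Fin n)) : ℝ :=
  I.length F + I.sepPenalty F

/-- The optimum value. -/
noncomputable def opt (I : PCSF n) : ℝ :=
  sInf (I.totalCost '' {F | I.IsForest F})

/-- The infimum in `opt` is a minimum. -/
theorem isLeast_opt (I : PCSF n) : IsLeast (I.totalCost '' {F | I.IsForest F}) I.opt := by
  have hne : (I.totalCost '' {F | I.IsForest F}).Nonempty :=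
    ⟨_, ⊥, ⟨bot_le, SimpleGraph.isAcyclic_bot⟩, rfl⟩
  have hfin : (I.totalCost '' {F | I.IsForest F}).Finite := (Set.toFinite _).image _
  exact ⟨hne.csInf_mem hfin, fun x hx => csInf_le hfin.bddBelow hx⟩

/-- A solution that announces which penalties it pays: the forest `F` connects every pair
outside `P`, and the penalty of every pair in `P` is paid. -/
def IsPayingSolution (I : PCSF n) (F : SimpleGraph (Fin n)) (P : Finset (Sym2 (Fin n))) : Prop :=
  I.IsForest F ∧ ∀ p, p ∉ P → Joins F p

/-- The cost of a paying solution. -/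
noncomputable def payingCost (I : PCSF n) (F : SimpleGraph (Fin n))
    (P : Finset (Sym2 (Fin n))) : ℝ :=
  I.length F + ∑ p ∈ P, I.penalty p

/-- The instance with all penalties multiplied by `a`. -/
def scale (I : PCSF n) (a : ℝ) (ha : 0 ≤ a) : PCSF n where
  graph := I.graph
  cost := I.cost
  penalty p := a * I.penalty p
  cost_nonneg := I.cost_nonneg
  penalty_nonneg p := mul_nonneg ha (I.penalty_nonneg p)

end PCSF

/-! ## The algorithm Primal-Dual Forest

A terminal pair is written `i = (s, t)` with `s < t`.  A terminal is a pair `i` together with one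
of its two endpoints, so that a vertex occurring in several pairs carries several terminals. -/

namespace PrimalDual

variable {n : ℕ}

/-- The label of a terminal. -/
inductive Status where
  | alive
  | satisfied
  | dead

/-- The variables of the algorithm: the forest `F`, the components ever formed, the active
components, `y(S)`, `Potential(S)`, `Uncharged(S)`, the split variables `y_{i,S}`, and the labels
of the terminals. -/
structure State (n : ℕ) where
  forest : SimpleGraph (Fin n)
  formed : Finset (Finset (Fin n))
  active : Finset (Finset (Fin n))
  y : Finset (Fin n) → ℝ
  potential : Finset (Fin n) → ℝ
  uncharged : Finset (Fin n) → ℝ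
  share : Fin n × Fin n → Finset (Fin n) → ℝ
  status : Fin n × Fin n → Fin n → Status

open Classical in
/-- The terminal pairs: the pairs with nonzero penalty. -/
noncomputable def pairs (I : PCSF n) : Finset (Fin n × Fin n) :=
  {i | i.1 < i.2 ∧ 0 < I.penalty s(i.1, i.2)}

/-- The penalty `π_i`. -/
def pen (I : PCSF n) (i : Fin n × Fin n) : ℝ := I.penalty s(i.1, i.2)

open Classical in
/-- The initial state.  The active components are the singletons of terminals, and the potential
of a vertex is the sum of `π_i / 2` over the terminals located there. -/
noncomputable def init (I : PCSF n) : State n where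
  forest := ⊥
  formed := (pairs I).image (fun i => {i.1}) ∪ (pairs I).image (fun i => {i.2})
  active := (pairs I).image (fun i => {i.1}) ∪ (pairs I).image (fun i => {i.2})
  y _ := 0
  potential S := ∑ i ∈ pairs I with S = {i.1} ∨ S = {i.2}, pen I i / 2
  uncharged _ := 0
  share _ _ := 0
  status _ _ := Status.alive

open Classical in
/-- The vertex set of the component of `u` in the current forest. -/
noncomputable def comp (st : State n) (u : Fin n) : Finset (Fin n) :=
  {v | st.forest.Reachable u v}

/-- `e ∈ δ(S)`: exactly one endpoint of `e` lies in `S`. -/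
def Cuts (S : Finset (Fin n)) (e : Sym2 (Fin n)) : Prop :=
  (∃ u ∈ e, u ∈ S) ∧ ∃ v ∈ e, v ∉ S

open Classical in
/-- `∑_{S : e ∈ δ(S)} y(S)`. -/
noncomputable def load (st : State n) (e : Sym2 (Fin n)) : ℝ :=
  ∑ S ∈ st.formed with Cuts S e, st.y S

/-- The loop of ProcessHistory: run through the list of sets, charging as much of their uncharged
growth as the remaining charge `r` allows.  Returns the remaining charge and the updated values
of `Uncharged` and of `y_{i,·}`. -/
noncomputable def chargeLoop (r : ℝ) (unch share : Finset (Fin n) → ℝ) :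
    List (Finset (Fin n)) → ℝ × (Finset (Fin n) → ℝ) × (Finset (Fin n) → ℝ)
  | [] => (r, unch, share)
  | S :: L =>
    if unch S ≤ r then
      chargeLoop (r - unch S) (Function.update unch S 0) (Function.update share S (unch S)) L
    else
      (0, Function.update unch S (unch S - r), Function.update share S r)

/-- The history of a terminal at `u`, in increasing order of size.  It is only used for a terminal
that has been alive up to that moment, so that every component formed so far and containing
`u` belongs to it. -/
noncomputable def history (st : State n) (u : Fin n) : List (Finset (Fin n)) :=
  (st.formed.filter (fun S => u ∈ S)).toList.mergeSort (fun S T => decide (S.card ≤ T.card))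

/-- ProcessHistory for the terminal of the pair `i` at `u`: the returned remaining charge. -/
noncomputable def historyRest (I : PCSF n) (st : State n) (i : Fin n × Fin n) (u : Fin n) : ℝ :=
  (chargeLoop (pen I i / 2) st.uncharged (st.share i) (history st u)).1

/-- ProcessHistory for the terminal of the pair `i` at `u`: the new state. -/
noncomputable def historyState (I : PCSF n) (st : State n) (i : Fin n × Fin n) (u : Fin n) :
    State n :=
  { st with
    uncharged := (chargeLoop (pen I i / 2) st.uncharged (st.share i) (history st u)).2.1
    share := Function.update st.share i
      (chargeLoop (pen I i / 2) st.uncharged (st.share i) (history st u)).2.2 }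

/-- Give the terminal of the pair `i` at `u` the label `a`. -/
def mark (st : State n) (i : Fin n × Fin n) (u : Fin n) (a : Status) : State n :=
  { st with status := Function.update st.status i (Function.update (st.status i) u a) }

open Classical in
/-- `If (the terminal is alive), Potential(S) ← Potential(S) - ProcessHistory(terminal)`. -/
noncomputable def payOut (I : PCSF n) (S : Finset (Fin n)) (st : State n) (i : Fin n × Fin n)
    (u : Fin n) : State n :=
  if st.status i u = Status.alive then
    { historyState I st i u with
      potential := Function.update st.potential S (st.potential S - historyRest I st i u) }
  else st

open Classical in
/-- The work for one pair `i = (s, t)` that is united by the new component `S`. -/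
noncomputable def unitePair (I : PCSF n) (S : Finset (Fin n)) (st : State n)
    (i : Fin n × Fin n) : State n :=
  let a := if st.status i i.1 = Status.alive ∧ st.status i i.2 = Status.alive
    then Status.satisfied else Status.dead
  mark (mark (payOut I S (payOut I S st i i.1) i i.2) i i.1 a) i i.2 a

/-- `S` unites `i`: it is the smallest component formed so far that contains both endpoints. -/
def Unites (st : State n) (S : Finset (Fin n)) (i : Fin n × Fin n) : Prop :=
  (i.1 ∈ S ∧ i.2 ∈ S) ∧ ∀ T ∈ st.formed, i.1 ∈ T → i.2 ∈ T → S ⊆ T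

/-- Increase `y(S)` by `d` for all active components. -/
noncomputable def grow (st : State n) (d : ℝ) : State n :=
  { st with
    y := fun S => if S ∈ st.active then st.y S + d else st.y S
    potential := fun S => if S ∈ st.active then st.potential S - d else st.potential S
    uncharged := fun S => if S ∈ st.active then st.uncharged S + d else st.uncharged S }

/-- Add the edge `uv` to the forest and merge the components `S₁`, `S₂` of its endpoints. -/
noncomputable def merge (st : State n) (u v : Fin n) : State n :=
  let S₁ := comp st u
  let S₂ := comp st v
  { st with
    forest := st.forest ⊔ SimpleGraph.edge u v
    formed := insert (S₁ ∪ S₂) st.formed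
    active := insert (S₁ ∪ S₂) ((st.active.erase S₁).erase S₂)
    y := Function.update st.y (S₁ ∪ S₂) 0
    uncharged := Function.update st.uncharged (S₁ ∪ S₂) 0
    potential := Function.update st.potential (S₁ ∪ S₂) (st.potential S₁ + st.potential S₂) }

/-- An edge of the graph between two different components, one of them active, is tight. -/
def TightEdge (I : PCSF n) (st : State n) (u v : Fin n) : Prop :=
  I.graph.Adj u v ∧ ¬ st.forest.Reachable u v ∧
    (comp st u ∈ st.active ∨ comp st v ∈ st.active) ∧ load st s(u, v) = I.cost s(u, v)

/-- No edge is overloaded and no active component has overspent its potential. -/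
def WithinLimits (I : PCSF n) (st : State n) : Prop :=
  (∀ e ∈ I.graph.edgeSet, load st e ≤ I.cost e) ∧ ∀ S ∈ st.active, 0 ≤ st.potential S

/-- One iteration of the main loop: all active components grow by the same amount until an edge
goes tight or a component uses all its potential, and one such event is processed.  Ties between
events, and the order of the inner `For each` loops, are resolved arbitrarily (of several
simultaneous events, the others are processed by iterations with `d = 0`). -/
inductive Step (I : PCSF n) : State n → State n → Prop
  | edge (st : State n) (d : ℝ) (u v : Fin n) (L : List (Fin n × Fin n)) :
      0 ≤ d → WithinLimits I (grow st d) → TightEdge I (grow st d) u v →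
      L.Nodup →
      (∀ i, i ∈ L ↔ i ∈ pairs I ∧
        Unites (merge (grow st d) u v) (comp st u ∪ comp st v) i) →
      Step I st
        (L.foldl (unitePair I (comp st u ∪ comp st v)) (merge (grow st d) u v))
  | exhausted (st : State n) (d : ℝ) (S : Finset (Fin n))
      (L : List ((Fin n × Fin n) × Fin n)) :
      0 ≤ d → WithinLimits I (grow st d) → S ∈ st.active → (grow st d).potential S = 0 →
      L.Nodup →
      (∀ x, x ∈ L ↔ x.1 ∈ pairs I ∧ (x.2 = x.1.1 ∨ x.2 = x.1.2) ∧ x.2 ∈ S ∧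
        st.status x.1 x.2 = Status.alive) →
      Step I st
        (L.foldl (fun s x => historyState I (mark s x.1 x.2 Status.dead) x.1 x.2)
          { grow st d with active := st.active.erase S })

/-- `F` does not separate any pair of satisfied terminals. -/
def KeepsSatisfied (I : PCSF n) (st : State n) (F : SimpleGraph (Fin n)) : Prop :=
  ∀ i ∈ pairs I, st.status i i.1 = Status.satisfied → st.status i i.2 = Status.satisfied →
    F.Reachable i.1 i.2

open Classical in
/-- The deletion phase, with the edges inspected in the order of the list. -/
noncomputable def prune (I : PCSF n) (st : State n) (L : List (Sym2 (Fin n))) :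
    SimpleGraph (Fin n) :=
  L.foldl (fun F e => if KeepsSatisfied I st (F.deleteEdges {e}) then F.deleteEdges {e} else F)
    st.forest

/-- `F` is an output of Primal-Dual Forest on the instance `I`. -/
def Output (I : PCSF n) (F : SimpleGraph (Fin n)) : Prop :=
  ∃ st : State n, Relation.ReflTransGen (Step I) (init I) st ∧ st.active = ∅ ∧
    ∃ L : List (Sym2 (Fin n)), L.Nodup ∧ (∀ e, e ∈ L ↔ e ∈ st.forest.edgeSet) ∧
      F = prune I st L

end PrimalDual

/-! ## The machine model

A random access machine over the reals.  A program uses a fixed finite set of two-dimensional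
arrays of natural numbers (for counters, indices and Boolean data) and of real numbers.  Naturals
can be added, subtracted (truncated at `0`) and compared; reals can be added, subtracted,
multiplied, divided and compared; the only constants are natural numbers.  The only flow of
information from reals to naturals is by comparisons.  Two costs are counted: the number of
elementary operations (unit cost), and the total bit length of all values that occur
(logarithmic cost, meaningful when all numbers are rational). -/

namespace RAM

/-- The bit length of a rational number, written as a reduced fraction. -/
def ratBits (r : ℚ) : ℕ := Nat.size r.num.natAbs + Nat.size r.den + 1

open Classical in
/-- The bit length of a real number that is rational; it is never used for other numbers. -/
noncomputable def realBits (x : ℝ) : ℕ :=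
  if h : ∃ r : ℚ, (r : ℝ) = x then ratBits h.choose else 0

theorem realBits_ratCast (r : ℚ) : realBits (r : ℝ) = ratBits r := by
  have h : ∃ s : ℚ, (s : ℝ) = (r : ℝ) := ⟨r, rfl⟩
  rw [realBits, dif_pos h]
  exact congrArg ratBits (Rat.cast_injective h.choose_spec)

/-- The memory: `nat a i j` and `num a i j` are the entries `(i, j)` of array number `a`. -/
structure Store where
  nat : ℕ → ℕ → ℕ → ℕ
  num : ℕ → ℕ → ℕ → ℝ

/-- Overwrite one natural number. -/
def Store.setNat (σ : Store) (a i j x : ℕ) : Store :=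
  { σ with nat := fun a' i' j' => if a' = a ∧ i' = i ∧ j' = j then x else σ.nat a' i' j' }

/-- Overwrite one real number. -/
noncomputable def Store.setNum (σ : Store) (a i j : ℕ) (x : ℝ) : Store :=
  { σ with num := fun a' i' j' => if a' = a ∧ i' = i ∧ j' = j then x else σ.num a' i' j' }

/-- Expressions for natural numbers. -/
inductive NatExp where
  | const (k : ℕ)
  | cell (a : ℕ) (i j : NatExp)
  | add (e f : NatExp)
  | sub (e f : NatExp)

namespace NatExp

def eval (σ : Store) : NatExp → ℕ
  | const k => k
  | cell a i j => σ.nat a (i.eval σ) (j.eval σ)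
  | add e f => e.eval σ + f.eval σ
  | sub e f => e.eval σ - f.eval σ

/-- Number of elementary operations of an evaluation. -/
def steps : NatExp → ℕ
  | const _ => 1
  | cell _ i j => i.steps + j.steps + 1
  | add e f => e.steps + f.steps + 1
  | sub e f => e.steps + f.steps + 1

/-- Logarithmic cost of an evaluation. -/
def bits (σ : Store) : NatExp → ℕ
  | const k => Nat.size k + 1
  | cell a i j => i.bits σ + j.bits σ + Nat.size ((cell a i j).eval σ) + 1
  | add e f => e.bits σ + f.bits σ + Nat.size ((add e f).eval σ) + 1
  | sub e f => e.bits σ + f.bits σ + Nat.size ((sub e f).eval σ) + 1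

end NatExp

/-- Expressions for real numbers. -/
inductive NumExp where
  | const (k : ℕ)
  | cell (a : ℕ) (i j : NatExp)
  | add (e f : NumExp)
  | sub (e f : NumExp)
  | mul (e f : NumExp)
  | div (e f : NumExp)

namespace NumExp

noncomputable def eval (σ : Store) : NumExp → ℝ
  | const k => k
  | cell a i j => σ.num a (i.eval σ) (j.eval σ)
  | add e f => e.eval σ + f.eval σ
  | sub e f => e.eval σ - f.eval σ
  | mul e f => e.eval σ * f.eval σ
  | div e f => e.eval σ / f.eval σ

/-- Number of elementary operations of an evaluation. -/
def steps : NumExp → ℕ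
  | const _ => 1
  | cell _ i j => i.steps + j.steps + 1
  | add e f => e.steps + f.steps + 1
  | sub e f => e.steps + f.steps + 1
  | mul e f => e.steps + f.steps + 1
  | div e f => e.steps + f.steps + 1

/-- Logarithmic cost of an evaluation. -/
noncomputable def bits (σ : Store) : NumExp → ℕ
  | const k => realBits (k : ℝ) + 1
  | cell a i j => i.bits σ + j.bits σ + realBits ((cell a i j).eval σ) + 1
  | add e f => e.bits σ + f.bits σ + realBits ((add e f).eval σ) + 1
  | sub e f => e.bits σ + f.bits σ + realBits ((sub e f).eval σ) + 1
  | mul e f => e.bits σ + f.bits σ + realBits ((mul e f).eval σ) + 1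
  | div e f => e.bits σ + f.bits σ + realBits ((div e f).eval σ) + 1

end NumExp

/-- Tests. -/
inductive Test where
  | natLe (e f : NatExp)
  | numLe (e f : NumExp)
  | neg (b : Test)
  | both (b c : Test)

namespace Test

def Holds (σ : Store) : Test → Prop
  | natLe e f => e.eval σ ≤ f.eval σ
  | numLe e f => e.eval σ ≤ f.eval σ
  | neg b => ¬ b.Holds σ
  | both b c => b.Holds σ ∧ c.Holds σ

def steps : Test → ℕ
  | natLe e f => e.steps + f.steps + 1
  | numLe e f => e.steps + f.steps + 1
  | neg b => b.steps + 1
  | both b c => b.steps + c.steps + 1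

noncomputable def bits (σ : Store) : Test → ℕ
  | natLe e f => e.bits σ + f.bits σ + 1
  | numLe e f => e.bits σ + f.bits σ + 1
  | neg b => b.bits σ + 1
  | both b c => b.bits σ + c.bits σ + 1

end Test

/-- Programs. -/
inductive Program where
  | skip
  | setNat (a : ℕ) (i j e : NatExp)
  | setNum (a : ℕ) (i j : NatExp) (e : NumExp)
  | seq (P Q : Program)
  | cond (b : Test) (P Q : Program)
  | loop (b : Test) (P : Program)

/-- `Exec P σ t b τ`: started in the store `σ`, the program `P` halts in the store `τ`, after `t`
elementary operations, and with logarithmic cost `b`. -/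
inductive Exec : Program → Store → ℕ → ℕ → Store → Prop
  | skip (σ : Store) : Exec .skip σ 1 1 σ
  | setNat (σ : Store) (a : ℕ) (i j e : NatExp) :
      Exec (.setNat a i j e) σ (i.steps + j.steps + e.steps + 1)
        (i.bits σ + j.bits σ + e.bits σ + 1)
        (σ.setNat a (i.eval σ) (j.eval σ) (e.eval σ))
  | setNum (σ : Store) (a : ℕ) (i j : NatExp) (e : NumExp) :
      Exec (.setNum a i j e) σ (i.steps + j.steps + e.steps + 1)
        (i.bits σ + j.bits σ + e.bits σ + 1)
        (σ.setNum a (i.eval σ) (j.eval σ) (e.eval σ))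
  | seq {P Q : Program} {σ τ ρ : Store} {t b t' b' : ℕ} :
      Exec P σ t b τ → Exec Q τ t' b' ρ → Exec (.seq P Q) σ (t + t') (b + b') ρ
  | condTrue {c : Test} {P Q : Program} {σ τ : Store} {t b : ℕ} :
      c.Holds σ → Exec P σ t b τ → Exec (.cond c P Q) σ (c.steps + t) (c.bits σ + b) τ
  | condFalse {c : Test} {P Q : Program} {σ τ : Store} {t b : ℕ} :
      ¬ c.Holds σ → Exec Q σ t b τ → Exec (.cond c P Q) σ (c.steps + t) (c.bits σ + b) τ
  | loopStop {c : Test} {P : Program} {σ : Store} :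
      ¬ c.Holds σ → Exec (.loop c P) σ c.steps (c.bits σ) σ
  | loopStep {c : Test} {P : Program} {σ τ ρ : Store} {t b t' b' : ℕ} :
      c.Holds σ → Exec P σ t b τ → Exec (.loop c P) τ t' b' ρ →
      Exec (.loop c P) σ (c.steps + t + t') (c.bits σ + b + b') ρ

end RAM

/-! ## Input and output of the machine -/

namespace PCSF

variable {n : ℕ}

open Classical in
/-- The cost matrix: the cost of the edge `uv`, and `0` if there is no such edge. -/
noncomputable def costEntry (I : PCSF n) (u v : Fin n) : ℝ :=
  if I.graph.Adj u v then I.cost s(u, v) else 0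

/-- The penalty matrix, with zero diagonal. -/
def penaltyEntry (I : PCSF n) (u v : Fin n) : ℝ :=
  if u = v then 0 else I.penalty s(u, v)

open Classical in
/-- The input of the machine: `n` in the natural array `0`, the adjacency matrix in the natural
array `1`, `ε` in the real array `0`, the cost matrix in the real array `1`, the penalty
matrix in the real array `2`; everything else is `0`. -/
noncomputable def input (I : PCSF n) (ε : ℝ) : RAM.Store where
  nat a i j :=
    if a = 0 ∧ i = 0 ∧ j = 0 then n
    else if h : a = 1 ∧ i < n ∧ j < n then
      (if I.graph.Adj ⟨i, h.2.1⟩ ⟨j, h.2.2⟩ then 1 else 0)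
    else 0
  num a i j :=
    if a = 0 ∧ i = 0 ∧ j = 0 then ε
    else if h : a = 1 ∧ i < n ∧ j < n then I.costEntry ⟨i, h.2.1⟩ ⟨j, h.2.2⟩
    else if h : a = 2 ∧ i < n ∧ j < n then I.penaltyEntry ⟨i, h.2.1⟩ ⟨j, h.2.2⟩
    else 0

/-- All numbers in the input are rational. -/
def IsRational (I : PCSF n) (ε : ℝ) : Prop :=
  (∃ r : ℚ, (r : ℝ) = ε) ∧
    ∀ u v, (∃ r : ℚ, (r : ℝ) = I.costEntry u v) ∧ ∃ r : ℚ, (r : ℝ) = I.penaltyEntry u v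

/-- The bit length of a rational input. -/
noncomputable def inputBits (I : PCSF n) (ε : ℝ) : ℕ :=
  n + RAM.realBits ε +
    ∑ u, ∑ v, (1 + RAM.realBits (I.costEntry u v) + RAM.realBits (I.penaltyEntry u v))

end PCSF

/-- The natural array `2` of the store holds the adjacency matrix of `F`. -/
def RAM.Store.Represents {n : ℕ} (σ : RAM.Store) (F : SimpleGraph (Fin n)) : Prop :=
  ∀ u v : Fin n, (F.Adj u v → σ.nat 2 u v = 1) ∧ (¬ F.Adj u v → σ.nat 2 u v = 0)

/-!
Primal-Dual Forest raises dual variables `y(S)`, and a charging scheme splits every `y(S)` into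
shares of the terminal pairs.  The cost bounds come from three properties of the final shares
(`PrimalDual.Output.certificate`).

* All growth is charged.  The invariant behind it (`PrimalDual.Charges`) is a Hall condition: for
  every vertex set `X`, the uncharged growth of the sets inside `X` is at most the charge still
  available at the alive terminals in `X`.  ProcessHistory preserves it because it charges small sets
  first (`PrimalDual.Charges.charge`); growth preserves it because the potential of a component
  equals the slack of the condition for that component.  At the end no terminal is alive, so nothing
  is left uncharged.
* The sum of all `y(S)` pays for half of the edges of the output `F`.  At any moment, contract the
  components of the current forest: `F` becomes a forest none of whose leaves is inactive, because the
  edge at an inactive leaf would have been deleted, so the active components have average degree at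
  most `2` (`PrimalDual.Inv.sum_cuts_le`).
* A pair that `F` does not connect is dead and has been charged at least half of its penalty, while no
  pair is charged more than its penalty; and on the pairs that a subgraph `G` connects, the charges
  add up to at most the length of `G`, since `G` crosses every set that separates such a pair.

With penalties scaled by `2 / ε`, comparing with an optimal forest `Fo` bounds the total charge by
`(2 / ε) OPT`, hence the cost of `F` by `(8 / ε) OPT`.  The pairs connected by `Fo` but not by `F` have
scaled penalty at most twice the length of `Fo`, hence true penalty at most `ε` times that length;
paying for them in addition to the penalties of `Fo` gives the paying solution
(`PrimalDual.Output.guarantees`).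

The machine program is verified with a calculus of preconditions `RAM.wp`, in which loops carry
counted invariants, so that total correctness and the time bound come together (`RAM.wp_sound`).  The
relation `RAM.Rep` says that a store represents a state of the algorithm; each part of the program
simulates a step, and since each step decreases the number of components plus the number of active
components, `2 n` rounds suffice (`RAM.wp_mainLoop`).  Ties are resolved by the order of inspection,
which the loop invariants exhibit as the lists that the definition of a step asks for.

For the logarithmic cost, the program multiplies no reals and divides only by `2` and by `ε`.  If all
values are bounded by `Q` and are multiples of `1 / Q`, then after `t` operations the same holds with
`Q * K ^ t` for a constant `K` depending on `ε` (`RAM.Exec.bits_le`), so that all bit lengths are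
linear in `t` and in the size of the input.
-/


/-! ### Connected components of a graph under addition of edges -/

namespace PrimalDual

section Clusters

variable {V : Type*}

theorem reachable_sup_edge_iff (G : SimpleGraph V) (u v a b : V) :
    (G ⊔ SimpleGraph.edge u v).Reachable a b ↔
      G.Reachable a b ∨ (G.Reachable a u ∧ G.Reachable v b) ∨
        (G.Reachable a v ∧ G.Reachable u b) := by
  constructor
  · rintro ⟨p⟩
    induction p with
    | nil => exact Or.inl (SimpleGraph.Reachable.refl _)
    | @cons a c b h p ih =>
      rw [SimpleGraph.sup_adj, SimpleGraph.edge_adj] at h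
      have step : G.Reachable a c ∨ (a = u ∧ c = v) ∨ (a = v ∧ c = u) := by
        rcases h with h | ⟨h, -⟩
        · exact Or.inl h.reachable
        · exact Or.inr h
      rcases step with h | ⟨rfl, rfl⟩ | ⟨rfl, rfl⟩
      · rcases ih with h1 | ⟨h1, h2⟩ | ⟨h1, h2⟩
        · exact Or.inl (h.trans h1)
        · exact Or.inr (Or.inl ⟨h.trans h1, h2⟩)
        · exact Or.inr (Or.inr ⟨h.trans h1, h2⟩)
      · rcases ih with h1 | ⟨h1, h2⟩ | ⟨h1, h2⟩
        · exact Or.inr (Or.inl ⟨.refl _, h1⟩)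
        · exact Or.inr (Or.inl ⟨.refl _, h2⟩)
        · exact Or.inl h2
      · rcases ih with h1 | ⟨h1, h2⟩ | ⟨h1, h2⟩
        · exact Or.inr (Or.inr ⟨.refl _, h1⟩)
        · exact Or.inl h2
        · exact Or.inr (Or.inr ⟨.refl _, h2⟩)
  · have hle : G ≤ G ⊔ SimpleGraph.edge u v := le_sup_left
    have huv : (G ⊔ SimpleGraph.edge u v).Reachable u v := by
      by_cases h : u = v
      · subst h; exact .refl _
      · exact SimpleGraph.Adj.reachable (by simp [SimpleGraph.edge_adj, h])
    rintro (h | ⟨h1, h2⟩ | ⟨h1, h2⟩)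
    · exact h.mono hle
    · exact (h1.mono hle).trans (huv.trans (h2.mono hle))
    · exact (h1.mono hle).trans (huv.symm.trans (h2.mono hle))

variable [Fintype V]

open Classical in
/-- The vertex set of the connected component of `u` in `G`. -/
noncomputable def cluster (G : SimpleGraph V) (u : V) : Finset V := {v | G.Reachable u v}

@[simp] theorem mem_cluster {G : SimpleGraph V} {u v : V} :
    v ∈ cluster G u ↔ G.Reachable u v := by simp [cluster]

theorem mem_cluster_self (G : SimpleGraph V) (u : V) : u ∈ cluster G u := by simp

theorem cluster_eq_of_reachable {G : SimpleGraph V} {u v : V} (h : G.Reachable u v) :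
    cluster G u = cluster G v := by
  ext w; simp only [mem_cluster]; exact ⟨fun h' => h.symm.trans h', fun h' => h.trans h'⟩

theorem cluster_eq_iff {G : SimpleGraph V} {u v : V} :
    cluster G u = cluster G v ↔ G.Reachable u v :=
  ⟨fun h => by rw [← mem_cluster, h]; exact mem_cluster_self G v, cluster_eq_of_reachable⟩

theorem cluster_eq_of_mem {G : SimpleGraph V} {u v : V} (h : v ∈ cluster G u) :
    cluster G v = cluster G u := (cluster_eq_of_reachable (mem_cluster.1 h)).symm

theorem cluster_sup_edge_left [DecidableEq V] (G : SimpleGraph V) {u v a : V}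
    (h : a ∈ cluster G u ∪ cluster G v) :
    cluster (G ⊔ SimpleGraph.edge u v) a = cluster G u ∪ cluster G v := by
  ext b
  simp only [mem_cluster, Finset.mem_union, reachable_sup_edge_iff] at h ⊢
  constructor
  · rintro (h1 | ⟨-, h2⟩ | ⟨-, h2⟩)
    · exact h.imp (fun h => h.trans h1) (fun h => h.trans h1)
    · exact Or.inr h2
    · exact Or.inl h2
  · rintro (h1 | h1) <;> rcases h with h | h
    · exact Or.inl (h.symm.trans h1)
    · exact Or.inr (Or.inr ⟨h.symm, h1⟩)
    · exact Or.inr (Or.inl ⟨h.symm, h1⟩)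
    · exact Or.inl (h.symm.trans h1)

theorem cluster_sup_edge_of_notMem [DecidableEq V] (G : SimpleGraph V) {u v a : V}
    (h : a ∉ cluster G u ∪ cluster G v) :
    cluster (G ⊔ SimpleGraph.edge u v) a = cluster G a := by
  ext b
  simp only [mem_cluster, Finset.mem_union, reachable_sup_edge_iff, not_or] at h ⊢
  constructor
  · rintro (h1 | ⟨h1, -⟩ | ⟨h1, -⟩)
    · exact h1
    · exact absurd h1.symm h.1
    · exact absurd h1.symm h.2
  · exact Or.inl

open Classical in
/-- The vertex sets of the connected components of `G`. -/
noncomputable def clusters (G : SimpleGraph V) : Finset (Finset V) :=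
  Finset.univ.image (cluster G)

theorem cluster_mem_clusters (G : SimpleGraph V) (u : V) : cluster G u ∈ clusters G := by
  simp [clusters]

theorem mem_clusters {G : SimpleGraph V} {S : Finset V} :
    S ∈ clusters G ↔ ∃ u, cluster G u = S := by simp [clusters]

open Classical in
theorem card_clusters_le (G : SimpleGraph V) : (clusters G).card ≤ Fintype.card V :=
  Finset.card_image_le

theorem card_clusters_sup_edge {G : SimpleGraph V} {u v : V} (h : ¬ G.Reachable u v) :
    (clusters (G ⊔ SimpleGraph.edge u v)).card + 1 ≤ (clusters G).card := by
  classical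
  have hsub : clusters (G ⊔ SimpleGraph.edge u v) ⊆
      insert (cluster G u ∪ cluster G v) (((clusters G).erase (cluster G u)).erase
        (cluster G v)) := by
    intro S hS
    obtain ⟨a, rfl⟩ := mem_clusters.1 hS
    by_cases ha : a ∈ cluster G u ∪ cluster G v
    · rw [cluster_sup_edge_left G ha]; exact Finset.mem_insert_self _ _
    · rw [cluster_sup_edge_of_notMem G ha]
      refine Finset.mem_insert_of_mem (Finset.mem_erase.2 ⟨?_, Finset.mem_erase.2
        ⟨?_, cluster_mem_clusters G a⟩⟩)
      · intro h'; exact ha (Finset.mem_union_right _ (h' ▸ mem_cluster_self G a))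
      · intro h'; exact ha (Finset.mem_union_left _ (h' ▸ mem_cluster_self G a))
  have h1 := Finset.card_le_card hsub
  have h2 := Finset.card_insert_le (cluster G u ∪ cluster G v)
    (((clusters G).erase (cluster G u)).erase (cluster G v))
  have hne : cluster G v ≠ cluster G u := fun h' => h (cluster_eq_iff.1 h').symm
  have h3 := Finset.card_erase_add_one (Finset.mem_erase.2 ⟨hne, cluster_mem_clusters G v⟩)
  have h4 := Finset.card_erase_add_one (cluster_mem_clusters G u)
  omega

/-- Each edge added to a forest, keeping it a forest, destroys a component. -/
theorem card_add_card_clusters_le (H : SimpleGraph V) (D : Finset (Sym2 V))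
    (hac : (H ⊔ SimpleGraph.fromEdgeSet (D : Set (Sym2 V))).IsAcyclic)
    (hD : ∀ u v, s(u, v) ∈ D → u ≠ v ∧ ¬ H.Adj u v) :
    D.card + (clusters (H ⊔ SimpleGraph.fromEdgeSet (D : Set (Sym2 V)))).card ≤
      (clusters H).card := by
  classical
  induction D using Finset.induction_on with
  | empty => simp
  | insert e D he ih =>
    induction e with
    | h u v =>
    have heq : H ⊔ SimpleGraph.fromEdgeSet ((insert s(u, v) D : Finset _) : Set (Sym2 V)) =
        (H ⊔ SimpleGraph.fromEdgeSet (D : Set (Sym2 V))) ⊔ SimpleGraph.edge u v := by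
      rw [sup_assoc, SimpleGraph.edge, ← SimpleGraph.fromEdgeSet_union, Finset.coe_insert,
        Set.insert_eq, Set.union_comm]
    rw [heq] at hac ⊢
    obtain ⟨hac', hreach⟩ := SimpleGraph.isAcyclic_sup_fromEdgeSet_iff.1 hac
    have hnr : ¬ (H ⊔ SimpleGraph.fromEdgeSet (D : Set (Sym2 V))).Reachable u v := by
      intro h
      have huv := hD u v (Finset.mem_insert_self _ _)
      rcases hreach h with h | h
      · exact huv.1 h
      · rw [SimpleGraph.sup_adj, SimpleGraph.fromEdgeSet_adj] at h
        exact h.elim huv.2 fun h => he h.1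
    have := ih hac' fun a b h => hD a b (Finset.mem_insert_of_mem h)
    have := card_clusters_sup_edge hnr
    rw [Finset.card_insert_of_notMem he]
    omega

end Clusters

variable {n : ℕ}

theorem cuts_mk {S : Finset (Fin n)} {u v : Fin n} :
    Cuts S s(u, v) ↔ (u ∈ S ∧ v ∉ S) ∨ (v ∈ S ∧ u ∉ S) := by
  simp only [Cuts, Sym2.mem_iff]
  constructor
  · rintro ⟨⟨a, rfl | rfl, ha⟩, b, rfl | rfl, hb⟩ <;> tauto
  · rintro (h | h)
    · exact ⟨⟨u, Or.inl rfl, h.1⟩, v, Or.inr rfl, h.2⟩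
    · exact ⟨⟨v, Or.inr rfl, h.1⟩, u, Or.inl rfl, h.2⟩

theorem cuts_cluster_mk {G : SimpleGraph (Fin n)} {u v : Fin n} {S : Finset (Fin n)}
    (hS : S ∈ clusters G) :
    Cuts S s(u, v) ↔ ¬ G.Reachable u v ∧ (S = cluster G u ∨ S = cluster G v) := by
  obtain ⟨a, rfl⟩ := mem_clusters.1 hS
  rw [cuts_mk, cluster_eq_iff, cluster_eq_iff, mem_cluster, mem_cluster]
  constructor
  · rintro (⟨h1, h2⟩ | ⟨h1, h2⟩)
    · exact ⟨fun h => h2 (h1.trans h), Or.inl h1⟩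
    · exact ⟨fun h => h2 (h1.trans h.symm), Or.inr h1⟩
  · rintro ⟨h, h1 | h1⟩
    · exact Or.inl ⟨h1, fun h2 => h (h1.symm.trans h2)⟩
    · exact Or.inr ⟨h1, fun h2 => h (h2.symm.trans h1)⟩

open Classical in
/-- If `D` extends the forest `H` to a larger forest and every component outside `A` that is
touched by `D` is touched at least twice, then the components in `A` have average degree at
most `2`: the components are the vertices of a forest with edge set `D`, none of whose leaves lies
outside `A`. -/
theorem sum_card_cuts_le (H : SimpleGraph (Fin n)) (D : Finset (Sym2 (Fin n)))
    (hac : (H ⊔ SimpleGraph.fromEdgeSet (D : Set (Sym2 (Fin n)))).IsAcyclic)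
    (hD : ∀ u v, s(u, v) ∈ D → ¬ H.Reachable u v)
    (A : Finset (Finset (Fin n))) (hA : A ⊆ clusters H)
    (hleaf : ∀ S ∈ clusters H, S ∉ A → (D.filter (Cuts S)).card ≠ 1) :
    ∑ S ∈ A, (D.filter (Cuts S)).card ≤ 2 * A.card := by
  set K := H ⊔ SimpleGraph.fromEdgeSet (D : Set (Sym2 (Fin n))) with hK
  have h1 : D.card + (clusters K).card ≤ (clusters H).card :=
    card_add_card_clusters_le H D hac fun u v h =>
      ⟨fun h' => hD u v h (h' ▸ .refl _), fun h' => hD u v h h'.reachable⟩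
  -- components not touched by `D` survive
  have h2 : (clusters H).filter (fun S => (D.filter (Cuts S)).card = 0) ⊆ clusters K := by
    intro S hS
    obtain ⟨hS, h0⟩ := Finset.mem_filter.1 hS
    obtain ⟨a, rfl⟩ := mem_clusters.1 hS
    refine mem_clusters.2 ⟨a, ?_⟩
    have hno : ∀ e ∈ D, ¬ Cuts (cluster H a) e := by
      intro e he hc
      have : e ∈ D.filter (Cuts (cluster H a)) := Finset.mem_filter.2 ⟨he, hc⟩
      rw [Finset.card_eq_zero.1 h0] at this
      simp at this
    ext b
    rw [mem_cluster, mem_cluster]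
    refine ⟨?_, fun h => h.mono le_sup_left⟩
    rintro ⟨p⟩
    suffices ∀ c d, K.Walk c d → H.Reachable a c → H.Reachable a d from this a b p (.refl _)
    intro c d p
    induction p with
    | nil => exact id
    | @cons c d e h p ih =>
      intro hc
      apply ih
      rw [hK, SimpleGraph.sup_adj, SimpleGraph.fromEdgeSet_adj] at h
      rcases h with h | ⟨h, -⟩
      · exact hc.trans h.reachable
      · by_contra hd
        exact hno _ h (cuts_mk.2 (Or.inl ⟨by simpa using hc, by simpa using hd⟩))
  -- every edge of `D` touches exactly two components
  have h3 : ∑ S ∈ clusters H, (D.filter (Cuts S)).card = 2 * D.card := by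
    simp only [Finset.card_filter]
    rw [Finset.sum_comm, mul_comm, ← smul_eq_mul, ← Finset.sum_const]
    refine Finset.sum_congr rfl fun e he => ?_
    induction e with
    | h u v =>
    rw [← Finset.card_filter]
    have hne : cluster H u ≠ cluster H v := fun h' => hD u v he (cluster_eq_iff.1 h')
    have : (clusters H).filter (fun S => Cuts S s(u, v)) = {cluster H u, cluster H v} := by
      ext S
      rw [Finset.mem_filter, Finset.mem_insert, Finset.mem_singleton]
      constructor
      · rintro ⟨hS, hc⟩; exact ((cuts_cluster_mk hS).1 hc).2
      · intro h
        have hS : S ∈ clusters H := by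
          rcases h with rfl | rfl <;> exact cluster_mem_clusters _ _
        exact ⟨hS, (cuts_cluster_mk hS).2 ⟨hD u v he, h⟩⟩
    rw [this, Finset.card_pair hne]
  have h4 := Finset.card_le_card h2
  have h5 := Finset.card_filter_add_card_filter_not (s := clusters H)
    (fun S => (D.filter (Cuts S)).card = 0)
  have h6 : (clusters H).filter (fun S => ¬ (D.filter (Cuts S)).card = 0) =
      A.filter (fun S => ¬ (D.filter (Cuts S)).card = 0) ∪
      (clusters H \ A).filter (fun S => ¬ (D.filter (Cuts S)).card = 0) := by
    rw [← Finset.filter_union, Finset.union_sdiff_of_subset hA]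
  have h7 := Finset.card_union_le (A.filter (fun S => ¬ (D.filter (Cuts S)).card = 0))
      ((clusters H \ A).filter (fun S => ¬ (D.filter (Cuts S)).card = 0))
  rw [← h6] at h7
  have h8 : 2 * ((clusters H \ A).filter (fun S => ¬ (D.filter (Cuts S)).card = 0)).card ≤
      ∑ S ∈ clusters H \ A, (D.filter (Cuts S)).card := by
    rw [mul_comm, ← smul_eq_mul, ← Finset.sum_const, Finset.sum_filter]
    refine Finset.sum_le_sum fun S hS => ?_
    obtain ⟨hS, hSA⟩ := Finset.mem_sdiff.1 hS
    have := hleaf S hS hSA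
    split_ifs <;> omega
  have h9 := Finset.sum_sdiff (f := fun S => (D.filter (Cuts S)).card) hA
  have h10 := Finset.card_filter_le A (fun S => ¬ (D.filter (Cuts S)).card = 0)
  omega

end PrimalDual

/-! ### Charging the growth to the terminals -/

namespace PrimalDual

section ChargeLoop

variable {n : ℕ}

/-- What the loop of ProcessHistory does: the amount `unch S - u' S` is moved from the uncharged
growth to the share of every set `S` of the list, the total amount being the spent charge, and a set
is touched only if all earlier sets are charged completely. -/
theorem chargeLoop_spec (L : List (Finset (Fin n))) (hL : L.Nodup) :
    ∀ (r : ℝ) (unch sh : Finset (Fin n) → ℝ), 0 ≤ r → (∀ S, 0 ≤ unch S) →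
      (∀ S ∈ L, sh S = 0) →
      ∀ (r' : ℝ) (u' s' : Finset (Fin n) → ℝ), chargeLoop r unch sh L = (r', u', s') →
      0 ≤ r' ∧ (∀ S, 0 ≤ u' S) ∧ (∀ S, u' S ≤ unch S) ∧ (∀ S, S ∉ L → u' S = unch S) ∧
      (∀ S, s' S = sh S + (unch S - u' S)) ∧
      (r' + ∑ S ∈ L.toFinset, (unch S - u' S) = r) ∧
      L.Pairwise (fun S T => u' S = 0 ∨ u' T = unch T) ∧
      (∀ S ∈ L, u' S ≠ 0 → r' = 0) := by
  induction L with
  | nil =>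
    intro r unch sh hr hu _ r' u' s' h
    simp only [chargeLoop, Prod.mk.injEq] at h
    obtain ⟨rfl, rfl, rfl⟩ := h
    simp [hr, hu]
  | cons S L ih =>
    obtain ⟨hSL, hL⟩ := List.nodup_cons.1 hL
    intro r unch sh hr hu hsh r' u' s' h
    rw [chargeLoop] at h
    split_ifs at h with hle
    · have hne : ∀ T ∈ L, T ≠ S := fun T hT h' => hSL (h' ▸ hT)
      obtain ⟨a1, a2, a3, a4, a5, a6, a7, a8⟩ := ih hL (r - unch S) (Function.update unch S 0)
        (Function.update sh S (unch S)) (by linarith)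
        (fun T => by
          by_cases hT : T = S
          · subst hT; simp
          · simpa [hT] using hu T)
        (fun T hT => by simpa [hne T hT] using hsh T (List.mem_cons_of_mem _ hT)) r' u' s' h
      have hS0 : u' S = 0 := by simpa using a4 S hSL
      refine ⟨a1, a2, fun T => ?_, fun T hT => ?_, fun T => ?_, ?_, ?_, ?_⟩
      · by_cases hT : T = S
        · subst hT; rw [hS0]; exact hu T
        · simpa [hT] using a3 T
      · have hTS : T ≠ S := fun h' => hT (h' ▸ List.mem_cons_self)
        simpa [hTS] using a4 T (fun h' => hT (List.mem_cons_of_mem _ h'))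
      · by_cases hT : T = S
        · subst hT
          have := a5 T
          simp only [Function.update_self] at this
          rw [this, hS0, hsh T List.mem_cons_self]; ring
        · simpa [hT] using a5 T
      · rw [List.toFinset_cons, Finset.sum_insert (by simpa using hSL)]
        have : ∑ T ∈ L.toFinset, (unch T - u' T) =
            ∑ T ∈ L.toFinset, (Function.update unch S 0 T - u' T) :=
          Finset.sum_congr rfl fun T hT => by simp [hne T (by simpa using hT)]
        rw [this, hS0]; linarith
      · refine List.pairwise_cons.2 ⟨fun T _ => Or.inl hS0, ?_⟩
        refine a7.imp_of_mem fun {A B} _ hB h' => ?_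
        simpa [hne B hB] using h'
      · intro T hT h0
        rcases List.mem_cons.1 hT with rfl | hT
        · exact absurd hS0 h0
        · exact a8 T hT h0
    · simp only [Prod.mk.injEq] at h
      obtain ⟨rfl, rfl, rfl⟩ := h
      have hne : ∀ T ∈ L, T ≠ S := fun T hT h' => hSL (h' ▸ hT)
      refine ⟨le_rfl, fun T => ?_, fun T => ?_, fun T hT => ?_, fun T => ?_, ?_, ?_, ?_⟩
      · by_cases hT : T = S
        · subst hT; simp only [Function.update_self]; linarith
        · simpa [hT] using hu T
      · by_cases hT : T = S
        · subst hT; simp only [Function.update_self]; linarith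
        · simp [hT]
      · have hTS : T ≠ S := fun h' => hT (h' ▸ List.mem_cons_self)
        simp [hTS]
      · by_cases hT : T = S
        · subst hT; simp [hsh T List.mem_cons_self]
        · simp [hT]
      · rw [List.toFinset_cons, Finset.sum_insert (by simpa using hSL)]
        rw [Finset.sum_eq_zero fun T hT => by simp [hne T (by simpa using hT)]]
        simp
      · refine List.pairwise_cons.2 ⟨fun T hT => Or.inr (by simp [hne T hT]), ?_⟩
        exact List.pairwise_of_forall_mem_list fun A _ B hB => Or.inr (by simp [hne B hB])
      · intros; rfl

end ChargeLoop

variable {n : ℕ}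

theorem mem_history {st : State n} {u : Fin n} {T : Finset (Fin n)} :
    T ∈ history st u ↔ T ∈ st.formed ∧ u ∈ T := by
  simp [history]

theorem nodup_history (st : State n) (u : Fin n) : (history st u).Nodup :=
  (List.mergeSort_perm _ _).nodup_iff.2 (Finset.nodup_toList _)

theorem pairwise_history (st : State n) (u : Fin n) :
    (history st u).Pairwise (fun S T => S.card ≤ T.card) := by
  have := List.pairwise_mergeSort (le := fun S T : Finset (Fin n) => decide (S.card ≤ T.card))
    (fun a b c h1 h2 => by simp only [decide_eq_true_eq] at *; omega)
    (fun a b => by simp only [Bool.or_eq_true, decide_eq_true_eq]; omega)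
    (st.formed.filter (fun S => u ∈ S)).toList
  simpa [history] using this

open Classical in
/-- The terminals: pairs with positive penalty, together with one of the endpoints. -/
noncomputable def terms (I : PCSF n) : Finset ((Fin n × Fin n) × Fin n) :=
  {x | x.1 ∈ pairs I ∧ (x.2 = x.1.1 ∨ x.2 = x.1.2)}

theorem mem_terms {I : PCSF n} {x : (Fin n × Fin n) × Fin n} :
    x ∈ terms I ↔ x.1 ∈ pairs I ∧ (x.2 = x.1.1 ∨ x.2 = x.1.2) := by simp [terms]

theorem mem_pairs {I : PCSF n} {i : Fin n × Fin n} :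
    i ∈ pairs I ↔ i.1 < i.2 ∧ 0 < I.penalty s(i.1, i.2) := by simp [pairs]

theorem pen_nonneg (I : PCSF n) (i : Fin n × Fin n) : 0 ≤ pen I i := I.penalty_nonneg _

open Classical in
/-- The total charge still available at the alive terminals in `X`. -/
noncomputable def aliveSum (I : PCSF n) (st : State n) (X : Finset (Fin n)) : ℝ :=
  ∑ x ∈ terms I with x.2 ∈ X ∧ st.status x.1 x.2 = Status.alive, pen I x.1 / 2

open Classical in
/-- The total uncharged growth of the subsets of `X`. -/
noncomputable def unchSum (st : State n) (X : Finset (Fin n)) : ℝ :=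
  ∑ T ∈ st.formed with T ⊆ X, st.uncharged T

/-- The invariants of the charging scheme.  The main one, `hall`, is a Hall condition: the
uncharged growth inside any set of vertices can still be paid by the alive terminals there. -/
structure Charges (I : PCSF n) (st : State n) : Prop where
  unch_nonneg : ∀ T, 0 ≤ st.uncharged T
  share_nonneg : ∀ i T, 0 ≤ st.share i T
  hall : ∀ X, unchSum st X ≤ aliveSum I st X
  y_eq : ∀ T ∈ st.formed, st.y T = st.uncharged T + ∑ i ∈ pairs I, st.share i T
  share_supp : ∀ i ∈ pairs I, ∀ T, st.share i T ≠ 0 → T ∈ st.formed ∧ (i.1 ∈ T ↔ i.2 ∉ T)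
  share_alive : ∀ i u, (i, u) ∈ terms I → st.status i u = Status.alive →
    ∀ T, u ∈ T → st.share i T = 0
  share_le : ∀ i u, (i, u) ∈ terms I →
    ∑ T ∈ st.formed with u ∈ T, st.share i T ≤ pen I i / 2
  dead_share : ∀ i u, (i, u) ∈ terms I → st.status i u = Status.dead →
    pen I i / 2 ≤ ∑ T ∈ st.formed, st.share i T

theorem unchSum_nonneg {I : PCSF n} {st : State n} (h : Charges I st) (X : Finset (Fin n)) :
    0 ≤ unchSum st X := Finset.sum_nonneg fun T _ => h.unch_nonneg T

open Classical in
theorem aliveSum_update {I : PCSF n} {st st' : State n} {i : Fin n × Fin n} {u : Fin n}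
    {a : Status} (hx : (i, u) ∈ terms I) (hal : st.status i u = Status.alive)
    (ha : a ≠ Status.alive) (hst : st'.status = (mark st i u a).status) (X : Finset (Fin n)) :
    aliveSum I st' X = aliveSum I st X - if u ∈ X then pen I i / 2 else 0 := by
  have key : ∀ x : (Fin n × Fin n) × Fin n, (x.2 ∈ X ∧ st'.status x.1 x.2 = Status.alive) ↔
      (x.2 ∈ X ∧ st.status x.1 x.2 = Status.alive) ∧ x ≠ (i, u) := by
    rintro ⟨j, v⟩
    simp only [hst, mark, Function.update_apply]
    by_cases hj : j = i
    · subst hj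
      by_cases hv : v = u
      · subst hv; simp [ha]
      · simp [hv]
    · simp [hj]
  have : (terms I).filter (fun x => x.2 ∈ X ∧ st'.status x.1 x.2 = Status.alive) =
      ((terms I).filter (fun x => x.2 ∈ X ∧ st.status x.1 x.2 = Status.alive)).erase (i, u) := by
    ext x
    simp only [Finset.mem_filter, Finset.mem_erase, key]
    tauto
  rw [aliveSum, this, aliveSum]
  split_ifs with hu
  · rw [← Finset.sum_erase_add _ _ (Finset.mem_filter.2 ⟨hx, hu, hal⟩)]
    simp
  · rw [Finset.erase_eq_of_notMem (fun h => hu (Finset.mem_filter.1 h).2.1)]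
    simp

theorem aliveSum_erase {I : PCSF n} {st : State n} {i : Fin n × Fin n} {u : Fin n}
    (hx : (i, u) ∈ terms I) (hal : st.status i u = Status.alive) {X : Finset (Fin n)}
    (hu : u ∈ X) : aliveSum I st (X.erase u) + pen I i / 2 ≤ aliveSum I st X := by
  classical
  have hmem : (i, u) ∈ (terms I).filter (fun x => x.2 ∈ X ∧ st.status x.1 x.2 = Status.alive) :=
    Finset.mem_filter.2 ⟨hx, hu, hal⟩
  rw [aliveSum, aliveSum, ← Finset.sum_erase_add _ _ hmem]
  refine add_le_add ?_ le_rfl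
  refine Finset.sum_le_sum_of_subset_of_nonneg (fun x hx => ?_)
    fun x _ _ => div_nonneg (pen_nonneg _ _) zero_le_two
  simp only [Finset.mem_filter, Finset.mem_erase] at hx ⊢
  exact ⟨fun h => hx.2.1.1 (by rw [h]), hx.1, hx.2.1.2, hx.2.2⟩

/-- ProcessHistory for an alive terminal that thereby ceases to be alive.  The Hall condition
survives because the charge goes to the smaller sets first: for a set `X` containing the terminal,
either the whole charge is spent inside `X`, or no uncharged growth is left on the subsets of `X`
containing the terminal and the condition for `X` without the terminal applies. -/
theorem Charges.charge {I : PCSF n} {st st' : State n} (h : Charges I st)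
    {i : Fin n × Fin n} {u : Fin n} {a : Status}
    (hx : (i, u) ∈ terms I) (hal : st.status i u = Status.alive) (ha : a ≠ Status.alive)
    (hchain : ∀ S ∈ st.formed, ∀ T ∈ st.formed, u ∈ S → u ∈ T → S ⊆ T ∨ T ⊆ S)
    (hboth : ∀ T ∈ st.formed, i.1 ∈ T → i.2 ∈ T → st.uncharged T = 0)
    (hf : st'.formed = st.formed) (hy : st'.y = st.y)
    (hun : st'.uncharged = (historyState I st i u).uncharged)
    (hsh : st'.share = (historyState I st i u).share)
    (hst : st'.status = (mark st i u a).status)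
    (hdead : a = Status.dead → historyRest I st i u = 0 ∨
      pen I i / 2 ≤ ∑ T ∈ st.formed, st.share i T) :
    0 ≤ historyRest I st i u ∧ Charges I st' ∧
    (∀ T, st'.uncharged T ≤ st.uncharged T) ∧
    (∀ X, u ∉ X → unchSum st' X = unchSum st X) ∧
    (∀ X, u ∈ X → (∀ T ∈ st.formed, u ∈ T → T ⊆ X) →
      unchSum st' X = unchSum st X - (pen I i / 2 - historyRest I st i u)) := by
  classical
  obtain ⟨hi, hiu⟩ := mem_terms.1 hx
  simp only at hi hiu
  have hspec := chargeLoop_spec (history st u) (nodup_history st u) (pen I i / 2) st.uncharged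
    (st.share i) (div_nonneg (pen_nonneg _ _) zero_le_two) h.unch_nonneg
    (fun S hS => h.share_alive i u hx hal S (mem_history.1 hS).2) _ _ _ rfl
  have hr : (chargeLoop (pen I i / 2) st.uncharged (st.share i) (history st u)).1 =
    historyRest I st i u := rfl
  have hu' : (chargeLoop (pen I i / 2) st.uncharged (st.share i) (history st u)).2.1 =
    st'.uncharged := hun.symm
  have hs' : st'.share = Function.update st.share i
    (chargeLoop (pen I i / 2) st.uncharged (st.share i) (history st u)).2.2 := hsh
  rw [hr, hu'] at hspec
  obtain ⟨r0, u0, ule, uoff, sEq, tot, pw, rz⟩ := hspec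
  have hsame : ∀ T, st'.share i T = st.share i T + (st.uncharged T - st'.uncharged T) := by
    intro T; rw [hs', Function.update_self]; exact sEq T
  have hother : ∀ j, j ≠ i → st'.share j = st.share j := by
    intro j hj; rw [hs', Function.update_of_ne hj]
  have hmono : ∀ j T, st.share j T ≤ st'.share j T := by
    intro j T
    by_cases hj : j = i
    · subst hj; rw [hsame]; linarith [ule T]
    · rw [hother j hj]
  have hfin : (history st u).toFinset = st.formed.filter (fun T => u ∈ T) := by
    ext T; simp [mem_history]
  rw [hfin] at tot
  have hoff : ∀ T ∈ st.formed, u ∉ T → st'.uncharged T = st.uncharged T :=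
    fun T _ hT => uoff T fun h' => hT (mem_history.1 h').2
  -- a set that still has uncharged growth blocks all larger sets
  have hblock : ∀ S ∈ st.formed, u ∈ S → st'.uncharged S ≠ 0 →
      ∀ T ∈ st.formed, u ∈ T → ¬ T ⊆ S → st'.uncharged T = st.uncharged T := by
    intro S hS huS hS0 T hT huT hTS
    have hST : S ⊆ T := (hchain S hS T hT huS huT).resolve_right hTS
    have hcard : S.card < T.card := Finset.card_lt_card ⟨hST, hTS⟩
    have hpw := pw.and (pairwise_history st u)
    have hSL : S ∈ history st u := mem_history.2 ⟨hS, huS⟩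
    have hTL : T ∈ history st u := mem_history.2 ⟨hT, huT⟩
    have hne : S ≠ T := fun h' => by subst h'; exact hTS (Finset.Subset.refl _)
    obtain ⟨k, hk, rfl⟩ := List.mem_iff_getElem.1 hSL
    obtain ⟨l, hl, rfl⟩ := List.mem_iff_getElem.1 hTL
    rcases lt_trichotomy k l with hkl | hkl | hkl
    · exact ((List.pairwise_iff_getElem.1 hpw k l hk hl hkl).1).resolve_left hS0
    · subst hkl; exact absurd rfl hne
    · exact absurd (List.pairwise_iff_getElem.1 hpw l k hl hk hkl).2 (by omega)
  have hunch_off : ∀ X, u ∉ X → unchSum st' X = unchSum st X := by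
    intro X huX
    rw [unchSum, unchSum, hf]
    refine Finset.sum_congr rfl fun T hT => ?_
    obtain ⟨hT, hTX⟩ := Finset.mem_filter.1 hT
    exact hoff T hT fun h' => huX (hTX h')
  -- the amount charged inside `X`
  have hdiff : ∀ X, unchSum st X - unchSum st' X =
      ∑ T ∈ (st.formed.filter (fun T => u ∈ T)).filter (fun T => T ⊆ X),
        (st.uncharged T - st'.uncharged T) := by
    intro X
    rw [unchSum, unchSum, hf, ← Finset.sum_sub_distrib, Finset.filter_filter]
    symm
    refine Finset.sum_subset (fun T hT => ?_) fun T hT hT' => ?_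
    · simp only [Finset.mem_filter] at hT ⊢; exact ⟨hT.1, hT.2.2⟩
    · simp only [Finset.mem_filter, not_and] at hT hT'
      rw [hoff T hT.1 (fun h' => hT' hT.1 h' hT.2), sub_self]
  have hunch_on : ∀ X, u ∈ X → (∀ T ∈ st.formed, u ∈ T → T ⊆ X) →
      unchSum st' X = unchSum st X - (pen I i / 2 - historyRest I st i u) := by
    intro X _ hX
    have := hdiff X
    rw [Finset.filter_true_of_mem (fun T hT => hX T (Finset.mem_filter.1 hT).1
      (Finset.mem_filter.1 hT).2)] at this
    linarith
  have halive : ∀ X, aliveSum I st' X = aliveSum I st X - if u ∈ X then pen I i / 2 else 0 :=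
    aliveSum_update hx hal ha hst
  have hstatus : ∀ j v, st'.status j v = if j = i ∧ v = u then a else st.status j v := by
    intro j v
    rw [hst]
    simp only [mark, Function.update_apply]
    by_cases hj : j = i
    · subst hj; by_cases hv : v = u <;> simp [hv]
    · simp [hj]
  refine ⟨r0, ⟨u0, fun j T => (h.share_nonneg j T).trans (hmono j T), fun X => ?_, ?_, ?_, ?_, ?_,
    ?_⟩, ule, hunch_off, hunch_on⟩
  · rw [halive]
    split_ifs with huX
    · by_cases hex : ∃ S ∈ st.formed, u ∈ S ∧ S ⊆ X ∧ st'.uncharged S ≠ 0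
      · -- everything is charged inside `X`
        obtain ⟨S, hS, huS, hSX, hS0⟩ := hex
        have hr0 : historyRest I st i u = 0 := rz S (mem_history.2 ⟨hS, huS⟩) hS0
        have : ∑ T ∈ (st.formed.filter (fun T => u ∈ T)).filter (fun T => T ⊆ X),
            (st.uncharged T - st'.uncharged T) =
            ∑ T ∈ st.formed.filter (fun T => u ∈ T), (st.uncharged T - st'.uncharged T) := by
          refine Finset.sum_subset (Finset.filter_subset _ _) fun T hT hT' => ?_
          obtain ⟨hTf, huT⟩ := Finset.mem_filter.1 hT
          have hTX : ¬ T ⊆ X := fun h' => hT' (Finset.mem_filter.2 ⟨hT, h'⟩)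
          rw [hblock S hS huS hS0 T hTf huT (fun h' => hTX (h'.trans hSX)), sub_self]
        have h1 := hdiff X
        have h2 := h.hall X
        linarith
      · -- nothing is left of the sets containing `u` inside `X`
        push Not at hex
        have h1 : unchSum st' X = unchSum st' (X.erase u) := by
          rw [unchSum, unchSum]
          symm
          refine Finset.sum_subset (fun T hT => ?_) fun T hT hT' => ?_
          · simp only [Finset.mem_filter] at hT ⊢
            exact ⟨hT.1, hT.2.trans (Finset.erase_subset _ _)⟩
          · simp only [Finset.mem_filter, not_and, hf] at hT hT'
            by_cases huT : u ∈ T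
            · exact hex T hT.1 huT hT.2
            · exact absurd (Finset.subset_erase.2 ⟨hT.2, huT⟩) (hT' hT.1)
        have h2 := hunch_off (X.erase u) (Finset.notMem_erase u X)
        have h3 := h.hall (X.erase u)
        have h4 := aliveSum_erase hx hal huX
        linarith
    · rw [sub_zero, hunch_off X huX]; exact h.hall X
  · intro T hT
    rw [hf] at hT
    have hrest : ∑ j ∈ (pairs I).erase i, st'.share j T = ∑ j ∈ (pairs I).erase i, st.share j T :=
      Finset.sum_congr rfl fun j hj => by rw [hother j (Finset.ne_of_mem_erase hj)]
    rw [hy, h.y_eq T hT, ← Finset.add_sum_erase _ _ hi, ← Finset.add_sum_erase _ _ hi, hsame, hrest]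
    ring
  · intro j hj T hT
    rw [hf]
    by_cases hji : j = i
    · subst hji
      by_cases hs0 : st.share j T = 0
      · rw [hsame, hs0, zero_add] at hT
        have hTu : T ∈ history st u := by
          by_contra h'
          exact hT (by rw [uoff T h', sub_self])
        obtain ⟨hTf, huT⟩ := mem_history.1 hTu
        have hpos : st.uncharged T ≠ 0 := fun h0 => hT (by linarith [ule T, u0 T])
        refine ⟨hTf, ?_⟩
        rcases hiu with rfl | rfl <;> tauto
      · exact h.share_supp j hj T hs0
    · rw [hother j hji] at hT; exact h.share_supp j hj T hT
  · intro j v hjv hs T hT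
    rw [hstatus] at hs
    by_cases hji : j = i
    · subst hji
      have hv : v ≠ u := by
        rintro rfl
        simp only [and_self, if_true] at hs
        exact ha hs
      simp only [hv, and_false, if_false] at hs
      rw [hsame, h.share_alive j v hjv hs T hT, zero_add]
      by_cases hTu : T ∈ history st u
      · obtain ⟨hTf, huT⟩ := mem_history.1 hTu
        have hb : j.1 ∈ T ∧ j.2 ∈ T := by
          have := (mem_terms.1 hjv).2
          simp only at this
          rcases hiu with rfl | rfl <;> rcases this with rfl | rfl <;>
            first | exact absurd rfl hv | exact ⟨hT, huT⟩ | exact ⟨huT, hT⟩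
        have := hboth T hTf hb.1 hb.2
        linarith [ule T, u0 T]
      · rw [uoff T hTu, sub_self]
    · simp only [hji, false_and, if_false] at hs
      rw [hother j hji]; exact h.share_alive j v hjv hs T hT
  · intro j v hjv
    rw [hf]
    by_cases hji : j = i
    · subst hji
      by_cases hv : v = u
      · subst hv
        have : ∑ T ∈ st.formed with v ∈ T, st'.share j T =
            ∑ T ∈ st.formed.filter (fun T => v ∈ T), (st.uncharged T - st'.uncharged T) := by
          refine Finset.sum_congr rfl fun T hT => ?_
          rw [hsame, h.share_alive j v hx hal T (Finset.mem_filter.1 hT).2, zero_add]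
        rw [this]; linarith
      · refine le_of_eq_of_le (Finset.sum_congr rfl fun T hT => ?_) (h.share_le j v hjv)
        obtain ⟨hTf, hvT⟩ := Finset.mem_filter.1 hT
        rw [hsame]
        by_cases huT : u ∈ T
        · have hb : j.1 ∈ T ∧ j.2 ∈ T := by
            have := (mem_terms.1 hjv).2
            simp only at this
            rcases hiu with rfl | rfl <;> rcases this with rfl | rfl <;>
              first | exact absurd rfl hv | exact ⟨hvT, huT⟩ | exact ⟨huT, hvT⟩
          have := hboth T hTf hb.1 hb.2
          linarith [ule T, u0 T]
        · rw [hoff T hTf huT]; ring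
    · rw [hother j hji]; exact h.share_le j v hjv
  · intro j v hjv hs
    rw [hf]
    rw [hstatus] at hs
    have hsum : ∀ j, ∑ T ∈ st.formed, st.share j T ≤ ∑ T ∈ st.formed, st'.share j T :=
      fun j => Finset.sum_le_sum fun T _ => hmono j T
    split_ifs at hs with hc
    · obtain ⟨rfl, rfl⟩ := hc
      rcases hdead hs with h0 | h0
      · rw [h0, zero_add] at tot
        rw [← tot]
        calc ∑ T ∈ st.formed with v ∈ T, (st.uncharged T - st'.uncharged T)
            ≤ ∑ T ∈ st.formed with v ∈ T, st'.share j T := by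
              refine Finset.sum_le_sum fun T _ => ?_
              rw [hsame]; linarith [h.share_nonneg j T]
          _ ≤ ∑ T ∈ st.formed, st'.share j T :=
              Finset.sum_le_sum_of_subset_of_nonneg (Finset.filter_subset _ _)
                fun T _ _ => (h.share_nonneg j T).trans (hmono j T)
      · exact h0.trans (hsum j)
    · exact (h.dead_share j v hjv hs).trans (hsum j)

end PrimalDual

/-! ### Invariants of the main loop -/

namespace PrimalDual

variable {n : ℕ}

/-- The structural invariants, which involve only the forest, the formed and active sets, and the
dual variables `y`. -/
structure Struct (I : PCSF n) (st : State n) : Prop where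
  forest_le : st.forest ≤ I.graph
  acyclic : st.forest.IsAcyclic
  formed_sub : ∀ T ∈ st.formed, ∀ u ∈ T, T ⊆ comp st u
  formed_ne : ∀ T ∈ st.formed, T.Nonempty
  laminar : ∀ S ∈ st.formed, ∀ T ∈ st.formed, ∀ u, u ∈ S → u ∈ T → S ⊆ T ∨ T ⊆ S
  comp_formed : ∀ u, comp st u ∈ st.formed ∨ comp st u = {u}
  term_formed : ∀ i u, (i, u) ∈ terms I → {u} ∈ st.formed
  active_sub : st.active ⊆ st.formed
  active_comp : ∀ S ∈ st.active, ∃ u, comp st u = S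
  y_nonneg : ∀ S ∈ st.formed, 0 ≤ st.y S
  load_le : ∀ e ∈ I.graph.edgeSet, load st e ≤ I.cost e
  tight : ∀ e ∈ st.forest.edgeSet, load st e = I.cost e

/-- The potential of a component is the available charge that is not needed yet. -/
def PotEq (I : PCSF n) (st : State n) : Prop :=
  ∀ u, st.potential (comp st u) = aliveSum I st (comp st u) - unchSum st (comp st u)

/-- The invariants on the labels of the terminals. -/
structure Labels (I : PCSF n) (st : State n) : Prop where
  alive_active : ∀ i u, (i, u) ∈ terms I → st.status i u = Status.alive → comp st u ∈ st.active
  alive_sep : ∀ i u, (i, u) ∈ terms I → st.status i u = Status.alive →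
    ¬ st.forest.Reachable i.1 i.2
  sat_iff : ∀ i ∈ pairs I, st.status i i.1 = Status.satisfied ↔ st.status i i.2 = Status.satisfied
  sat_reach : ∀ i ∈ pairs I, st.status i i.1 = Status.satisfied → st.forest.Reachable i.1 i.2

/-- The invariants of the main loop. -/
structure Inv (I : PCSF n) (st : State n) : Prop where
  struct : Struct I st
  charges : Charges I st
  pot : PotEq I st
  labels : Labels I st

/-- The two states agree in the forest, the formed and active sets, and `y`. -/
structure SameStruct (st st' : State n) : Prop where
  forest : st'.forest = st.forest
  formed : st'.formed = st.formed
  active : st'.active = st.active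
  y : st'.y = st.y

theorem SameStruct.refl (st : State n) : SameStruct st st := ⟨rfl, rfl, rfl, rfl⟩

theorem SameStruct.trans {a b c : State n} (h : SameStruct a b) (h' : SameStruct b c) :
    SameStruct a c :=
  ⟨h'.1.trans h.1, h'.2.trans h.2, h'.3.trans h.3, h'.4.trans h.4⟩

theorem SameStruct.comp {st st' : State n} (h : SameStruct st st') (u : Fin n) :
    comp st' u = comp st u := by
  unfold PrimalDual.comp; rw [h.forest]

theorem SameStruct.load {st st' : State n} (h : SameStruct st st') (e : Sym2 (Fin n)) :
    load st' e = load st e := by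
  unfold PrimalDual.load; rw [h.formed, h.y]

theorem comp_eq_cluster (st : State n) (u : Fin n) : comp st u = cluster st.forest u := by
  ext v; simp [comp]

theorem mem_comp {st : State n} {u v : Fin n} : v ∈ comp st u ↔ st.forest.Reachable u v := by
  simp [comp]

theorem mem_comp_self (st : State n) (u : Fin n) : u ∈ comp st u :=
  mem_comp.2 (SimpleGraph.Reachable.refl u)

theorem comp_eq_of_mem {st : State n} {u v : Fin n} (h : v ∈ comp st u) :
    comp st v = comp st u := by
  rw [comp_eq_cluster, comp_eq_cluster]
  exact cluster_eq_of_reachable (mem_comp.1 h).symm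

theorem Struct.congr {I : PCSF n} {st st' : State n} (h : Struct I st) (hs : SameStruct st st') :
    Struct I st' where
  forest_le := hs.forest ▸ h.forest_le
  acyclic := hs.forest ▸ h.acyclic
  formed_sub T hT u hu := by rw [hs.comp]; exact h.formed_sub T (hs.formed ▸ hT) u hu
  formed_ne := hs.formed ▸ h.formed_ne
  laminar := hs.formed ▸ h.laminar
  comp_formed u := by rw [hs.comp, hs.formed]; exact h.comp_formed u
  term_formed := hs.formed ▸ h.term_formed
  active_sub := by rw [hs.formed, hs.active]; exact h.active_sub
  active_comp S hS := by
    obtain ⟨u, hu⟩ := h.active_comp S (hs.active ▸ hS)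
    exact ⟨u, by rw [hs.comp, hu]⟩
  y_nonneg := by rw [hs.formed, hs.y]; exact h.y_nonneg
  load_le e he := by rw [hs.load]; exact h.load_le e he
  tight e he := by rw [hs.load]; exact h.tight e (hs.forest ▸ he)

section SetSums

open Classical

theorem aliveSum_union {I : PCSF n} {st : State n} {X Y : Finset (Fin n)} (h : Disjoint X Y) :
    aliveSum I st (X ∪ Y) = aliveSum I st X + aliveSum I st Y := by
  rw [aliveSum, aliveSum, aliveSum, ← Finset.sum_union]
  · congr 1
    ext x
    simp only [Finset.mem_filter, Finset.mem_union]
    tauto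
  · rw [Finset.disjoint_left]
    intro x hx hx'
    simp only [Finset.mem_filter] at hx hx'
    exact Finset.disjoint_left.1 h hx.2.1 hx'.2.1

theorem aliveSum_sdiff {I : PCSF n} {st : State n} {X Y : Finset (Fin n)} (h : X ⊆ Y) :
    aliveSum I st Y = aliveSum I st X + aliveSum I st (Y \ X) := by
  rw [← aliveSum_union Finset.disjoint_sdiff, Finset.union_sdiff_of_subset h]

/-- The uncharged growth is additive when every formed set lies on one side. -/
theorem unchSum_split {st : State n} {X Y : Finset (Fin n)} (h : Disjoint X Y)
    (hne : ∀ T ∈ st.formed, T.Nonempty)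
    (hs : ∀ T ∈ st.formed, T ⊆ X ∪ Y → T ⊆ X ∨ T ⊆ Y) :
    unchSum st (X ∪ Y) = unchSum st X + unchSum st Y := by
  rw [unchSum, unchSum, unchSum, ← Finset.sum_union]
  · congr 1
    ext T
    simp only [Finset.mem_filter, Finset.mem_union]
    constructor
    · rintro ⟨hT, hT'⟩; exact (hs T hT hT').imp (fun h => ⟨hT, h⟩) (fun h => ⟨hT, h⟩)
    · rintro (⟨hT, h⟩ | ⟨hT, h⟩)
      · exact ⟨hT, h.trans Finset.subset_union_left⟩
      · exact ⟨hT, h.trans Finset.subset_union_right⟩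
  · rw [Finset.disjoint_left]
    intro T hT hT'
    simp only [Finset.mem_filter] at hT hT'
    obtain ⟨a, ha⟩ := hne T hT.1
    exact Finset.disjoint_left.1 h (hT.2 ha) (hT'.2 ha)

theorem Struct.subset_or_disjoint {I : PCSF n} {st : State n} (h : Struct I st)
    {T : Finset (Fin n)} (hT : T ∈ st.formed) (u : Fin n) :
    T ⊆ comp st u ∨ Disjoint T (comp st u) := by
  by_cases hd : Disjoint T (comp st u)
  · exact Or.inr hd
  · obtain ⟨a, ha, hau⟩ := Finset.not_disjoint_iff.1 hd
    exact Or.inl ((h.formed_sub T hT a ha).trans (comp_eq_of_mem hau).subset)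

/-- The only active set inside a component is the component itself. -/
theorem Struct.active_subset_comp {I : PCSF n} {st : State n} (h : Struct I st)
    {S : Finset (Fin n)} (hS : S ∈ st.active) {u : Fin n} (hu : S ⊆ comp st u) :
    S = comp st u := by
  obtain ⟨a, rfl⟩ := h.active_comp S hS
  exact comp_eq_of_mem (hu (mem_comp_self st a))

theorem unchSum_grow {I : PCSF n} {st : State n} (h : Struct I st) (d : ℝ) (X : Finset (Fin n)) :
    unchSum (grow st d) X = unchSum st X + d * (st.active.filter (fun S => S ⊆ X)).card := by
  have h1 : (grow st d).formed = st.formed := rfl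
  rw [unchSum, unchSum, h1, mul_comm, ← nsmul_eq_mul, ← Finset.sum_const]
  have h2 : st.active.filter (fun S => S ⊆ X) =
      (st.formed.filter (fun S => S ⊆ X)).filter (fun S => S ∈ st.active) := by
    ext S
    simp only [Finset.mem_filter]
    exact ⟨fun hS => ⟨⟨h.active_sub hS.1, hS.2⟩, hS.1⟩, fun hS => ⟨hS.2, hS.1.2⟩⟩
  rw [h2, Finset.sum_filter (fun S => S ∈ st.active), ← Finset.sum_add_distrib]
  refine Finset.sum_congr rfl fun T _ => ?_
  simp only [grow]
  split_ifs <;> simp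

theorem load_grow {I : PCSF n} {st : State n} (h : Struct I st) (d : ℝ) (e : Sym2 (Fin n)) :
    load (grow st d) e = load st e + d * (st.active.filter (fun S => Cuts S e)).card := by
  have h1 : (grow st d).formed = st.formed := rfl
  rw [load, load, h1, mul_comm, ← nsmul_eq_mul, ← Finset.sum_const]
  have h2 : st.active.filter (fun S => Cuts S e) =
      (st.formed.filter (fun S => Cuts S e)).filter (fun S => S ∈ st.active) := by
    ext S
    simp only [Finset.mem_filter]
    exact ⟨fun hS => ⟨⟨h.active_sub hS.1, hS.2⟩, hS.1⟩, fun hS => ⟨hS.2, hS.1.2⟩⟩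
  rw [h2, Finset.sum_filter (fun S => S ∈ st.active), ← Finset.sum_add_distrib]
  refine Finset.sum_congr rfl fun T _ => ?_
  simp only [grow]
  split_ifs <;> simp

end SetSums

theorem Struct.active_clusters {I : PCSF n} {st : State n} (h : Struct I st) :
    st.active ⊆ clusters st.forest := by
  intro S hS
  obtain ⟨u, rfl⟩ := h.active_comp S hS
  rw [comp_eq_cluster]
  exact cluster_mem_clusters _ _

/-- The invariants survive the growth of the active components. -/
theorem Inv.grow {I : PCSF n} {st : State n} (h : Inv I st) {d : ℝ} (hd : 0 ≤ d)
    (hw : WithinLimits I (grow st d)) : Inv I (grow st d) := by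
  classical
  obtain ⟨hS, hC, hP, hL⟩ := h
  have hcomp : ∀ u, comp (PrimalDual.grow st d) u = comp st u := fun _ => rfl
  have halive : ∀ X, aliveSum I (PrimalDual.grow st d) X = aliveSum I st X := fun _ => rfl
  have hpot : PotEq I (PrimalDual.grow st d) := by
    intro u
    rw [hcomp, halive, unchSum_grow hS]
    by_cases hu : comp st u ∈ st.active
    · have : st.active.filter (fun S => S ⊆ comp st u) = {comp st u} := by
        ext S
        simp only [Finset.mem_filter, Finset.mem_singleton]
        constructor
        · rintro ⟨h1, h2⟩; exact hS.active_subset_comp h1 h2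
        · rintro rfl; exact ⟨hu, Finset.Subset.refl _⟩
      rw [this]
      simp only [PrimalDual.grow, hu, if_true, hP u, Finset.card_singleton]
      push_cast; ring
    · have : st.active.filter (fun S => S ⊆ comp st u) = ∅ := by
        refine Finset.filter_eq_empty_iff.2 fun S h1 h2 => hu ?_
        rw [← hS.active_subset_comp h1 h2]; exact h1
      rw [this]
      simp only [PrimalDual.grow, hu, if_false, hP u, Finset.card_empty]
      push_cast; ring
  refine ⟨⟨hS.forest_le, hS.acyclic, hS.formed_sub, hS.formed_ne, hS.laminar, hS.comp_formed,
    hS.term_formed, hS.active_sub, hS.active_comp, ?_, hw.1, ?_⟩,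
    ⟨?_, hC.share_nonneg, ?_, ?_, hC.share_supp, hC.share_alive, hC.share_le, hC.dead_share⟩,
    hpot, ⟨hL.alive_active, hL.alive_sep, hL.sat_iff, hL.sat_reach⟩⟩
  · intro S hSf
    have := hS.y_nonneg S hSf
    simp only [PrimalDual.grow]
    split_ifs <;> linarith
  · intro e he
    change e ∈ st.forest.edgeSet at he
    rw [load_grow hS, hS.tight e he]
    have : st.active.filter (fun S => Cuts S e) = ∅ := by
      refine Finset.filter_eq_empty_iff.2 fun S h1 h2 => ?_
      induction e with
      | h a b =>
      exact ((cuts_cluster_mk (hS.active_clusters h1)).1 h2).1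
        (SimpleGraph.Adj.reachable he)
    rw [this]; simp
  · intro T
    have := hC.unch_nonneg T
    simp only [PrimalDual.grow]
    split_ifs <;> linarith
  · -- split off the active components inside `X` one by one
    intro X
    induction X using Finset.strongInduction with
    | H X ih =>
    by_cases hex : ∃ S ∈ st.active, S ⊆ X
    · obtain ⟨S, hSa, hSX⟩ := hex
      obtain ⟨u, rfl⟩ := hS.active_comp S hSa
      have h1 := ih (X \ comp st u) (Finset.sdiff_ssubset hSX ⟨u, mem_comp_self st u⟩)
      have h2 : unchSum (PrimalDual.grow st d) X = unchSum (PrimalDual.grow st d) (comp st u) +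
          unchSum (PrimalDual.grow st d) (X \ comp st u) := by
        rw [← unchSum_split Finset.disjoint_sdiff (by exact hS.formed_ne),
          Finset.union_sdiff_of_subset hSX]
        intro T hT hTX
        refine (hS.subset_or_disjoint hT u).imp id fun h => ?_
        rw [Finset.union_sdiff_of_subset hSX] at hTX
        exact Finset.subset_sdiff.2 ⟨hTX, h⟩
      have h3 := hpot u
      have h4 := hw.2 _ hSa
      rw [hcomp] at h3
      rw [h2, halive, aliveSum_sdiff hSX]
      rw [halive] at h1 h3
      linarith
    · have : st.active.filter (fun S => S ⊆ X) = ∅ :=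
        Finset.filter_eq_empty_iff.2 fun S h1 h2 => hex ⟨S, h1, h2⟩
      rw [unchSum_grow hS, this, halive]
      simpa using hC.hall X
  · intro T hT
    have := hC.y_eq T hT
    simp only [PrimalDual.grow]
    split_ifs <;> linarith

theorem comp_union_ne {st : State n} {u v : Fin n} (huv : ¬ st.forest.Reachable u v) (a : Fin n) :
    ¬ comp st u ∪ comp st v ⊆ comp st a := by
  intro h
  have h1 := h (Finset.mem_union_left _ (mem_comp_self st u))
  have h2 := h (Finset.mem_union_right _ (mem_comp_self st v))
  rw [mem_comp] at h1 h2
  exact huv (h1.symm.trans h2)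

theorem comp_disjoint {st : State n} {u v : Fin n} (huv : ¬ st.forest.Reachable u v) :
    Disjoint (comp st u) (comp st v) := by
  rw [Finset.disjoint_left]
  intro a h1 h2
  rw [mem_comp] at h1 h2
  exact huv (h1.trans h2.symm)

theorem comp_merge_of_mem {st : State n} {u v a : Fin n} (h : a ∈ comp st u ∪ comp st v) :
    comp (merge st u v) a = comp st u ∪ comp st v := by
  rw [comp_eq_cluster (merge st u v)]
  have := cluster_sup_edge_left st.forest (u := u) (v := v) (a := a)
    (by rwa [comp_eq_cluster, comp_eq_cluster] at h)
  rw [← comp_eq_cluster, ← comp_eq_cluster] at this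
  exact this

theorem comp_merge_of_notMem {st : State n} {u v a : Fin n} (h : a ∉ comp st u ∪ comp st v) :
    comp (merge st u v) a = comp st a := by
  rw [comp_eq_cluster (merge st u v), comp_eq_cluster]
  exact cluster_sup_edge_of_notMem st.forest (u := u) (v := v) (a := a)
    (by rwa [comp_eq_cluster, comp_eq_cluster] at h)

theorem Struct.union_notMem {I : PCSF n} {st : State n} (h : Struct I st) {u v : Fin n}
    (huv : ¬ st.forest.Reachable u v) : comp st u ∪ comp st v ∉ st.formed := fun hf =>
  comp_union_ne huv u (h.formed_sub _ hf u (Finset.mem_union_left _ (mem_comp_self st u)))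

theorem load_merge {I : PCSF n} {st : State n} (h : Struct I st) {u v : Fin n}
    (huv : ¬ st.forest.Reachable u v) (e : Sym2 (Fin n)) :
    load (merge st u v) e = load st e := by
  classical
  have hn := h.union_notMem huv
  rw [load, load]
  simp only [merge]
  rw [Finset.filter_insert]
  have : ∑ S ∈ st.formed with Cuts S e, Function.update st.y (comp st u ∪ comp st v) 0 S =
      ∑ S ∈ st.formed with Cuts S e, st.y S := by
    refine Finset.sum_congr rfl fun S hS => ?_
    rw [Function.update_of_ne]
    rintro rfl
    exact hn (Finset.mem_filter.1 hS).1
  split_ifs with hc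
  · rw [Finset.sum_insert (fun h' => hn (Finset.mem_filter.1 h').1), this]
    simp
  · exact this

theorem unchSum_merge {I : PCSF n} {st : State n} (h : Struct I st) {u v : Fin n}
    (huv : ¬ st.forest.Reachable u v) (X : Finset (Fin n)) :
    unchSum (merge st u v) X = unchSum st X := by
  classical
  have hn := h.union_notMem huv
  rw [unchSum, unchSum]
  simp only [merge]
  rw [Finset.filter_insert]
  have : ∑ S ∈ st.formed with S ⊆ X, Function.update st.uncharged (comp st u ∪ comp st v) 0 S =
      ∑ S ∈ st.formed with S ⊆ X, st.uncharged S := by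
    refine Finset.sum_congr rfl fun S hS => ?_
    rw [Function.update_of_ne]
    rintro rfl
    exact hn (Finset.mem_filter.1 hS).1
  split_ifs with hc
  · rw [Finset.sum_insert (fun h' => hn (Finset.mem_filter.1 h').1), this]
    simp
  · exact this

theorem Struct.merge {I : PCSF n} {st : State n} (hS : Struct I st) {u v : Fin n}
    (ht : TightEdge I st u v) : Struct I (merge st u v) := by
  classical
  obtain ⟨hadj, huv, hact, hload⟩ := ht
  have hle : ∀ a, comp st a ⊆ comp (PrimalDual.merge st u v) a := fun a b hb =>
    mem_comp.2 ((mem_comp.1 hb).mono le_sup_left)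
  refine ⟨?_, SimpleGraph.IsAcyclic.sup_edge_of_not_reachable huv hS.acyclic, ?_, ?_, ?_, ?_, ?_,
    ?_, ?_, ?_, ?_, ?_⟩
  · refine sup_le hS.forest_le fun a b hab => ?_
    rcases ((SimpleGraph.edge_adj u v a b).1 hab).1 with ⟨rfl, rfl⟩ | ⟨rfl, rfl⟩
    · exact hadj
    · exact hadj.symm
  · intro T hT a ha
    rcases Finset.mem_insert.1 hT with rfl | hT
    · exact (comp_merge_of_mem ha).symm.subset
    · exact (hS.formed_sub T hT a ha).trans (hle a)
  · intro T hT
    rcases Finset.mem_insert.1 hT with rfl | hT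
    · exact ⟨u, Finset.mem_union_left _ (mem_comp_self st u)⟩
    · exact hS.formed_ne T hT
  · have hnew : ∀ T ∈ st.formed, ∀ a, a ∈ comp st u ∪ comp st v → a ∈ T →
        T ⊆ comp st u ∪ comp st v := by
      intro T hT a ha haT
      refine (hS.formed_sub T hT a haT).trans ?_
      rcases Finset.mem_union.1 ha with ha | ha
      · rw [comp_eq_of_mem ha]; exact Finset.subset_union_left
      · rw [comp_eq_of_mem ha]; exact Finset.subset_union_right
    intro S hSf T hT a haS haT
    rcases Finset.mem_insert.1 hSf with rfl | hSf <;> rcases Finset.mem_insert.1 hT with rfl | hT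
    · exact Or.inl (Finset.Subset.refl _)
    · exact Or.inr (hnew T hT a haS haT)
    · exact Or.inl (hnew S hSf a haT haS)
    · exact hS.laminar S hSf T hT a haS haT
  · intro a
    by_cases ha : a ∈ comp st u ∪ comp st v
    · rw [comp_merge_of_mem ha]; exact Or.inl (Finset.mem_insert_self _ _)
    · rw [comp_merge_of_notMem ha]
      exact (hS.comp_formed a).imp (fun h => Finset.mem_insert_of_mem h) id
  · intro i a h; exact Finset.mem_insert_of_mem (hS.term_formed i a h)
  · intro S hSa
    rcases Finset.mem_insert.1 hSa with rfl | hSa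
    · exact Finset.mem_insert_self _ _
    · exact Finset.mem_insert_of_mem (hS.active_sub (Finset.mem_of_mem_erase
        (Finset.mem_of_mem_erase hSa)))
  · intro S hSa
    rcases Finset.mem_insert.1 hSa with rfl | hSa
    · exact ⟨u, comp_merge_of_mem (Finset.mem_union_left _ (mem_comp_self st u))⟩
    · obtain ⟨h2, hSa⟩ := Finset.mem_erase.1 hSa
      obtain ⟨h1, hSa⟩ := Finset.mem_erase.1 hSa
      obtain ⟨a, rfl⟩ := hS.active_comp S hSa
      refine ⟨a, comp_merge_of_notMem fun h => ?_⟩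
      rcases Finset.mem_union.1 h with h | h
      · exact h1 (comp_eq_of_mem h)
      · exact h2 (comp_eq_of_mem h)
  · intro S hSf
    by_cases hSn : S = comp st u ∪ comp st v
    · subst hSn; simp [PrimalDual.merge]
    · have := hS.y_nonneg S ((Finset.mem_insert.1 hSf).resolve_left hSn)
      simpa [PrimalDual.merge, hSn] using this
  · intro e he
    rw [load_merge hS huv]; exact hS.load_le e he
  · intro e he
    rw [load_merge hS huv]
    change e ∈ (st.forest ⊔ SimpleGraph.edge u v).edgeSet at he
    induction e with
    | h a b =>
    rw [SimpleGraph.mem_edgeSet, SimpleGraph.sup_adj, SimpleGraph.edge_adj] at he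
    rcases he with he | ⟨⟨rfl, rfl⟩ | ⟨rfl, rfl⟩, -⟩
    · exact hS.tight _ he
    · exact hload
    · rw [Sym2.eq_swap]; exact hload

theorem Charges.merge {I : PCSF n} {st : State n} (hS : Struct I st) (hC : Charges I st)
    {u v : Fin n} (huv : ¬ st.forest.Reachable u v) : Charges I (merge st u v) := by
  classical
  have hn := hS.union_notMem huv
  have hshare : ∀ i ∈ pairs I, st.share i (comp st u ∪ comp st v) = 0 := by
    intro i hi
    by_contra h
    exact hn (hC.share_supp i hi _ h).1
  have hsum : ∀ i ∈ pairs I, ∑ T ∈ insert (comp st u ∪ comp st v) st.formed, st.share i T =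
      ∑ T ∈ st.formed, st.share i T := by
    intro i hi; rw [Finset.sum_insert hn, hshare i hi, zero_add]
  refine ⟨?_, hC.share_nonneg, ?_, ?_, ?_, hC.share_alive, ?_, ?_⟩
  · intro T
    by_cases hT : T = comp st u ∪ comp st v
    · subst hT; simp [PrimalDual.merge]
    · simpa [PrimalDual.merge, hT] using hC.unch_nonneg T
  · intro X; rw [unchSum_merge hS huv]; exact hC.hall X
  · intro T hT
    by_cases hTn : T = comp st u ∪ comp st v
    · subst hTn
      simp only [PrimalDual.merge, Function.update_self]
      rw [Finset.sum_eq_zero hshare]; simp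
    · have := hC.y_eq T ((Finset.mem_insert.1 hT).resolve_left hTn)
      simpa [PrimalDual.merge, hTn] using this
  · intro i hi T hT
    obtain ⟨h1, h2⟩ := hC.share_supp i hi T hT
    exact ⟨Finset.mem_insert_of_mem h1, h2⟩
  · intro i a hia
    have := hC.share_le i a hia
    simp only [PrimalDual.merge]
    rw [Finset.filter_insert]
    split_ifs
    · rw [Finset.sum_insert (fun h' => hn (Finset.mem_filter.1 h').1),
        hshare i (mem_terms.1 hia).1, zero_add]
      exact this
    · exact this
  · intro i a hia hs
    simp only [PrimalDual.merge]
    rw [hsum i (mem_terms.1 hia).1]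
    exact hC.dead_share i a hia hs

theorem PotEq.merge {I : PCSF n} {st : State n} (hS : Struct I st) (hP : PotEq I st)
    {u v : Fin n} (huv : ¬ st.forest.Reachable u v) : PotEq I (merge st u v) := by
  classical
  intro a
  rw [unchSum_merge hS huv]
  have halive : ∀ X, aliveSum I (PrimalDual.merge st u v) X = aliveSum I st X := fun _ => rfl
  rw [halive]
  by_cases ha : a ∈ comp st u ∪ comp st v
  · rw [comp_merge_of_mem ha, aliveSum_union (comp_disjoint huv),
      unchSum_split (comp_disjoint huv) hS.formed_ne]
    · simp only [PrimalDual.merge, Function.update_self, hP u, hP v]; ring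
    · intro T hT hTs
      obtain ⟨b, hb⟩ := hS.formed_ne T hT
      rcases Finset.mem_union.1 (hTs hb) with h | h
      · exact Or.inl ((hS.formed_sub T hT b hb).trans (comp_eq_of_mem h).subset)
      · exact Or.inr ((hS.formed_sub T hT b hb).trans (comp_eq_of_mem h).subset)
  · rw [comp_merge_of_notMem ha]
    have hne : comp st a ≠ comp st u ∪ comp st v := fun h => comp_union_ne huv a h.symm.subset
    simp [PrimalDual.merge, hne, hP a]

end PrimalDual

/-! ### The events preserve the invariants -/

namespace PrimalDual

variable {n : ℕ}

theorem mark_self (st : State n) (i : Fin n × Fin n) (u : Fin n) :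
    mark st i u (st.status i u) = st := by
  simp [mark]

theorem sameStruct_mark (st : State n) (i : Fin n × Fin n) (u : Fin n) (a : Status) :
    SameStruct st (mark st i u a) := ⟨rfl, rfl, rfl, rfl⟩

theorem sameStruct_historyState (I : PCSF n) (st : State n) (i : Fin n × Fin n) (u : Fin n) :
    SameStruct st (historyState I st i u) := ⟨rfl, rfl, rfl, rfl⟩

theorem sameStruct_payOut (I : PCSF n) (S : Finset (Fin n)) (st : State n) (i : Fin n × Fin n)
    (u : Fin n) : SameStruct st (payOut I S st i u) := by
  unfold payOut; split_ifs
  · exact ⟨rfl, rfl, rfl, rfl⟩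
  · exact .refl _

theorem sameStruct_unitePair (I : PCSF n) (S : Finset (Fin n)) (st : State n)
    (i : Fin n × Fin n) : SameStruct st (unitePair I S st i) :=
  ((sameStruct_payOut I S st i i.1).trans (sameStruct_payOut I S _ i i.2)).trans
    ((sameStruct_mark _ _ _ _).trans (sameStruct_mark _ _ _ _))

theorem status_payOut (I : PCSF n) (S : Finset (Fin n)) (st : State n) (i : Fin n × Fin n)
    (u : Fin n) : (payOut I S st i u).status = st.status := by
  unfold payOut; split_ifs <;> rfl

theorem status_mark (st : State n) (i : Fin n × Fin n) (u : Fin n) (a : Status)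
    (j : Fin n × Fin n) (v : Fin n) :
    (mark st i u a).status j v = if j = i ∧ v = u then a else st.status j v := by
  simp only [mark, Function.update_apply]
  by_cases hj : j = i
  · subst hj; by_cases hv : v = u <;> simp [hv]
  · simp [hj]

/-- ProcessHistory for one terminal, followed by the change of its label. -/
noncomputable def settle (I : PCSF n) (S : Finset (Fin n)) (st : State n) (i : Fin n × Fin n)
    (u : Fin n) (a : Status) : State n := mark (payOut I S st i u) i u a

open Classical in
/-- The new label of the terminals of a pair that is united. -/
noncomputable def unitedLabel (st : State n) (i : Fin n × Fin n) : Status :=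
  if st.status i i.1 = Status.alive ∧ st.status i i.2 = Status.alive
    then Status.satisfied else Status.dead

theorem payOut_mark_comm (I : PCSF n) (S : Finset (Fin n)) (st : State n) (i : Fin n × Fin n)
    {u v : Fin n} (a : Status) (h : u ≠ v) :
    payOut I S (mark st i u a) i v = mark (payOut I S st i v) i u a := by
  have h1 : (mark st i u a).status i v = st.status i v := by
    rw [status_mark]; simp [h.symm]
  unfold payOut
  rw [h1]
  split_ifs <;> rfl

/-- The two terminals of a pair that is united can be settled one after the other. -/
theorem unitePair_eq (I : PCSF n) (S : Finset (Fin n)) (st : State n) {i : Fin n × Fin n}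
    (h : i.1 ≠ i.2) : unitePair I S st i =
      settle I S (settle I S st i i.1 (unitedLabel st i)) i i.2 (unitedLabel st i) := by
  unfold settle
  rw [payOut_mark_comm I S _ i _ h]
  rfl

/-- The part of the invariants that changes when terminals are charged. -/
structure Balanced (I : PCSF n) (st : State n) : Prop where
  struct : Struct I st
  charges : Charges I st
  pot : PotEq I st

theorem Balanced.settle {I : PCSF n} {st : State n} (h : Balanced I st) {i : Fin n × Fin n}
    {u : Fin n} {a : Status} {S : Finset (Fin n)}
    (hx : (i, u) ∈ terms I) (ha : a ≠ Status.alive)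
    (hS : comp st u = S)
    (hboth : ∀ T ∈ st.formed, i.1 ∈ T → i.2 ∈ T → T = S) (hunch : st.uncharged S = 0)
    (hna : st.status i u ≠ Status.alive → st.status i u = a)
    (hdead : st.status i u = Status.alive → a = Status.dead →
      pen I i / 2 ≤ ∑ T ∈ st.formed, st.share i T) :
    Balanced I (settle I S st i u a) ∧ (PrimalDual.settle I S st i u a).uncharged S = 0 := by
  classical
  obtain ⟨hs, hC, hP⟩ := h
  by_cases hal : st.status i u = Status.alive
  swap
  · have : PrimalDual.settle I S st i u a = st := by
      rw [PrimalDual.settle, payOut, if_neg hal, ← hna hal, mark_self]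
    rw [this]; exact ⟨⟨hs, hC, hP⟩, hunch⟩
  have hsame : SameStruct st (PrimalDual.settle I S st i u a) :=
    (sameStruct_payOut I S st i u).trans (sameStruct_mark _ _ _ _)
  have heq : PrimalDual.settle I S st i u a = mark { historyState I st i u with
      potential := Function.update st.potential S (st.potential S - historyRest I st i u) }
        i u a := by
    rw [PrimalDual.settle, payOut, if_pos hal]
  have hst : (PrimalDual.settle I S st i u a).status = (mark st i u a).status := by rw [heq]; rfl
  have hun : (PrimalDual.settle I S st i u a).uncharged = (historyState I st i u).uncharged := by
    rw [heq]; rfl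
  have hsh : (PrimalDual.settle I S st i u a).share = (historyState I st i u).share := by
    rw [heq]; rfl
  have hpt : (PrimalDual.settle I S st i u a).potential =
      Function.update st.potential S (st.potential S - historyRest I st i u) := by rw [heq]; rfl
  obtain ⟨r0, hC', ule, uoff, uon⟩ := hC.charge (st' := PrimalDual.settle I S st i u a) hx hal ha
    (fun A hA B hB => hs.laminar A hA B hB u)
    (fun T hT h1 h2 => by rw [hboth T hT h1 h2]; exact hunch)
    hsame.formed hsame.y hun hsh hst (fun h => Or.inr (hdead hal h))
  refine ⟨⟨hs.congr hsame, hC', fun w => ?_⟩,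
    le_antisymm ((ule S).trans hunch.le) (hC'.unch_nonneg S)⟩
  rw [hsame.comp, hpt, aliveSum_update hx hal ha hst]
  by_cases hw : u ∈ comp st w
  · have hwS : comp st w = S := by rw [← hS, comp_eq_of_mem hw]
    rw [uon _ hw (fun T hT huT => by
      rw [hwS, ← hS]; exact hs.formed_sub T hT u huT), if_pos hw]
    have := hP w
    rw [hwS] at this ⊢
    rw [Function.update_self, this]; ring
  · have hwS : comp st w ≠ S := fun h => hw (h ▸ hS ▸ mem_comp_self st u)
    rw [uoff _ hw, if_neg hw, Function.update_of_ne hwS, hP w, sub_zero]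

/-- The conditions under which `unitePair` is called for the pair `i`. -/
structure Unitable (I : PCSF n) (S : Finset (Fin n)) (st : State n) (i : Fin n × Fin n) :
    Prop where
  mem : i ∈ pairs I
  left : comp st i.1 = S
  right : comp st i.2 = S
  both : ∀ T ∈ st.formed, i.1 ∈ T → i.2 ∈ T → T = S
  not_sat : st.status i i.1 ≠ Status.satisfied ∧ st.status i i.2 ≠ Status.satisfied

theorem status_unitePair (I : PCSF n) (S : Finset (Fin n)) (st : State n) (i j : Fin n × Fin n)
    (v : Fin n) : (unitePair I S st i).status j v =
      if j = i ∧ (v = i.1 ∨ v = i.2) then unitedLabel st i else st.status j v := by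
  have : (unitePair I S st i).status = (mark (mark st i i.1 (unitedLabel st i)) i i.2
      (unitedLabel st i)).status := by
    simp only [unitePair, mark, status_payOut]; rfl
  rw [this, status_mark, status_mark]
  by_cases hj : j = i <;> by_cases h1 : v = i.1 <;> by_cases h2 : v = i.2 <;> simp [hj, h1, h2]

theorem left_mem_terms {I : PCSF n} {i : Fin n × Fin n} (h : i ∈ pairs I) : (i, i.1) ∈ terms I :=
  mem_terms.2 ⟨h, Or.inl rfl⟩

theorem right_mem_terms {I : PCSF n} {i : Fin n × Fin n} (h : i ∈ pairs I) : (i, i.2) ∈ terms I :=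
  mem_terms.2 ⟨h, Or.inr rfl⟩

theorem Balanced.unitePair {I : PCSF n} {st : State n} (h : Balanced I st) {i : Fin n × Fin n}
    {S : Finset (Fin n)} (hu : Unitable I S st i) (hunch : st.uncharged S = 0) :
    Balanced I (unitePair I S st i) ∧ (PrimalDual.unitePair I S st i).uncharged S = 0 := by
  have hlt := (mem_pairs.1 hu.mem).1
  have hne := hlt.ne
  have hcases : ∀ a : Status, a ≠ Status.alive → a ≠ Status.satisfied → a = Status.dead := by
    intro a; cases a <;> simp
  have hlab : unitedLabel st i ≠ Status.alive := by
    unfold unitedLabel; split_ifs <;> simp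
  have hlab_of : ∀ u, (u = i.1 ∨ u = i.2) → st.status i u ≠ Status.alive →
      st.status i u = unitedLabel st i := by
    intro u hu' hna
    have h1 : st.status i u = Status.dead := by
      refine hcases _ hna ?_
      rcases hu' with rfl | rfl
      · exact hu.not_sat.1
      · exact hu.not_sat.2
    rw [h1, unitedLabel, if_neg]
    rintro ⟨h2, h3⟩
    rcases hu' with rfl | rfl
    · exact hna h2
    · exact hna h3
  rw [unitePair_eq I S st hne]
  set a := unitedLabel st i with ha
  obtain ⟨h1, h2⟩ := h.settle (a := a) (left_mem_terms hu.mem) hlab hu.left hu.both hunch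
    (hlab_of _ (Or.inl rfl)) (fun hal had => by
      have : st.status i i.2 ≠ Status.alive := by
        intro h2
        rw [ha, unitedLabel, if_pos ⟨hal, h2⟩] at had
        exact absurd had (by simp)
      exact h.charges.dead_share i i.2 (right_mem_terms hu.mem) (hcases _ this hu.not_sat.2))
  have hsame : SameStruct st (PrimalDual.settle I S st i i.1 a) :=
    (sameStruct_payOut I S st i i.1).trans (sameStruct_mark _ _ _ _)
  have hst : ∀ v, (PrimalDual.settle I S st i i.1 a).status i v =
      if v = i.1 then a else st.status i v := by
    intro v
    rw [PrimalDual.settle, status_mark, status_payOut]; simp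
  have hst2 : (PrimalDual.settle I S st i i.1 a).status i i.2 = st.status i i.2 := by
    rw [hst, if_neg hne.symm]
  refine h1.settle (a := a) (right_mem_terms hu.mem) hlab (by rw [hsame.comp, hu.right])
    (by rw [hsame.formed]; exact hu.both) h2 (by rw [hst2]; exact hlab_of _ (Or.inr rfl)) ?_
  intro _ had
  exact h1.charges.dead_share i i.1 (left_mem_terms hu.mem) (by rw [hst, if_pos rfl, had])

theorem Unitable.congr {I : PCSF n} {S : Finset (Fin n)} {st st' : State n} {i : Fin n × Fin n}
    (h : Unitable I S st i) (hs : SameStruct st st') (hst : st'.status i = st.status i) :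
    Unitable I S st' i :=
  ⟨h.mem, by rw [hs.comp, h.left], by rw [hs.comp, h.right], hs.formed ▸ h.both,
    by rw [hst]; exact h.not_sat⟩

/-- The loop over all pairs that are united by a new component. -/
theorem Balanced.foldl_unitePair {I : PCSF n} {S : Finset (Fin n)} (L : List (Fin n × Fin n))
    (hL : L.Nodup) {st : State n} (h : Balanced I st) (hu : ∀ i ∈ L, Unitable I S st i)
    (hunch : st.uncharged S = 0) :
    Balanced I (L.foldl (PrimalDual.unitePair I S) st) ∧
    (L.foldl (PrimalDual.unitePair I S) st).uncharged S = 0 ∧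
    SameStruct st (L.foldl (PrimalDual.unitePair I S) st) ∧
    (∀ j ∉ L, (L.foldl (PrimalDual.unitePair I S) st).status j = st.status j) ∧
    (∀ j ∈ L, ∀ v, (L.foldl (PrimalDual.unitePair I S) st).status j v =
      if v = j.1 ∨ v = j.2 then unitedLabel st j else st.status j v) := by
  induction L generalizing st with
  | nil => exact ⟨h, hunch, .refl _, fun _ _ => rfl, by simp⟩
  | cons i L ih =>
    obtain ⟨hiL, hL⟩ := List.nodup_cons.1 hL
    obtain ⟨h1, h2⟩ := h.unitePair (hu i List.mem_cons_self) hunch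
    have hst : ∀ j, j ≠ i → (PrimalDual.unitePair I S st i).status j = st.status j := by
      intro j hj; ext v; rw [status_unitePair]; simp [hj]
    have hsame := sameStruct_unitePair I S st i
    obtain ⟨a1, a2, a3, a4, a5⟩ := ih hL h1 (fun j hj => (hu j (List.mem_cons_of_mem _ hj)).congr
      hsame (hst j fun h' => hiL (h' ▸ hj))) h2
    refine ⟨a1, a2, hsame.trans a3, fun j hj => ?_, fun j hj v => ?_⟩
    · rw [List.mem_cons, not_or] at hj
      rw [List.foldl_cons, a4 j hj.2, hst j hj.1]
    · rw [List.foldl_cons]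
      rcases List.mem_cons.1 hj with rfl | hj
      · rw [a4 j hiL, status_unitePair]; simp
      · have hji : j ≠ i := fun h' => hiL (h' ▸ hj)
        rw [a5 j hj v, unitedLabel, unitedLabel, hst j hji]

/-- One iteration of the loop over the alive terminals of an exhausted component. -/
noncomputable def expire (I : PCSF n) (s : State n) (x : (Fin n × Fin n) × Fin n) : State n :=
  historyState I (mark s x.1 x.2 Status.dead) x.1 x.2

theorem sameStruct_expire (I : PCSF n) (s : State n) (x : (Fin n × Fin n) × Fin n) :
    SameStruct s (expire I s x) :=
  (sameStruct_mark _ _ _ _).trans (sameStruct_historyState _ _ _ _)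

theorem status_expire (I : PCSF n) (s : State n) (x : (Fin n × Fin n) × Fin n)
    (j : Fin n × Fin n) (v : Fin n) : (expire I s x).status j v =
      if (j, v) = x then Status.dead else s.status j v := by
  have : (expire I s x).status = (mark s x.1 x.2 Status.dead).status := rfl
  rw [this, status_mark]
  rcases x with ⟨a, b⟩
  simp

theorem Balanced.expire {I : PCSF n} {st : State n} (h : Balanced I st) {i : Fin n × Fin n}
    {u : Fin n} (hx : (i, u) ∈ terms I) (hal : st.status i u = Status.alive)
    (hpot : st.potential (comp st u) = 0) (hsep : ¬ st.forest.Reachable i.1 i.2) :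
    Balanced I (expire I st (i, u)) := by
  classical
  obtain ⟨hs, hC, hP⟩ := h
  have hchain : ∀ A ∈ st.formed, ∀ B ∈ st.formed, u ∈ A → u ∈ B → A ⊆ B ∨ B ⊆ A :=
    fun A hA B hB => hs.laminar A hA B hB u
  have hboth : ∀ T ∈ st.formed, i.1 ∈ T → i.2 ∈ T → st.uncharged T = 0 :=
    fun T hT h1 h2 => absurd (mem_comp.1 (hs.formed_sub T hT i.1 h1 h2)) hsep
  have hin : ∀ T ∈ st.formed, u ∈ T → T ⊆ comp st u := fun T hT huT => hs.formed_sub T hT u huT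
  -- all of the charge is used: compare with the Hall condition after charging
  have hr : historyRest I st i u = 0 := by
    have hst : (historyState I (mark st i u Status.satisfied) i u).status =
      (mark st i u Status.satisfied).status := rfl
    obtain ⟨r0, hC', -, -, uon⟩ := hC.charge
      (st' := historyState I (mark st i u Status.satisfied) i u) (a := Status.satisfied) hx hal
      (by simp) hchain hboth rfl rfl rfl rfl hst (by simp)
    have h1 := hC'.hall (comp st u)
    rw [uon _ (mem_comp_self st u) hin, aliveSum_update hx hal (by simp) hst,
      if_pos (mem_comp_self st u)] at h1
    have h2 := hP u
    linarith
  have hsame := sameStruct_expire I st (i, u)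
  have hst : (PrimalDual.expire I st (i, u)).status = (mark st i u Status.dead).status := rfl
  obtain ⟨r0, hC', ule, uoff, uon⟩ := hC.charge (st' := PrimalDual.expire I st (i, u))
    (a := Status.dead) hx hal (by simp) hchain hboth rfl rfl rfl rfl hst (fun _ => Or.inl hr)
  refine ⟨hs.congr hsame, hC', fun w => ?_⟩
  have hpt : (PrimalDual.expire I st (i, u)).potential = st.potential := rfl
  rw [hsame.comp, hpt, aliveSum_update hx hal (by simp) hst]
  by_cases hw : u ∈ comp st w
  · rw [uon _ hw (by rw [← comp_eq_of_mem hw]; exact hin), if_pos hw, hr, hP w]; ring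
  · rw [uoff _ hw, if_neg hw, hP w, sub_zero]

/-- The loop over the alive terminals of an exhausted component. -/
theorem Balanced.foldl_expire {I : PCSF n} {S : Finset (Fin n)}
    (L : List ((Fin n × Fin n) × Fin n)) (hL : L.Nodup) {st : State n} (h : Balanced I st)
    (hx : ∀ x ∈ L, x ∈ terms I ∧ st.status x.1 x.2 = Status.alive ∧ comp st x.2 = S ∧
      ¬ st.forest.Reachable x.1.1 x.1.2) (hpot : st.potential S = 0) :
    Balanced I (L.foldl (PrimalDual.expire I) st) ∧
    (L.foldl (PrimalDual.expire I) st).potential = st.potential ∧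
    SameStruct st (L.foldl (PrimalDual.expire I) st) ∧
    (∀ j v, (j, v) ∉ L → (L.foldl (PrimalDual.expire I) st).status j v = st.status j v) ∧
    (∀ x ∈ L, (L.foldl (PrimalDual.expire I) st).status x.1 x.2 = Status.dead) := by
  induction L generalizing st with
  | nil => exact ⟨h, rfl, .refl _, fun _ _ _ => rfl, by simp⟩
  | cons x L ih =>
    obtain ⟨hxL, hL⟩ := List.nodup_cons.1 hL
    obtain ⟨b1, b2, b3, b4⟩ := hx x List.mem_cons_self
    have h1 : Balanced I (PrimalDual.expire I st x) :=
      h.expire (i := x.1) (u := x.2) b1 b2 (by rw [b3, hpot]) b4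
    have hsame := sameStruct_expire I st x
    obtain ⟨a1, a2, a3, a4, a5⟩ := ih hL h1 (fun y hy => by
      obtain ⟨c1, c2, c3, c4⟩ := hx y (List.mem_cons_of_mem _ hy)
      refine ⟨c1, ?_, by rw [hsame.comp, c3], by rw [hsame.forest]; exact c4⟩
      rw [status_expire, if_neg (fun h' : y = x => hxL (h' ▸ hy)), c2]) hpot
    refine ⟨a1, a2, hsame.trans a3, fun j v hj => ?_, fun y hy => ?_⟩
    · rw [List.mem_cons, not_or] at hj
      rw [List.foldl_cons, a4 j v hj.2, status_expire, if_neg hj.1]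
    · rw [List.foldl_cons]
      rcases List.mem_cons.1 hy with rfl | hy
      · rw [a4 _ _ hxL, status_expire, if_pos rfl]
      · exact a5 y hy

theorem pairs_cases {I : PCSF n} {i : Fin n × Fin n} {u : Fin n} (h : (i, u) ∈ terms I) :
    i ∈ pairs I ∧ (u = i.1 ∨ u = i.2) := mem_terms.1 h

/-- A pair is united by the new component exactly if its endpoints lie in the two old ones. -/
theorem Struct.unites_merge_iff {I : PCSF n} {st : State n} (hS : Struct I st) {u v : Fin n}
    (huv : ¬ st.forest.Reachable u v) {i : Fin n × Fin n} (hne : i.1 ≠ i.2) :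
    Unites (PrimalDual.merge st u v) (comp st u ∪ comp st v) i ↔
      (i.1 ∈ comp st u ∪ comp st v ∧ i.2 ∈ comp st u ∪ comp st v) ∧
        ¬ st.forest.Reachable i.1 i.2 := by
  refine and_congr_right fun hmem => ⟨fun h hr => ?_, fun h T hT h1 h2 => ?_⟩
  · have hf : comp st i.1 ∈ st.formed := by
      refine (hS.comp_formed i.1).resolve_right fun h' => hne ?_
      have := mem_comp.2 hr
      rw [h', Finset.mem_singleton] at this
      exact this.symm
    exact comp_union_ne huv i.1 (h _ (Finset.mem_insert_of_mem hf) (mem_comp_self st _)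
      (mem_comp.2 hr))
  · rcases Finset.mem_insert.1 hT with rfl | hT
    · exact Finset.Subset.refl _
    · exact absurd (mem_comp.1 (hS.formed_sub T hT i.1 h1 h2)) h

theorem Inv.balanced {I : PCSF n} {st : State n} (h : Inv I st) : Balanced I st :=
  ⟨h.struct, h.charges, h.pot⟩

theorem Inv.merge_balanced {I : PCSF n} {st : State n} (h : Inv I st) {u v : Fin n}
    (ht : TightEdge I st u v) : Balanced I (merge st u v) :=
  ⟨h.struct.merge ht, h.charges.merge h.struct ht.2.1, h.pot.merge h.struct ht.2.1⟩

theorem Inv.unitable {I : PCSF n} {st : State n} (h : Inv I st) {u v : Fin n}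
    (huv : ¬ st.forest.Reachable u v) {i : Fin n × Fin n} (hi : i ∈ pairs I)
    (hun : Unites (merge st u v) (comp st u ∪ comp st v) i) :
    Unitable I (comp st u ∪ comp st v) (merge st u v) i := by
  have hne := (mem_pairs.1 hi).1.ne
  obtain ⟨⟨h1, h2⟩, h3⟩ := (h.struct.unites_merge_iff huv hne).1 hun
  refine ⟨hi, comp_merge_of_mem h1, comp_merge_of_mem h2, fun T hT a1 a2 => ?_, ?_, ?_⟩
  · rcases Finset.mem_insert.1 hT with rfl | hT
    · rfl
    · exact absurd (mem_comp.1 (h.struct.formed_sub T hT i.1 a1 a2)) h3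
  · exact fun hs => h3 (h.labels.sat_reach i hi hs)
  · exact fun hs => h3 (h.labels.sat_reach i hi ((h.labels.sat_iff i hi).2 hs))

theorem Inv.edge {I : PCSF n} {st : State n} (h : Inv I st) {u v : Fin n}
    (ht : TightEdge I st u v) {L : List (Fin n × Fin n)} (hL : L.Nodup)
    (hLm : ∀ i, i ∈ L ↔ i ∈ pairs I ∧ Unites (merge st u v) (comp st u ∪ comp st v) i) :
    Inv I (L.foldl (unitePair I (comp st u ∪ comp st v)) (merge st u v)) := by
  classical
  have huv := ht.2.1
  obtain ⟨a1, -, a3, a4, a5⟩ := (h.merge_balanced ht).foldl_unitePair L hL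
    (fun i hi => h.unitable huv ((hLm i).1 hi).1 ((hLm i).1 hi).2)
    (by simp [merge] : (merge st u v).uncharged (comp st u ∪ comp st v) = 0)
  refine ⟨a1.struct, a1.charges, a1.pot, ?_⟩
  set st' := L.foldl (unitePair I (comp st u ∪ comp st v)) (merge st u v) with hst'
  have hlab : ∀ i, unitedLabel (merge st u v) i ≠ Status.alive := by
    intro i; unfold unitedLabel; split_ifs <;> simp
  -- an alive terminal belongs to a pair that is not united
  have hal : ∀ i w, (i, w) ∈ terms I → st'.status i w = Status.alive →
      i ∉ L ∧ st.status i w = Status.alive := by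
    intro i w hx hs
    have hiL : i ∉ L := fun hi => by
      rw [a5 i hi w, if_pos (pairs_cases hx).2] at hs
      exact hlab i hs
    rw [a4 i hiL] at hs
    exact ⟨hiL, hs⟩
  have hmem : ∀ {a b : Fin n}, st.forest.Reachable a b → (merge st u v).forest.Reachable a b :=
    fun hab => hab.mono le_sup_left
  refine ⟨fun i w hx hs => ?_, fun i w hx hs => ?_, fun i hi => ?_, fun i hi hs => ?_⟩
  · obtain ⟨-, hs⟩ := hal i w hx hs
    have h1 := h.labels.alive_active i w hx hs
    rw [a3.comp, a3.active]
    by_cases hw : w ∈ comp st u ∪ comp st v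
    · rw [comp_merge_of_mem hw]; exact Finset.mem_insert_self _ _
    · rw [comp_merge_of_notMem hw]
      rw [Finset.mem_union, not_or] at hw
      refine Finset.mem_insert_of_mem (Finset.mem_erase.2 ⟨fun h' => hw.2 ?_,
        Finset.mem_erase.2 ⟨fun h' => hw.1 ?_, h1⟩⟩)
      · rw [← h']; exact mem_comp_self st w
      · rw [← h']; exact mem_comp_self st w
  · obtain ⟨hiL, hs⟩ := hal i w hx hs
    have hi := (pairs_cases hx).1
    have hsep := h.labels.alive_sep i w hx hs
    rw [a3.forest]
    intro hr
    refine hiL ((hLm i).2 ⟨hi, (h.struct.unites_merge_iff huv (mem_pairs.1 hi).1.ne).2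
      ⟨?_, hsep⟩⟩)
    have hr' := (reachable_sup_edge_iff st.forest u v i.1 i.2).1 hr
    simp only [Finset.mem_union, mem_comp]
    rcases hr' with h1 | ⟨h1, h2⟩ | ⟨h1, h2⟩
    · exact absurd h1 hsep
    · exact ⟨Or.inl h1.symm, Or.inr h2⟩
    · exact ⟨Or.inr h1.symm, Or.inl h2⟩
  · by_cases hiL : i ∈ L
    · rw [a5 i hiL, a5 i hiL, if_pos (Or.inl rfl), if_pos (Or.inr rfl)]
    · rw [a4 i hiL]; exact h.labels.sat_iff i hi
  · rw [a3.forest]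
    by_cases hiL : i ∈ L
    · have hu := h.unitable huv hi ((hLm i).1 hiL).2
      rw [← mem_comp, hu.left, ← hu.right]; exact mem_comp_self _ _
    · rw [a4 i hiL] at hs
      exact hmem (h.labels.sat_reach i hi hs)

theorem Inv.erase_balanced {I : PCSF n} {st : State n} (h : Inv I st) (S : Finset (Fin n)) :
    Balanced I { st with active := st.active.erase S } := by
  obtain ⟨hs, hC, hP⟩ := h.balanced
  exact ⟨⟨hs.forest_le, hs.acyclic, hs.formed_sub, hs.formed_ne, hs.laminar, hs.comp_formed,
    hs.term_formed, (Finset.erase_subset _ _).trans hs.active_sub,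
    fun T hT => hs.active_comp T (Finset.mem_of_mem_erase hT), hs.y_nonneg, hs.load_le,
    hs.tight⟩, ⟨hC.unch_nonneg, hC.share_nonneg, hC.hall, hC.y_eq, hC.share_supp,
    hC.share_alive, hC.share_le, hC.dead_share⟩, hP⟩

/-- The terminals of an active component that are marked dead meet the conditions of
`Balanced.foldl_expire`. -/
theorem Inv.expirable {I : PCSF n} {st : State n} (h : Inv I st) {S : Finset (Fin n)}
    (hS : S ∈ st.active) {x : (Fin n × Fin n) × Fin n} (hx : x ∈ terms I) (hxS : x.2 ∈ S)
    (hal : st.status x.1 x.2 = Status.alive) :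
    x ∈ terms I ∧ st.status x.1 x.2 = Status.alive ∧ comp st x.2 = S ∧
      ¬ st.forest.Reachable x.1.1 x.1.2 := by
  obtain ⟨c, rfl⟩ := h.struct.active_comp S hS
  exact ⟨hx, hal, comp_eq_of_mem hxS, h.labels.alive_sep _ _ hx hal⟩

theorem Inv.exhausted {I : PCSF n} {st : State n} (h : Inv I st) {S : Finset (Fin n)}
    (hS : S ∈ st.active) (hpot : st.potential S = 0) {L : List ((Fin n × Fin n) × Fin n)}
    (hL : L.Nodup) (hLm : ∀ x, x ∈ L ↔ x.1 ∈ pairs I ∧ (x.2 = x.1.1 ∨ x.2 = x.1.2) ∧ x.2 ∈ S ∧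
        st.status x.1 x.2 = Status.alive) :
    Inv I (L.foldl (expire I) { st with active := st.active.erase S }) := by
  set st₁ : State n := { st with active := st.active.erase S } with hst₁
  obtain ⟨a1, -, a3, a4, a5⟩ := (h.erase_balanced S).foldl_expire (S := S) L hL (fun x hx => by
    obtain ⟨h1, h2, h3, h4⟩ := (hLm x).1 hx
    exact h.expirable hS (mem_terms.2 ⟨h1, h2⟩) h3 h4) hpot
  refine ⟨a1.struct, a1.charges, a1.pot, ?_⟩
  set st' := L.foldl (expire I) st₁ with hst'
  have hal : ∀ i w, (i, w) ∈ terms I → st'.status i w = Status.alive →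
      w ∉ S ∧ st.status i w = Status.alive := by
    intro i w hx hs
    have hiL : (i, w) ∉ L := fun hi => by
      have := a5 _ hi
      simp only at this
      rw [this] at hs; exact absurd hs (by simp)
    rw [a4 i w hiL] at hs
    exact ⟨fun hw => hiL ((hLm _).2 ⟨(pairs_cases hx).1, (pairs_cases hx).2, hw, hs⟩), hs⟩
  have hsat : ∀ i w, (i, w) ∈ terms I →
      (st'.status i w = Status.satisfied ↔ st.status i w = Status.satisfied) := by
    intro i w hx
    by_cases hiL : (i, w) ∈ L
    · have h1 := a5 _ hiL
      have h2 := ((hLm _).1 hiL).2.2.2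
      simp only at h1 h2
      rw [h1, h2]; simp
    · rw [a4 i w hiL]
  refine ⟨fun i w hx hs => ?_, fun i w hx hs => ?_, fun i hi => ?_, fun i hi hs => ?_⟩
  · obtain ⟨hw, hs⟩ := hal i w hx hs
    rw [a3.comp, a3.active]
    refine Finset.mem_erase.2 ⟨fun h' => hw (h' ▸ mem_comp_self st w),
      h.labels.alive_active i w hx hs⟩
  · rw [a3.forest]
    exact h.labels.alive_sep i w hx (hal i w hx hs).2
  · rw [hsat i _ (left_mem_terms hi), hsat i _ (right_mem_terms hi)]
    exact h.labels.sat_iff i hi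
  · rw [a3.forest]
    exact h.labels.sat_reach i hi ((hsat i _ (left_mem_terms hi)).1 hs)

theorem comp_init (I : PCSF n) (u : Fin n) : comp (init I) u = {u} := by
  ext v
  rw [mem_comp, Finset.mem_singleton]
  change (⊥ : SimpleGraph (Fin n)).Reachable u v ↔ _
  rw [SimpleGraph.reachable_bot]; exact eq_comm

theorem mem_formed_init {I : PCSF n} {T : Finset (Fin n)} :
    T ∈ (init I).formed ↔ ∃ i u, (i, u) ∈ terms I ∧ T = {u} := by
  simp only [init, Finset.mem_union, Finset.mem_image]
  constructor
  · rintro (⟨i, hi, rfl⟩ | ⟨i, hi, rfl⟩)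
    · exact ⟨i, _, left_mem_terms hi, rfl⟩
    · exact ⟨i, _, right_mem_terms hi, rfl⟩
  · rintro ⟨i, u, hx, rfl⟩
    obtain ⟨hi, rfl | rfl⟩ := pairs_cases hx
    · exact Or.inl ⟨i, hi, rfl⟩
    · exact Or.inr ⟨i, hi, rfl⟩

theorem active_init (I : PCSF n) : (init I).active = (init I).formed := rfl

theorem load_init (I : PCSF n) (e : Sym2 (Fin n)) : load (init I) e = 0 :=
  Finset.sum_eq_zero fun _ _ => rfl

theorem unchSum_init (I : PCSF n) (X : Finset (Fin n)) : unchSum (init I) X = 0 :=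
  Finset.sum_eq_zero fun _ _ => rfl

theorem aliveSum_nonneg (I : PCSF n) (st : State n) (X : Finset (Fin n)) : 0 ≤ aliveSum I st X :=
  Finset.sum_nonneg fun _ _ => div_nonneg (pen_nonneg _ _) zero_le_two

open Classical in
theorem potential_init (I : PCSF n) (u : Fin n) :
    (init I).potential {u} = aliveSum I (init I) {u} := by
  simp only [init, aliveSum, Finset.singleton_inj, Finset.mem_singleton, and_true]
  refine Finset.sum_nbij' (fun i => (i, u)) Prod.fst ?_ ?_ ?_ ?_ ?_
  · intro i hi
    obtain ⟨hi, h⟩ := Finset.mem_filter.1 hi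
    exact Finset.mem_filter.2 ⟨mem_terms.2 ⟨hi, h⟩, rfl⟩
  · rintro ⟨i, w⟩ hx
    obtain ⟨hx', hw⟩ := Finset.mem_filter.1 hx
    simp only at hw
    subst hw
    exact Finset.mem_filter.2 (pairs_cases hx')
  · intro i _; rfl
  · rintro ⟨i, w⟩ hx
    have hw := (Finset.mem_filter.1 hx).2
    simp only at hw
    rw [hw]
  · intro i _; rfl

theorem inv_init (I : PCSF n) : Inv I (init I) := by
  refine ⟨⟨bot_le, SimpleGraph.isAcyclic_bot, ?_, ?_, ?_, fun u => Or.inr (comp_init I u), ?_,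
    (active_init I).subset, ?_, fun _ _ => le_rfl, fun e _ => ?_, ?_⟩,
    ⟨fun _ => le_rfl, fun _ _ => le_rfl, fun X => ?_, fun _ _ => ?_, ?_, fun _ _ _ _ _ _ => rfl,
      fun i u _ => ?_, ?_⟩, fun u => ?_, ⟨?_, ?_, ?_, ?_⟩⟩
  · intro T hT u hu
    obtain ⟨i, w, -, rfl⟩ := mem_formed_init.1 hT
    rw [Finset.mem_singleton.1 hu, comp_init]
  · intro T hT
    obtain ⟨i, w, -, rfl⟩ := mem_formed_init.1 hT
    exact Finset.singleton_nonempty w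
  · intro S hS T hT u hu hu'
    obtain ⟨i, w, -, rfl⟩ := mem_formed_init.1 hS
    obtain ⟨i, w', -, rfl⟩ := mem_formed_init.1 hT
    rw [Finset.mem_singleton] at hu hu'
    subst hu; subst hu'
    exact Or.inl (Finset.Subset.refl _)
  · intro i u h; exact mem_formed_init.2 ⟨i, u, h, rfl⟩
  · intro S hS
    obtain ⟨i, w, -, rfl⟩ := mem_formed_init.1 hS
    exact ⟨w, comp_init I w⟩
  · rw [load_init]; exact I.cost_nonneg e
  · intro e he; exact absurd he (by simp [init])
  · rw [unchSum_init]; exact aliveSum_nonneg _ _ _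
  · simp [init]
  · intro i _ T hT; exact absurd rfl hT
  · simp only [init, Finset.sum_const_zero]
    exact div_nonneg (pen_nonneg _ _) zero_le_two
  · intro i u _ hs; exact absurd hs (by simp [init])
  · rw [comp_init, unchSum_init, potential_init, sub_zero]
  · intro i u hx _; rw [comp_init]; exact mem_formed_init.2 ⟨i, u, hx, rfl⟩
  · intro i u hx _
    change ¬ (⊥ : SimpleGraph (Fin n)).Reachable _ _
    rw [SimpleGraph.reachable_bot]; exact (mem_pairs.1 (pairs_cases hx).1).1.ne
  · intro i _; simp [init]
  · intro i _ hs; exact absurd hs (by simp [init])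

theorem Inv.step {I : PCSF n} {st st' : State n} (h : Inv I st) (hs : Step I st st') :
    Inv I st' := by
  cases hs with
  | edge d u v L hd hw ht hL hLm => exact (h.grow hd hw).edge ht hL hLm
  | exhausted d S L hd hw hS hpot hL hLm =>
    exact (h.grow hd hw).exhausted (S := S) hS hpot hL hLm

theorem inv_of_reaches {I : PCSF n} {st : State n} (h : Relation.ReflTransGen (Step I) (init I) st) :
    Inv I st := by
  induction h with
  | refl => exact inv_init I
  | tail _ hs ih => exact ih.step hs

end PrimalDual

/-! ### The cost of the output -/

namespace PrimalDual

variable {n : ℕ}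

theorem joins_mk {F : SimpleGraph (Fin n)} {a b : Fin n} : Joins F s(a, b) ↔ F.Reachable a b := by
  refine ⟨fun h => h a (Sym2.mem_mk_left a b) b (Sym2.mem_mk_right a b), fun h u hu v hv => ?_⟩
  rw [Sym2.mem_iff] at hu hv
  rcases hu with rfl | rfl <;> rcases hv with rfl | rfl
  · exact .refl _
  · exact h
  · exact h.symm
  · exact .refl _

theorem exists_cuts_of_reachable {G : SimpleGraph (Fin n)} {a b : Fin n} (h : G.Reachable a b)
    {S : Finset (Fin n)} (hS : a ∈ S ↔ b ∉ S) : ∃ e ∈ G.edgeSet, Cuts S e := by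
  obtain ⟨p⟩ := h
  induction p with
  | nil => tauto
  | @cons a c b hac p ih =>
    by_cases hc : a ∈ S ↔ c ∉ S
    · exact ⟨s(a, c), hac, cuts_mk.2 (by tauto)⟩
    · exact ih (by tauto)

theorem KeepsSatisfied.mono {I : PCSF n} {st : State n} {F G : SimpleGraph (Fin n)} (h : F ≤ G)
    (hF : KeepsSatisfied I st F) : KeepsSatisfied I st G :=
  fun i hi h1 h2 => (hF i hi h1 h2).mono h

open Classical in
theorem prune_spec (I : PCSF n) (st : State n) (L : List (Sym2 (Fin n)))
    (F : SimpleGraph (Fin n)) (hF : KeepsSatisfied I st F) (R : SimpleGraph (Fin n))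
    (hR : L.foldl (fun F e => if KeepsSatisfied I st (F.deleteEdges {e})
      then F.deleteEdges {e} else F) F = R) :
    R ≤ F ∧ KeepsSatisfied I st R ∧
      ∀ e ∈ L, e ∈ R.edgeSet → ¬ KeepsSatisfied I st (R.deleteEdges {e}) := by
  induction L generalizing F with
  | nil => subst hR; exact ⟨le_rfl, hF, by simp⟩
  | cons e L ih =>
    rw [List.foldl_cons] at hR
    split_ifs at hR with hk
    · obtain ⟨h1, h2, h3⟩ := ih _ hk hR
      refine ⟨h1.trans (F.deleteEdges_le _), h2, fun f hf hfR => ?_⟩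
      rcases List.mem_cons.1 hf with rfl | hf
      · have := SimpleGraph.edgeSet_mono h1 hfR
        simp [SimpleGraph.edgeSet_deleteEdges] at this
      · exact h3 f hf hfR
    · obtain ⟨h1, h2, h3⟩ := ih _ hF hR
      refine ⟨h1, h2, fun f hf hfR => ?_⟩
      rcases List.mem_cons.1 hf with rfl | hf
      · exact fun h => hk (h.mono (SimpleGraph.deleteEdges_mono h1))
      · exact h3 f hf hfR

/-- The total growth. -/
noncomputable def dualSum (st : State n) : ℝ := ∑ S ∈ st.formed, st.y S

theorem dualSum_grow {I : PCSF n} {st : State n} (h : Struct I st) (d : ℝ) :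
    dualSum (grow st d) = dualSum st + d * st.active.card := by
  classical
  have h1 : (grow st d).formed = st.formed := rfl
  rw [dualSum, dualSum, h1, mul_comm, ← nsmul_eq_mul, ← Finset.sum_const]
  have h2 : st.active = st.formed.filter (fun S => S ∈ st.active) := by
    ext S
    simp only [Finset.mem_filter]
    exact ⟨fun hS => ⟨h.active_sub hS, hS⟩, fun hS => hS.2⟩
  conv_rhs => rw [h2]
  rw [Finset.sum_filter, ← Finset.sum_add_distrib]
  refine Finset.sum_congr rfl fun T _ => ?_
  simp only [grow]
  split_ifs <;> simp

theorem dualSum_merge {I : PCSF n} {st : State n} (h : Struct I st) {u v : Fin n}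
    (huv : ¬ st.forest.Reachable u v) : dualSum (merge st u v) = dualSum st := by
  have hn := h.union_notMem huv
  rw [dualSum, dualSum]
  simp only [merge]
  rw [Finset.sum_insert hn, Function.update_self, zero_add]
  refine Finset.sum_congr rfl fun S hS => ?_
  rw [Function.update_of_ne]
  rintro rfl
  exact hn hS

theorem SameStruct.dualSum {st st' : State n} (h : SameStruct st st') :
    dualSum st' = dualSum st := by
  unfold PrimalDual.dualSum; rw [h.formed, h.y]

/-- The effect of an iteration on the forest, the dual variables and the labels. -/
theorem Inv.step_spec {I : PCSF n} {st st' : State n} (h : Inv I st) (hs : Step I st st') :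
    st.forest ≤ st'.forest ∧
    (∀ i u, (i, u) ∈ terms I → st.status i u = Status.dead → st'.status i u = Status.dead) ∧
    ∃ d, 0 ≤ d ∧ (∀ e, load st' e = load (PrimalDual.grow st d) e) ∧
      dualSum st' = dualSum (PrimalDual.grow st d) := by
  cases hs with
  | edge d u v L hd hw ht hL hLm =>
    have hg := h.grow hd hw
    have huv := ht.2.1
    obtain ⟨-, -, a3, a4, a5⟩ := (hg.merge_balanced ht).foldl_unitePair L hL
      (fun i hi => hg.unitable huv ((hLm i).1 hi).1 ((hLm i).1 hi).2) (by
        simp [merge])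
    refine ⟨?_, fun i w hx hs => ?_, d, hd, fun e => ?_, ?_⟩
    · change _ ≤ (List.foldl (unitePair I (comp (PrimalDual.grow st d) u ∪ comp (PrimalDual.grow st d) v))
        (PrimalDual.merge (PrimalDual.grow st d) u v) L).forest
      rw [a3.forest]; exact le_sup_left (a := st.forest)
    · change (List.foldl (unitePair I (comp (PrimalDual.grow st d) u ∪ comp (PrimalDual.grow st d) v))
        (PrimalDual.merge (PrimalDual.grow st d) u v) L).status i w = _
      by_cases hiL : i ∈ L
      · rw [a5 i hiL w, if_pos (pairs_cases hx).2, unitedLabel, if_neg]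
        rintro ⟨h1, h2⟩
        change st.status i _ = _ at h1
        change st.status i _ = _ at h2
        rcases (pairs_cases hx).2 with rfl | rfl
        · rw [hs] at h1; exact absurd h1 (by simp)
        · rw [hs] at h2; exact absurd h2 (by simp)
      · rw [a4 i hiL]; exact hs
    · exact (a3.load e).trans (load_merge hg.struct huv e)
    · exact a3.dualSum.trans (dualSum_merge hg.struct huv)
  | exhausted d S L hd hw hS hpot hL hLm =>
    have key : ∀ (L : List ((Fin n × Fin n) × Fin n)) (s : State n),
        SameStruct s (L.foldl (expire I) s) ∧
        ∀ i w, s.status i w = Status.dead → (L.foldl (expire I) s).status i w = Status.dead := by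
      intro L
      induction L with
      | nil => exact fun s => ⟨.refl _, fun _ _ h => h⟩
      | cons x L ih =>
        intro s
        obtain ⟨h1, h2⟩ := ih (expire I s x)
        refine ⟨(sameStruct_expire I s x).trans h1, fun i w hd => h2 i w ?_⟩
        rw [status_expire]; split_ifs
        · rfl
        · exact hd
    obtain ⟨k1, k2⟩ := key L { PrimalDual.grow st d with active := st.active.erase S }
    refine ⟨k1.forest.ge, fun i w _ hs => k2 i w hs, d, hd, fun e => ?_, ?_⟩
    · exact k1.load e
    · exact k1.dualSum

theorem reaches_spec {I : PCSF n} {st st' : State n} (h : Inv I st)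
    (hs : Relation.ReflTransGen (Step I) st st') :
    Inv I st' ∧ st.forest ≤ st'.forest ∧
    (∀ i u, (i, u) ∈ terms I → st.status i u = Status.dead → st'.status i u = Status.dead) := by
  induction hs with
  | refl => exact ⟨h, le_rfl, fun _ _ _ h => h⟩
  | tail _ hs ih =>
    obtain ⟨h1, h2, h3⟩ := ih
    obtain ⟨k1, k2, -⟩ := h1.step_spec hs
    exact ⟨h1.step hs, h2.trans k1, fun i u hx hd => k2 i u hx (h3 i u hx hd)⟩

section Length

open Classical

/-- At any time, the active components have average degree at most `2` in the pruned forest `F` of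
a later state. -/
theorem Inv.sum_cuts_le {I : PCSF n} {st stf : State n} (h : Inv I st) (hf : Inv I stf)
    (hle : st.forest ≤ stf.forest)
    (hdead : ∀ i u, (i, u) ∈ terms I → st.status i u = Status.dead →
      stf.status i u = Status.dead)
    {F : SimpleGraph (Fin n)} (hF : F ≤ stf.forest) (hk : KeepsSatisfied I stf F)
    (hmin : ∀ e ∈ F.edgeSet, ¬ KeepsSatisfied I stf (F.deleteEdges {e})) :
    ∑ e with e ∈ F.edgeSet, (st.active.filter (fun S => Cuts S e)).card ≤
      2 * st.active.card := by
  -- the edges of `F` that join different components of the current forest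
  set D : Finset (Sym2 (Fin n)) :=
    Finset.univ.filter (fun e => e ∈ F.edgeSet ∧ ∃ S ∈ clusters st.forest, Cuts S e) with hD
  have hmemD : ∀ a b, s(a, b) ∈ D ↔ F.Adj a b ∧ ¬ st.forest.Reachable a b := by
    intro a b
    simp only [hD, Finset.mem_filter, Finset.mem_univ, true_and, SimpleGraph.mem_edgeSet]
    refine and_congr_right fun _ => ⟨?_, fun h => ?_⟩
    · rintro ⟨S, hS, hc⟩; exact ((cuts_cluster_mk hS).1 hc).1
    · exact ⟨_, cluster_mem_clusters _ a,
        (cuts_cluster_mk (cluster_mem_clusters _ a)).2 ⟨h, Or.inl rfl⟩⟩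
  have hswap : ∑ e with e ∈ F.edgeSet, (st.active.filter (fun S => Cuts S e)).card =
      ∑ S ∈ st.active, (D.filter (Cuts S)).card := by
    simp only [Finset.card_filter]
    rw [Finset.sum_comm]
    refine Finset.sum_congr rfl fun S hS => ?_
    rw [← Finset.card_filter, ← Finset.card_filter]
    congr 1
    ext e
    simp only [hD, Finset.mem_filter, Finset.mem_univ, true_and]
    exact ⟨fun h' => ⟨⟨h'.1, S, h.struct.active_clusters hS, h'.2⟩, h'.2⟩,
      fun h' => ⟨h'.1.1, h'.2⟩⟩
  rw [hswap]
  refine sum_card_cuts_le st.forest D ?_ (fun a b hab => ((hmemD a b).1 hab).2) st.active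
    h.struct.active_clusters ?_
  · refine SimpleGraph.IsAcyclic.anti (sup_le hle ?_) hf.struct.acyclic
    intro a b hab
    rw [SimpleGraph.fromEdgeSet_adj] at hab
    exact hF ((hmemD a b).1 hab.1).1
  · -- a leaf `S` that is not active would be cut off from no pair of satisfied terminals
    intro S hS hSa hcard
    obtain ⟨e, he⟩ := Finset.card_eq_one.1 hcard
    have huniq : ∀ f ∈ F.edgeSet, Cuts S f → f = e := by
      intro f hf hc
      have : f ∈ D.filter (Cuts S) := by
        simp only [hD, Finset.mem_filter, Finset.mem_univ, true_and]
        exact ⟨⟨hf, S, hS, hc⟩, hc⟩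
      rw [he] at this
      exact Finset.mem_singleton.1 this
    have heD : e ∈ D ∧ Cuts S e := by
      have : e ∈ D.filter (Cuts S) := by rw [he]; exact Finset.mem_singleton_self e
      exact Finset.mem_filter.1 this
    have heF : e ∈ F.edgeSet := (Finset.mem_filter.1 heD.1).2.1
    have hne := hmin e heF
    unfold KeepsSatisfied at hne
    push Not at hne
    obtain ⟨i, hi, hs1, hs2, hnr⟩ := hne
    have hr := hk i hi hs1 hs2
    -- without `e` the set `S` is a union of components of `F`
    have hpres : ∀ a b, (F.deleteEdges {e}).Reachable a b → (a ∈ S ↔ b ∈ S) := by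
      intro a b hab
      by_contra hc
      obtain ⟨f, hf, hcf⟩ := exists_cuts_of_reachable hab (S := S) (by tauto)
      rw [SimpleGraph.edgeSet_deleteEdges] at hf
      exact hf.2 (huniq f hf.1 hcf)
    have hsep : i.1 ∈ S ↔ i.2 ∉ S := by
      induction e with
      | h a b =>
      have hF' : F = F.deleteEdges {s(a, b)} ⊔ SimpleGraph.edge a b := by
        ext x y
        rw [SimpleGraph.sup_adj, SimpleGraph.deleteEdges_adj, SimpleGraph.edge_adj,
          Set.mem_singleton_iff, Sym2.eq_iff]
        constructor
        · intro hxy; have := hxy.ne; tauto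
        · rintro (h | ⟨⟨rfl, rfl⟩ | ⟨rfl, rfl⟩, -⟩)
          · exact h.1
          · exact heF
          · exact (SimpleGraph.mem_edgeSet F).1 heF |>.symm
      rw [hF', reachable_sup_edge_iff] at hr
      have hab : a ∈ S ↔ b ∉ S := by have := cuts_mk.1 heD.2; tauto
      rcases hr with hr | ⟨h1, h2⟩ | ⟨h1, h2⟩
      · exact absurd hr hnr
      · rw [hpres _ _ h1, ← hpres _ _ h2]; exact hab
      · rw [hpres _ _ h1, ← hpres _ _ h2]; tauto
    obtain ⟨c, rfl⟩ := mem_clusters.1 hS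
    -- a terminal of `i` in the inactive component `S` is neither alive nor dead, and it is not
    -- satisfied either, since then `S` would contain both endpoints
    have hlive : ∀ w, (w = i.1 ∨ w = i.2) → w ∈ cluster st.forest c →
        stf.status i w = Status.satisfied → False := by
      intro w hw hwS hsat
      have hx : (i, w) ∈ terms I := mem_terms.2 ⟨hi, hw⟩
      cases hst : st.status i w with
      | alive =>
        refine hSa ?_
        have := h.labels.alive_active i w hx hst
        rwa [comp_eq_cluster, cluster_eq_of_mem hwS] at this
      | satisfied =>
        have hs1 : st.status i i.1 = Status.satisfied := by
          rcases hw with rfl | rfl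
          · exact hst
          · exact (h.labels.sat_iff i hi).2 hst
        have h12 := h.labels.sat_reach i hi hs1
        have : i.1 ∈ cluster st.forest c ↔ i.2 ∈ cluster st.forest c := by
          rw [mem_cluster, mem_cluster]
          exact ⟨fun h => h.trans h12, fun h => h.trans h12.symm⟩
        tauto
      | dead => rw [hdead i w hx hst] at hsat; exact absurd hsat (by simp)
    by_cases h1 : i.1 ∈ cluster st.forest c
    · exact hlive _ (Or.inl rfl) h1 hs1
    · exact hlive _ (Or.inr rfl) (by tauto) hs2

/-- The edges that survive the deletion phase are paid for twice by the dual variables: this is the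
degree bound, integrated over time. -/
theorem sum_load_le {I : PCSF n} {st stf : State n}
    (h : Relation.ReflTransGen (Step I) (init I) st)
    (hf : Relation.ReflTransGen (Step I) st stf)
    {F : SimpleGraph (Fin n)} (hF : F ≤ stf.forest) (hk : KeepsSatisfied I stf F)
    (hmin : ∀ e ∈ F.edgeSet, ¬ KeepsSatisfied I stf (F.deleteEdges {e})) :
    ∑ e with e ∈ F.edgeSet, load st e ≤ 2 * dualSum st := by
  induction h with
  | refl =>
    rw [Finset.sum_eq_zero fun e _ => load_init I e, dualSum,
      Finset.sum_eq_zero (f := (init I).y) fun S _ => rfl]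
    simp
  | @tail st st' h hs ih =>
    have hf' := Relation.ReflTransGen.head hs hf
    have hi := inv_of_reaches h
    obtain ⟨r1, r2, r3⟩ := reaches_spec hi hf'
    obtain ⟨-, -, d, hd, hload, hdual⟩ := hi.step_spec hs
    have h1 := hi.sum_cuts_le r1 r2 r3 hF hk hmin
    have h2 := ih hf'
    simp only [hload, hdual, load_grow hi.struct, dualSum_grow hi.struct]
    rw [Finset.sum_add_distrib, ← Finset.mul_sum]
    have h3 : (∑ e with e ∈ F.edgeSet, ((st.active.filter (fun S => Cuts S e)).card : ℝ)) ≤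
      2 * st.active.card := by exact_mod_cast h1
    have h4 := mul_le_mul_of_nonneg_left h3 hd
    linarith

/-- The certificate behind both guarantees: `share i` is the total charge of the pair `i`.  It pays
for half of the edges of `F`, it reaches half of the penalty if `F` does not connect the pair, and
on the pairs that `G` connects it is a lower bound for the length of `G`. -/
theorem Output.certificate {I : PCSF n} {F : SimpleGraph (Fin n)} (h : Output I F) :
    I.IsForest F ∧ ∃ share : Fin n × Fin n → ℝ, (∀ i, 0 ≤ share i) ∧
      I.length F ≤ 2 * ∑ i ∈ pairs I, share i ∧
      (∀ i ∈ pairs I, ¬ F.Reachable i.1 i.2 → pen I i ≤ 2 * share i) ∧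
      (∀ i ∈ pairs I, share i ≤ pen I i) ∧
      ∀ G ≤ I.graph, ∑ i ∈ pairs I with G.Reachable i.1 i.2, share i ≤ I.length G := by
  obtain ⟨st, hreach, hact, L, -, hL, rfl⟩ := h
  have hi := inv_of_reaches hreach
  have hk0 : KeepsSatisfied I st st.forest := fun i hi' h1 _ => hi.labels.sat_reach i hi' h1
  obtain ⟨p1, p2, p3⟩ := prune_spec I st L st.forest hk0 (prune I st L) rfl
  set F := prune I st L with hF
  have hmin : ∀ e ∈ F.edgeSet, ¬ KeepsSatisfied I st (F.deleteEdges {e}) :=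
    fun e he => p3 e ((hL e).2 (SimpleGraph.edgeSet_mono p1 he)) he
  have hnoalive : ∀ i u, (i, u) ∈ terms I → st.status i u ≠ Status.alive := by
    intro i u hx hs
    have := hi.labels.alive_active i u hx hs
    rw [hact] at this; simp at this
  -- no terminal is left alive, so by the Hall condition all growth has been charged
  have hunch : ∀ T ∈ st.formed, st.uncharged T = 0 := by
    have h1 := hi.charges.hall Finset.univ
    have h2 : aliveSum I st Finset.univ = 0 := by
      refine Finset.sum_eq_zero fun x hx => ?_
      obtain ⟨hx, -, hs⟩ := Finset.mem_filter.1 hx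
      exact absurd hs (hnoalive x.1 x.2 hx)
    have h3 : unchSum st Finset.univ = 0 :=
      le_antisymm (h1.trans h2.le) (unchSum_nonneg hi.charges _)
    intro T hT
    exact (Finset.sum_eq_zero_iff_of_nonneg fun T _ => hi.charges.unch_nonneg T).1 h3 T
      (Finset.mem_filter.2 ⟨hT, Finset.subset_univ T⟩)
  have hy : ∀ T ∈ st.formed, st.y T = ∑ i ∈ pairs I, st.share i T := by
    intro T hT; rw [hi.charges.y_eq T hT, hunch T hT, zero_add]
  refine ⟨⟨p1.trans hi.struct.forest_le, hi.struct.acyclic.anti p1⟩,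
    fun i => ∑ T ∈ st.formed, st.share i T,
    fun i => Finset.sum_nonneg fun T _ => hi.charges.share_nonneg i T, ?_, ?_, ?_, ?_⟩
  · have h1 := sum_load_le hreach .refl p1 p2 hmin
    have h2 : I.length F = ∑ e with e ∈ F.edgeSet, load st e := by
      refine Finset.sum_congr rfl fun e he => ?_
      exact (hi.struct.tight e (SimpleGraph.edgeSet_mono p1 (Finset.mem_filter.1 he).2)).symm
    have h3 : dualSum st = ∑ i ∈ pairs I, ∑ T ∈ st.formed, st.share i T := by
      rw [Finset.sum_comm]; exact Finset.sum_congr rfl hy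
    rw [h2, ← h3]; exact h1
  · intro i hip hnr
    have hx := left_mem_terms hip
    have hd : st.status i i.1 = Status.dead := by
      cases hst : st.status i i.1 with
      | alive => exact absurd hst (hnoalive i _ hx)
      | satisfied =>
        exact absurd (p2 i hip hst ((hi.labels.sat_iff i hip).1 hst)) hnr
      | dead => rfl
    have := hi.charges.dead_share i _ hx hd
    linarith
  · intro i hip
    have h1 := hi.charges.share_le i _ (left_mem_terms hip)
    have h2 := hi.charges.share_le i _ (right_mem_terms hip)
    have h3 : ∑ T ∈ st.formed, st.share i T ≤
        ∑ T ∈ st.formed, ((if i.1 ∈ T then st.share i T else 0) +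
          (if i.2 ∈ T then st.share i T else 0)) := by
      refine Finset.sum_le_sum fun T _ => ?_
      by_cases hs : st.share i T = 0
      · simp [hs]
      · have := (hi.charges.share_supp i hip T hs).2
        split_ifs <;> first | linarith | tauto
    rw [Finset.sum_add_distrib, ← Finset.sum_filter, ← Finset.sum_filter] at h3
    linarith
  · -- `G` has to cross every set that separates a pair connected by `G`
    intro G hG
    rw [Finset.sum_comm]
    have h1 : ∀ T ∈ st.formed, ∑ i ∈ pairs I with G.Reachable i.1 i.2, st.share i T ≤
        ∑ e with e ∈ G.edgeSet, if Cuts T e then st.y T else 0 := by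
      intro T hT
      have hy0 := hi.struct.y_nonneg T hT
      by_cases hc : ∃ e ∈ G.edgeSet, Cuts T e
      · obtain ⟨e, he, hce⟩ := hc
        calc ∑ i ∈ pairs I with G.Reachable i.1 i.2, st.share i T
            ≤ ∑ i ∈ pairs I, st.share i T :=
              Finset.sum_le_sum_of_subset_of_nonneg (Finset.filter_subset _ _)
                fun i _ _ => hi.charges.share_nonneg i T
          _ = if Cuts T e then st.y T else 0 := by rw [if_pos hce, hy T hT]
          _ ≤ _ := Finset.single_le_sum (f := fun e => if Cuts T e then st.y T else 0)
              (fun e _ => by split_ifs <;> simp [hy0])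
              (Finset.mem_filter.2 ⟨Finset.mem_univ e, he⟩)
      · rw [Finset.sum_eq_zero]
        · exact Finset.sum_nonneg fun e _ => by split_ifs <;> simp [hy0]
        · intro i hi'
          obtain ⟨hip, hr⟩ := Finset.mem_filter.1 hi'
          by_contra hs
          exact hc (exists_cuts_of_reachable hr (hi.charges.share_supp i hip T hs).2)
    refine (Finset.sum_le_sum h1).trans ?_
    rw [Finset.sum_comm, PCSF.length]
    refine Finset.sum_le_sum fun e he => ?_
    rw [← Finset.sum_filter]
    exact hi.struct.load_le e (SimpleGraph.edgeSet_mono hG (Finset.mem_filter.1 he).2)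

/-- Sums of penalties over unordered pairs as sums over the terminal pairs. -/
theorem sum_penalty_eq (I : PCSF n) (Q : Sym2 (Fin n) → Prop) [DecidablePred Q]
    (hQ : ∀ u, ¬ Q s(u, u)) :
    ∑ p with Q p, I.penalty p = ∑ i ∈ pairs I with Q s(i.1, i.2), pen I i := by
  have hinj : Set.InjOn (fun i : Fin n × Fin n => s(i.1, i.2))
      ((pairs I).filter (fun i => Q s(i.1, i.2)) : Set (Fin n × Fin n)) := by
    rintro ⟨a, b⟩ h ⟨c, d⟩ h' heq
    have h1 := (mem_pairs.1 (Finset.mem_filter.1 h).1).1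
    have h2 := (mem_pairs.1 (Finset.mem_filter.1 h').1).1
    simp only [Sym2.eq_iff] at heq h1 h2
    rcases heq with ⟨rfl, rfl⟩ | ⟨rfl, rfl⟩
    · rfl
    · exact absurd h1 h2.asymm
  have := Finset.sum_image (f := I.penalty) hinj
  simp only [pen]
  rw [← this]
  symm
  refine Finset.sum_subset (fun p hp => ?_) fun p hp hp' => ?_
  · obtain ⟨i, hi, rfl⟩ := Finset.mem_image.1 hp
    exact Finset.mem_filter.2 ⟨Finset.mem_univ _, (Finset.mem_filter.1 hi).2⟩
  · by_contra h0
    have hpos : 0 < I.penalty p := lt_of_le_of_ne (I.penalty_nonneg p) (Ne.symm h0)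
    refine hp' ?_
    have hq := (Finset.mem_filter.1 hp).2
    induction p with
    | h a b =>
    rcases lt_trichotomy a b with hab | hab | hab
    · exact Finset.mem_image.2 ⟨(a, b), Finset.mem_filter.2 ⟨mem_pairs.2 ⟨hab, hpos⟩, hq⟩, rfl⟩
    · subst hab; exact absurd hq (hQ a)
    · rw [Sym2.eq_swap] at hpos hq ⊢
      exact Finset.mem_image.2 ⟨(b, a), Finset.mem_filter.2 ⟨mem_pairs.2 ⟨hab, hpos⟩, hq⟩, rfl⟩

/-- Both guarantees hold for every output of the algorithm on the instance with scaled penalties.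
The paying solution is an optimal forest `Fo` that additionally pays for the pairs connected by
`Fo` but not by the output: their scaled penalties are at most twice their charges, hence at most
`2 * I.length Fo`, and their true penalties are smaller by the factor `ε / 2`. -/
theorem Output.guarantees {I : PCSF n} {ε : ℝ} (hε : 0 < ε) (hε1 : ε ≤ 1)
    {F : SimpleGraph (Fin n)}
    (h : Output (I.scale (2 / ε) (div_nonneg zero_le_two hε.le)) F) :
    I.IsForest F ∧ I.totalCost F ≤ 8 / ε * I.opt ∧
      ∃ (F' : SimpleGraph (Fin n)) (P : Finset (Sym2 (Fin n))),
        I.IsPayingSolution F' P ∧ I.payingCost F' P ≤ (1 + ε) * I.opt ∧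
        ∀ pr, pr ∉ P → Joins F pr := by
  obtain ⟨⟨Fo, hFo, hopt⟩, -⟩ := I.isLeast_opt
  set J := I.scale (2 / ε) (div_nonneg zero_le_two hε.le) with hJ
  obtain ⟨hfor, sh, h0, hlen, hdead, hle, hLP⟩ := h.certificate
  have hpen : ∀ p, I.penalty p = ε / 2 * J.penalty p := by
    intro p; simp only [hJ, PCSF.scale]; field_simp
  have hlenJ : ∀ G, J.length G = I.length G := fun _ => rfl
  have hsum : ∀ (Q : Sym2 (Fin n) → Prop) [DecidablePred Q], (∀ u, ¬ Q s(u, u)) →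
      ∑ p with Q p, I.penalty p = ε / 2 * ∑ i ∈ pairs J with Q s(i.1, i.2), pen J i := by
    intro Q _ hQ
    rw [← sum_penalty_eq J Q hQ, Finset.mul_sum]
    exact Finset.sum_congr rfl fun p _ => hpen p
  have hdiag : ∀ (G : SimpleGraph (Fin n)) (u : Fin n), Joins G s(u, u) :=
    fun G u => joins_mk.2 (.refl _)
  have hsep : ∀ G, I.sepPenalty G =
      ε / 2 * ∑ i ∈ pairs J with ¬ G.Reachable i.1 i.2, pen J i := by
    intro G
    rw [PCSF.sepPenalty, hsum (fun p => ¬ Joins G p) fun u hu => hu (hdiag G u)]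
    exact congrArg _ (Finset.sum_congr (by ext i; simp [joins_mk]) fun _ _ => rfl)
  have hlen0 : ∀ G, 0 ≤ I.length G := fun G => Finset.sum_nonneg fun e _ => I.cost_nonneg e
  have hsep0 : ∀ G, 0 ≤ I.sepPenalty G := fun G => Finset.sum_nonneg fun e _ => I.penalty_nonneg e
  have hLPo := hLP Fo hFo.1
  rw [hlenJ] at hLPo hlen
  rw [← hopt]
  refine ⟨hfor, ?_, Fo, Finset.univ.filter (fun p => ¬ Joins Fo p ∨ ¬ Joins F p), ⟨hFo, ?_⟩, ?_, ?_⟩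
  · -- the charges of the pairs connected by `Fo` are paid by its length, the others by the penalty
    have htot : ∑ i ∈ pairs J, sh i ≤ 2 / ε * I.totalCost Fo := by
      rw [← Finset.sum_filter_add_sum_filter_not (pairs J) (fun i => Fo.Reachable i.1 i.2)]
      have h1 : ∑ i ∈ pairs J with ¬ Fo.Reachable i.1 i.2, sh i ≤ 2 / ε * I.sepPenalty Fo := by
        rw [hsep, ← mul_assoc, show 2 / ε * (ε / 2) = 1 by field_simp, one_mul]
        exact Finset.sum_le_sum fun i hi => hle i (Finset.mem_filter.1 hi).1
      have h2 : I.length Fo ≤ 2 / ε * I.length Fo := by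
        refine le_mul_of_one_le_left (hlen0 Fo) ?_
        rw [le_div_iff₀ hε]; linarith
      rw [PCSF.totalCost, mul_add]
      linarith
    have h1 : I.sepPenalty F ≤ 2 * ∑ i ∈ pairs J, sh i := by
      rw [hsep]
      have h2 : ∑ i ∈ pairs J with ¬ F.Reachable i.1 i.2, pen J i ≤ 2 * ∑ i ∈ pairs J, sh i := by
        rw [Finset.mul_sum]
        refine (Finset.sum_le_sum fun i hi => hdead i (Finset.mem_filter.1 hi).1
          (Finset.mem_filter.1 hi).2).trans ?_
        exact Finset.sum_le_sum_of_subset_of_nonneg (Finset.filter_subset _ _)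
          fun i _ _ => mul_nonneg zero_le_two (h0 i)
      have h3 : 0 ≤ ∑ i ∈ pairs J with ¬ F.Reachable i.1 i.2, pen J i :=
        Finset.sum_nonneg fun i _ => pen_nonneg J i
      nlinarith
    have h4 : 8 / ε * I.totalCost Fo = 4 * (2 / ε * I.totalCost Fo) := by ring
    rw [PCSF.totalCost, h4]
    linarith
  · intro p hp
    by_contra hj
    exact hp (Finset.mem_filter.2 ⟨Finset.mem_univ p, Or.inl hj⟩)
  · have hunion : Finset.univ.filter (fun p => ¬ Joins Fo p ∨ ¬ Joins F p) =
        Finset.univ.filter (fun p => ¬ Joins Fo p) ∪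
        Finset.univ.filter (fun p => Joins Fo p ∧ ¬ Joins F p) := by
      ext p; simp only [Finset.mem_filter, Finset.mem_union, Finset.mem_univ, true_and]; tauto
    have hdisj : Disjoint (Finset.univ.filter (fun p => ¬ Joins Fo p))
        (Finset.univ.filter (fun p => Joins Fo p ∧ ¬ Joins F p)) := by
      rw [Finset.disjoint_left]
      intro p hp hp'
      exact (Finset.mem_filter.1 hp).2 (Finset.mem_filter.1 hp').2.1
    rw [PCSF.payingCost, hunion, Finset.sum_union hdisj,
      hsum (fun p => Joins Fo p ∧ ¬ Joins F p) fun u hu => hu.2 (hdiag F u)]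
    have h1 : ∑ i ∈ pairs J with Joins Fo s(i.1, i.2) ∧ ¬ Joins F s(i.1, i.2), pen J i ≤
        2 * I.length Fo := by
      refine le_trans ?_ (mul_le_mul_of_nonneg_left hLPo zero_le_two)
      rw [Finset.mul_sum]
      simp only [joins_mk]
      refine (Finset.sum_le_sum fun i hi => hdead i (Finset.mem_filter.1 hi).1
        (Finset.mem_filter.1 hi).2.2).trans ?_
      refine Finset.sum_le_sum_of_subset_of_nonneg (fun i hi => ?_)
        fun i _ _ => mul_nonneg zero_le_two (h0 i)
      obtain ⟨hi, h, -⟩ := Finset.mem_filter.1 hi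
      exact Finset.mem_filter.2 ⟨hi, h⟩
    have h2 := mul_le_mul_of_nonneg_left h1 (half_pos hε).le
    have h3 := mul_nonneg hε.le (hsep0 Fo)
    have h4 : I.totalCost Fo = I.length Fo + I.sepPenalty Fo := rfl
    have h5 : ∑ p with ¬ Joins Fo p, I.penalty p = I.sepPenalty Fo := rfl
    rw [h4, h5]
    linarith
  · intro p hp
    by_contra hj
    exact hp (Finset.mem_filter.2 ⟨Finset.mem_univ p, Or.inr hj⟩)

end Length

end PrimalDual

/-! ### Verification of programs -/

namespace RAM

/-- Number of elementary operations of a program all of whose loops make at most `N` rounds. -/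
def timeBound (N : ℕ) : Program → ℕ
  | .skip => 1
  | .setNat _ i j e => i.steps + j.steps + e.steps + 1
  | .setNum _ i j e => i.steps + j.steps + e.steps + 1
  | .seq P Q => timeBound N P + timeBound N Q
  | .cond c P Q => c.steps + (timeBound N P + timeBound N Q)
  | .loop c P => (N + 1) * (c.steps + timeBound N P)

/-- A precondition for `P` to halt with the postcondition `Q` after at most `N` rounds of each
loop; a loop comes with an invariant that may depend on the number of rounds. -/
def wp (N : ℕ) : Program → (Store → Prop) → Store → Prop
  | .skip, Q, σ => Q σ
  | .setNat a i j e, Q, σ => Q (σ.setNat a (i.eval σ) (j.eval σ) (e.eval σ))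
  | .setNum a i j e, Q, σ => Q (σ.setNum a (i.eval σ) (j.eval σ) (e.eval σ))
  | .seq P R, Q, σ => wp N P (wp N R Q) σ
  | .cond c P R, Q, σ => (c.Holds σ → wp N P Q σ) ∧ (¬ c.Holds σ → wp N R Q σ)
  | .loop c P, Q, σ => ∃ Inv : ℕ → Store → Prop, Inv 0 σ ∧ ∀ i τ, Inv i τ →
      (c.Holds τ → i < N ∧ wp N P (Inv (i + 1)) τ) ∧ (¬ c.Holds τ → Q τ)

theorem wp_seq {N : ℕ} {P R : Program} {Q : Store → Prop} {σ : Store}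
    (h : wp N P (wp N R Q) σ) : wp N (.seq P R) Q σ := h

/-- A precondition guarantees termination within the time bound. -/
theorem wp_sound {N : ℕ} {P : Program} : ∀ {Q : Store → Prop} {σ : Store}, wp N P Q σ →
    ∃ t b τ, Exec P σ t b τ ∧ t ≤ timeBound N P ∧ Q τ := by
  induction P with
  | skip => exact fun h => ⟨_, _, _, .skip _, le_rfl, h⟩
  | setNat a i j e => exact fun h => ⟨_, _, _, .setNat _ _ _ _ _, le_rfl, h⟩
  | setNum a i j e => exact fun h => ⟨_, _, _, .setNum _ _ _ _ _, le_rfl, h⟩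
  | seq P R ihP ihR =>
    intro Q σ h
    obtain ⟨t, b, τ, h1, h2, h3⟩ := ihP h
    obtain ⟨t', b', ρ, k1, k2, k3⟩ := ihR h3
    exact ⟨_, _, _, .seq h1 k1, Nat.add_le_add h2 k2, k3⟩
  | cond c P R ihP ihR =>
    intro Q σ h
    by_cases hc : c.Holds σ
    · obtain ⟨t, b, τ, h1, h2, h3⟩ := ihP (h.1 hc)
      exact ⟨_, _, _, .condTrue hc h1, by simp only [timeBound]; omega, h3⟩
    · obtain ⟨t, b, τ, h1, h2, h3⟩ := ihR (h.2 hc)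
      exact ⟨_, _, _, .condFalse hc h1, by simp only [timeBound]; omega, h3⟩
  | loop c P ih =>
    rintro Q σ ⟨Inv, h0, hI⟩
    suffices ∀ k i τ, i + k = N → Inv i τ → ∃ t b ρ, Exec (.loop c P) τ t b ρ ∧
        t ≤ (k + 1) * (c.steps + timeBound N P) ∧ Q ρ from this N 0 σ (by simp) h0
    intro k
    induction k with
    | zero =>
      intro i τ hi hτ
      by_cases hc : c.Holds τ
      · exact absurd ((hI i τ hτ).1 hc).1 (by omega)
      · exact ⟨_, _, _, .loopStop hc, by simp, (hI i τ hτ).2 hc⟩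
    | succ k ihk =>
      intro i τ hi hτ
      by_cases hc : c.Holds τ
      · obtain ⟨t, b, τ', h1, h2, h3⟩ := ih ((hI i τ hτ).1 hc).2
        obtain ⟨t', b', ρ, k1, k2, k3⟩ := ihk (i + 1) τ' (by omega) h3
        refine ⟨_, _, _, .loopStep hc h1 k1, ?_, k3⟩
        rw [Nat.succ_mul]; omega
      · refine ⟨_, _, _, .loopStop hc, ?_, (hI i τ hτ).2 hc⟩
        rw [Nat.succ_mul]; omega

theorem wp_mono {N : ℕ} {P : Program} : ∀ {Q R : Store → Prop} {σ : Store}, wp N P Q σ →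
    (∀ τ, Q τ → R τ) → wp N P R σ := by
  induction P with
  | skip => exact fun h hQ => hQ _ h
  | setNat a i j e => exact fun h hQ => hQ _ h
  | setNum a i j e => exact fun h hQ => hQ _ h
  | seq P R ihP ihR => exact fun h hQ => ihP h fun τ hτ => ihR hτ hQ
  | cond c P R ihP ihR => exact fun h hQ => ⟨fun hc => ihP (h.1 hc) hQ, fun hc => ihR (h.2 hc) hQ⟩
  | loop c P ih =>
    rintro Q R σ ⟨Inv, h0, hI⟩ hQ
    exact ⟨Inv, h0, fun i τ hτ => ⟨(hI i τ hτ).1, fun hc => hQ _ ((hI i τ hτ).2 hc)⟩⟩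

/-- The program assigns to the natural array `a`. -/
def Program.writesNat : Program → ℕ → Bool
  | .skip, _ => false
  | .setNat b _ _ _, a => a == b
  | .setNum _ _ _ _, _ => false
  | .seq P Q, a => P.writesNat a || Q.writesNat a
  | .cond _ P Q, a => P.writesNat a || Q.writesNat a
  | .loop _ P, a => P.writesNat a

/-- The program assigns to the real array `a`. -/
def Program.writesNum : Program → ℕ → Bool
  | .skip, _ => false
  | .setNat _ _ _ _, _ => false
  | .setNum b _ _ _, a => a == b
  | .seq P Q, a => P.writesNum a || Q.writesNum a
  | .cond _ P Q, a => P.writesNum a || Q.writesNum a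
  | .loop _ P, a => P.writesNum a

/-- The two stores agree in all arrays to which `P` does not assign. -/
structure Frame (P : Program) (σ τ : Store) : Prop where
  nat : ∀ a, P.writesNat a = false → τ.nat a = σ.nat a
  num : ∀ a, P.writesNum a = false → τ.num a = σ.num a

theorem Frame.refl (P : Program) (σ : Store) : Frame P σ σ := ⟨fun _ _ => rfl, fun _ _ => rfl⟩

theorem Frame.trans {P : Program} {σ τ ρ : Store} (h : Frame P σ τ) (h' : Frame P τ ρ) :
    Frame P σ ρ :=
  ⟨fun a ha => (h'.nat a ha).trans (h.nat a ha), fun a ha => (h'.num a ha).trans (h.num a ha)⟩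

theorem Frame.of_writes {P R : Program} {σ τ : Store} (h : Frame P σ τ)
    (h1 : ∀ a, R.writesNat a = false → P.writesNat a = false)
    (h2 : ∀ a, R.writesNum a = false → P.writesNum a = false) : Frame R σ τ :=
  ⟨fun a ha => h.nat a (h1 a ha), fun a ha => h.num a (h2 a ha)⟩

@[simp] theorem setNat_num (σ : Store) (a i j x : ℕ) : (σ.setNat a i j x).num = σ.num := rfl

@[simp] theorem setNum_nat (σ : Store) (a i j : ℕ) (x : ℝ) : (σ.setNum a i j x).nat = σ.nat := rfl

theorem setNat_nat_of_ne (σ : Store) {a b : ℕ} (i j x : ℕ) (h : b ≠ a) :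
    (σ.setNat a i j x).nat b = σ.nat b := by
  funext i' j'; simp [Store.setNat, h]

theorem setNum_num_of_ne (σ : Store) {a b : ℕ} (i j : ℕ) (x : ℝ) (h : b ≠ a) :
    (σ.setNum a i j x).num b = σ.num b := by
  funext i' j'; simp [Store.setNum, h]

theorem setNat_nat_self (σ : Store) (a i j x i' j' : ℕ) :
    (σ.setNat a i j x).nat a i' j' = if i' = i ∧ j' = j then x else σ.nat a i' j' := by
  simp [Store.setNat]

theorem setNum_num_self (σ : Store) (a i j : ℕ) (x : ℝ) (i' j' : ℕ) :
    (σ.setNum a i j x).num a i' j' = if i' = i ∧ j' = j then x else σ.num a i' j' := by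
  simp [Store.setNum]

/-- The postcondition may be strengthened by the frame condition. -/
theorem wp_frame {N : ℕ} {P : Program} : ∀ {Q : Store → Prop} {σ : Store}, wp N P Q σ →
    wp N P (fun τ => Q τ ∧ Frame P σ τ) σ := by
  induction P with
  | skip => exact fun h => ⟨h, .refl _ _⟩
  | setNat a i j e =>
    refine fun h => ⟨h, fun b hb => setNat_nat_of_ne _ _ _ _ ?_, fun b _ => rfl⟩
    simpa [Program.writesNat] using hb
  | setNum a i j e =>
    refine fun h => ⟨h, fun b _ => rfl, fun b hb => setNum_num_of_ne _ _ _ _ ?_⟩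
    simpa [Program.writesNum] using hb
  | seq P R ihP ihR =>
    intro Q σ h
    refine wp_seq (wp_mono (ihP h) fun τ hτ => wp_mono (ihR hτ.1) fun ρ hρ => ⟨hρ.1, ?_⟩)
    refine (hτ.2.of_writes ?_ ?_).trans (hρ.2.of_writes ?_ ?_) <;> intro a ha <;>
      simp_all [Program.writesNat, Program.writesNum]
  | cond c P R ihP ihR =>
    intro Q σ h
    refine ⟨fun hc => wp_mono (ihP (h.1 hc)) fun τ hτ => ⟨hτ.1, hτ.2.of_writes ?_ ?_⟩,
      fun hc => wp_mono (ihR (h.2 hc)) fun τ hτ => ⟨hτ.1, hτ.2.of_writes ?_ ?_⟩⟩ <;>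
      intro a ha <;> simp_all [Program.writesNat, Program.writesNum]
  | loop c P ih =>
    rintro Q σ ⟨Inv, h0, hI⟩
    refine ⟨fun i τ => Inv i τ ∧ Frame (.loop c P) σ τ, ⟨h0, .refl _ _⟩, fun i τ hτ =>
      ⟨fun hc => ⟨((hI i τ hτ.1).1 hc).1, ?_⟩, fun hc => ⟨(hI i τ hτ.1).2 hc, hτ.2⟩⟩⟩
    exact wp_mono (ih ((hI i τ hτ.1).1 hc).2) fun ρ hρ =>
      ⟨hρ.1, hτ.2.trans (hρ.2.of_writes (fun _ h => h) fun _ h => h)⟩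

/-- The rule for calling a verified subprogram: the postcondition comes with the frame condition. -/
theorem wp_call {N : ℕ} {P : Program} {Q R : Store → Prop} {σ : Store} (h : wp N P Q σ)
    (hR : ∀ τ, Q τ → Frame P σ τ → R τ) : wp N P R σ :=
  wp_mono (wp_frame h) fun τ hτ => hR τ hτ.1 hτ.2

/-- A natural number stored in a scalar variable. -/
abbrev reg (a : ℕ) : NatExp := .cell a (.const 0) (.const 0)

/-- A real number stored in a scalar variable. -/
abbrev numReg (a : ℕ) : NumExp := .cell a (.const 0) (.const 0)

/-- Run `P` with the variable `c` equal to `0, 1, …` up to the value of the variable `b`,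
exclusively. -/
def forLoop (c b : ℕ) (P : Program) : Program :=
  .seq (.setNat c (.const 0) (.const 0) (.const 0))
    (.loop (.neg (.natLe (reg b) (reg c)))
      (.seq P (.setNat c (.const 0) (.const 0) (.add (reg c) (.const 1)))))

/-- The rule for counting loops.  The frame condition keeps track of everything that the loop does
not modify, so that the invariant need only speak about the arrays that change. -/
theorem wp_forLoop {N c b : ℕ} {P : Program} {Q : Store → Prop} {σ : Store}
    (Inv : ℕ → Store → Prop) (hb : (forLoop c b P).writesNat b = false)
    (hc : P.writesNat c = false) (hN : σ.nat b 0 0 ≤ N)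
    (hset : ∀ i τ x, Inv i τ → Inv i (τ.setNat c 0 0 x)) (h0 : Inv 0 σ)
    (hstep : ∀ i τ, i < σ.nat b 0 0 → Frame (forLoop c b P) σ τ → τ.nat c 0 0 = i → Inv i τ →
      wp N P (Inv (i + 1)) τ)
    (hQ : ∀ τ, Frame (forLoop c b P) σ τ → Inv (σ.nat b 0 0) τ → Q τ) :
    wp N (forLoop c b P) Q σ := by
  have hfc : ∀ τ x, Frame (forLoop c b P) τ (τ.setNat c 0 0 x) := fun τ x =>
    ⟨fun a ha => setNat_nat_of_ne _ _ _ _ (by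
      simp [forLoop, Program.writesNat] at ha; exact ha.1), fun _ _ => rfl⟩
  refine ⟨fun i τ => i ≤ σ.nat b 0 0 ∧ τ.nat c 0 0 = i ∧ Frame (forLoop c b P) σ τ ∧ Inv i τ,
    ⟨Nat.zero_le _, by simp [setNat_nat_self, NatExp.eval], hfc _ _, hset _ _ _ h0⟩, ?_⟩
  rintro i τ ⟨hi, hci, hf, hI⟩
  have hbτ : τ.nat b 0 0 = σ.nat b 0 0 := by rw [hf.nat b hb]
  have hH : (Test.neg (.natLe (reg b) (reg c))).Holds τ ↔ i < σ.nat b 0 0 := by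
    simp [Test.Holds, NatExp.eval, hbτ, hci]
  rw [hH]
  refine ⟨fun hlt => ⟨hlt.trans_le hN, wp_seq (wp_call (hstep i τ hlt hf hci hI) ?_)⟩,
    fun hlt => ?_⟩
  · intro ρ hρ hfρ
    have hcρ : ρ.nat c 0 0 = i := by rw [hfρ.nat c hc, hci]
    have hfρ' : Frame (forLoop c b P) τ ρ := hfρ.of_writes
      (fun a ha => by simp [forLoop, Program.writesNat] at ha; exact ha.2.1)
      (fun a ha => by simpa [forLoop, Program.writesNum] using ha)
    have hev : NatExp.eval ρ ((reg c).add (.const 1)) = i + 1 := by simp [NatExp.eval, hcρ]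
    simp only [wp, hev]
    refine ⟨hlt, by simp [setNat_nat_self, NatExp.eval], (hf.trans hfρ').trans (hfc _ _),
      hset _ _ _ hρ⟩
  · have : i = σ.nat b 0 0 := by omega
    subst this
    exact hQ τ hf hI

/-- For a fixed program the time bound is a polynomial in the number of rounds of a loop; nested
loops increase the degree. -/
theorem exists_polynomial_timeBound (P : Program) :
    ∃ p : Polynomial ℕ, ∀ N, timeBound N P = p.eval N := by
  induction P with
  | skip => exact ⟨1, by simp [timeBound]⟩
  | setNat a i j e => exact ⟨.C (i.steps + j.steps + e.steps + 1), by simp [timeBound]⟩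
  | setNum a i j e => exact ⟨.C (i.steps + j.steps + e.steps + 1), by simp [timeBound]⟩
  | seq P Q ihP ihQ =>
    obtain ⟨p, hp⟩ := ihP
    obtain ⟨q, hq⟩ := ihQ
    exact ⟨p + q, by simp [timeBound, hp, hq]⟩
  | cond c P Q ihP ihQ =>
    obtain ⟨p, hp⟩ := ihP
    obtain ⟨q, hq⟩ := ihQ
    exact ⟨.C c.steps + (p + q), by simp [timeBound, hp, hq]⟩
  | loop c P ih =>
    obtain ⟨p, hp⟩ := ih
    exact ⟨(.X + 1) * (.C c.steps + p), by simp [timeBound, hp]⟩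

end RAM

/-! ### The logarithmic cost -/

namespace RAM

/-- `x` is a multiple of `1 / Q` of absolute value at most `Q`. -/
def Fits (Q : ℕ) (x : ℝ) : Prop := (∃ z : ℤ, x * Q = z) ∧ |x| ≤ Q

theorem Fits.mono {Q R : ℕ} {x : ℝ} (h : Fits Q x) (hd : Q ∣ R) (hR : 0 < R) : Fits R x := by
  obtain ⟨⟨z, hz⟩, hx⟩ := h
  have hle := Nat.le_of_dvd hR hd
  obtain ⟨c, rfl⟩ := hd
  refine ⟨⟨z * c, by push_cast; rw [← hz]; ring⟩, hx.trans (by exact_mod_cast hle)⟩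

theorem realBits_le_of_fits {Q : ℕ} (hQ : 0 < Q) {x : ℝ} (h : Fits Q x) :
    realBits x ≤ Nat.size (Q * Q) + Nat.size Q + 1 := by
  obtain ⟨⟨z, hz⟩, hx⟩ := h
  have hQ' : (0 : ℝ) < Q := by exact_mod_cast hQ
  have hxr : x = (((z : ℚ) / ((Q : ℤ) : ℚ) : ℚ) : ℝ) := by
    push_cast; rw [← hz]; field_simp
  rw [hxr, realBits_ratCast, ratBits]
  have hQz : (Q : ℤ) ≠ 0 := by exact_mod_cast hQ.ne'
  have hz' : z.natAbs ≤ Q * Q := by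
    have : |(z : ℝ)| ≤ (Q * Q : ℝ) := by
      rw [← hz, abs_mul, abs_of_pos hQ']
      exact mul_le_mul_of_nonneg_right hx hQ'.le
    have h2 : |z| ≤ (Q * Q : ℤ) := by exact_mod_cast this
    have h3 : (z.natAbs : ℤ) ≤ ((Q * Q : ℕ) : ℤ) := by push_cast; exact h2
    exact_mod_cast h3
  have hnum : ((z : ℚ) / ((Q : ℤ) : ℚ)).num.natAbs ≤ Q * Q := by
    refine le_trans ?_ hz'
    by_cases h0 : z = 0
    · subst h0; simp
    · have h1 := Rat.num_dvd z hQz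
      rw [Rat.divInt_eq_div] at h1
      exact Nat.le_of_dvd (Int.natAbs_pos.2 h0) (Int.natAbs_dvd_natAbs.2 h1)
  have hden : ((z : ℚ) / ((Q : ℤ) : ℚ)).den ≤ Q := by
    have h1 := Rat.den_dvd z (Q : ℤ)
    rw [Rat.divInt_eq_div] at h1
    exact Nat.le_of_dvd hQ (by exact_mod_cast h1)
  have h1 := Nat.size_le_size hnum
  have h2 := Nat.size_le_size hden
  omega

/-- All constants are at most `2`. -/
def NatExp.Small : NatExp → Prop
  | const k => k ≤ 2
  | cell _ i j => i.Small ∧ j.Small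
  | add e f => e.Small ∧ f.Small
  | sub e f => e.Small ∧ f.Small

/-- An expression that uses only constants up to `2`, additions, subtractions, and divisions by
`2` and by the entry `(0, 0)` of array `0`. -/
def NumExp.Small : NumExp → Prop
  | const k => k ≤ 2
  | cell _ i j => i.Small ∧ j.Small
  | add e f => e.Small ∧ f.Small
  | sub e f => e.Small ∧ f.Small
  | mul _ _ => False
  | div e f => e.Small ∧ (f = const 2 ∨ f = numReg 0)

/-- A test that compares only small expressions. -/
def Test.Small : Test → Prop
  | natLe e f => e.Small ∧ f.Small
  | numLe e f => e.Small ∧ f.Small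
  | neg b => b.Small
  | both b c => b.Small ∧ c.Small

/-- A program all of whose expressions are small and that does not change the real array `0`.
During `t` operations of such a program numerators and denominators grow at most exponentially
in `t`, whatever the program does. -/
def Program.Small : Program → Prop
  | skip => True
  | setNat _ i j e => i.Small ∧ j.Small ∧ e.Small
  | setNum a i j e => a ≠ 0 ∧ i.Small ∧ j.Small ∧ e.Small
  | seq P Q => P.Small ∧ Q.Small
  | cond b P Q => b.Small ∧ P.Small ∧ Q.Small
  | loop b P => b.Small ∧ P.Small

/-- Every value that an elementary operation produces from values that fit `Q` fits `2 p q Q`,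
where `ε = p / q`. -/
structure Growth (ε : ℝ) (K : ℕ) (p q : ℕ) : Prop where
  p_pos : 0 < p
  q_pos : 0 < q
  eq : ε = p / q
  K_eq : K = 2 * p * q

/-- All numbers in the store are small, and the divisor `ε` is in its place. -/
structure StoreFits (ε : ℝ) (Q : ℕ) (σ : Store) : Prop where
  eps : σ.num 0 0 0 = ε
  nat : ∀ a i j, σ.nat a i j ≤ Q
  num : ∀ a i j, Fits Q (σ.num a i j)

section Bits

variable {ε : ℝ} {K p q : ℕ}

theorem Growth.two_le (h : Growth ε K p q) : 2 ≤ K := by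
  have := h.p_pos; have := h.q_pos
  rw [h.K_eq, mul_assoc]
  exact Nat.le_mul_of_pos_right 2 (Nat.mul_pos h.p_pos h.q_pos)

theorem Growth.pos (h : Growth ε K p q) : 0 < K := by have := h.two_le; omega

theorem Fits.add_sub (h : Growth ε K p q) {Q : ℕ} {x y : ℝ} (hx : Fits Q x)
    (hy : Fits Q y) : Fits (Q * K) (x + y) ∧ Fits (Q * K) (x - y) := by
  have hK : (2 : ℝ) ≤ K := by exact_mod_cast h.two_le
  obtain ⟨⟨z, hz⟩, hx⟩ := hx
  obtain ⟨⟨w, hw⟩, hy⟩ := hy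
  have hb : (Q : ℝ) + Q ≤ (Q * K : ℕ) := by push_cast; nlinarith
  refine ⟨⟨⟨(z + w) * K, ?_⟩, (abs_add_le x y).trans (by linarith)⟩,
    ⟨⟨(z - w) * K, ?_⟩, (abs_sub x y).trans (by linarith)⟩⟩
  · push_cast; rw [← hz, ← hw]; ring
  · push_cast; rw [← hz, ← hw]; ring

theorem Fits.half (h : Growth ε K p q) {Q : ℕ} {x : ℝ} (hx : Fits Q x) :
    Fits (Q * K) (x / 2) := by
  obtain ⟨⟨z, hz⟩, hx⟩ := hx
  have hK : (1 : ℝ) ≤ K := by exact_mod_cast h.pos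
  refine ⟨⟨z * (p * q), ?_⟩, ?_⟩
  · rw [h.K_eq]; push_cast; rw [← hz]; ring
  · rw [abs_div, abs_of_pos (zero_lt_two (α := ℝ))]
    push_cast
    have := abs_nonneg x
    nlinarith

theorem Fits.div_eps (h : Growth ε K p q) {Q : ℕ} {x : ℝ} (hx : Fits Q x) :
    Fits (Q * K) (x / ε) := by
  obtain ⟨⟨z, hz⟩, hx⟩ := hx
  have hp : (1 : ℝ) ≤ p := by exact_mod_cast h.p_pos
  have hq : (1 : ℝ) ≤ q := by exact_mod_cast h.q_pos
  rw [h.eq]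
  refine ⟨⟨z * (2 * q * q), ?_⟩, ?_⟩
  · rw [h.K_eq]; push_cast; rw [← hz]; field_simp
  · rw [abs_div, abs_of_pos (by positivity : (0 : ℝ) < p / q), h.K_eq, div_div_eq_mul_div]
    rw [div_le_iff₀ (by positivity)]
    push_cast
    calc |x| * q ≤ Q * q := mul_le_mul_of_nonneg_right hx (by positivity)
      _ = Q * 1 * q * 1 := by ring
      _ ≤ Q * (2 * p) * q * p := by gcongr; linarith
      _ = Q * (2 * p * q) * p := by ring

/-- The bound on the values after `k` operations.  It also serves as a common denominator, so
additions do not make the denominators grow independently of each other. -/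
def level (Q K k : ℕ) : ℕ := Q * K ^ k

theorem level_pos (h : Growth ε K p q) {Q : ℕ} (hQ : 2 ≤ Q) (k : ℕ) : 0 < level Q K k :=
  Nat.mul_pos (by omega) (pow_pos h.pos k)

theorem level_dvd (Q K : ℕ) {k l : ℕ} (hkl : k ≤ l) : level Q K k ∣ level Q K l :=
  Nat.mul_dvd_mul_left Q (pow_dvd_pow K hkl)

theorem level_le (h : Growth ε K p q) {Q : ℕ} (hQ : 2 ≤ Q) {k l : ℕ} (hkl : k ≤ l) :
    level Q K k ≤ level Q K l :=
  Nat.le_of_dvd (level_pos h hQ l) (level_dvd Q K hkl)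

theorem level_succ (Q K k : ℕ) : level Q K (k + 1) = level Q K k * K := by
  rw [level, level, pow_succ, mul_assoc]

theorem two_le_level (h : Growth ε K p q) {Q : ℕ} (hQ : 2 ≤ Q) (k : ℕ) : 2 ≤ level Q K k :=
  hQ.trans (Nat.le_mul_of_pos_right Q (pow_pos h.pos k))

theorem Fits.level_mono (h : Growth ε K p q) {Q : ℕ} (hQ : 2 ≤ Q) {k l : ℕ} (hkl : k ≤ l)
    {x : ℝ} (hx : Fits (level Q K k) x) : Fits (level Q K l) x :=
  hx.mono (level_dvd Q K hkl) (level_pos h hQ l)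

/-- The cost of one operation on values that fit `level Q K k`. -/
def width (Q K k : ℕ) : ℕ := Nat.size (level Q K k * level Q K k) + Nat.size (level Q K k) + 2

theorem width_mono (h : Growth ε K p q) {Q : ℕ} (hQ : 2 ≤ Q) {k l : ℕ} (hkl : k ≤ l) :
    width Q K k ≤ width Q K l := by
  have h1 := level_le h hQ hkl
  have h2 := Nat.size_le_size h1
  have h3 := Nat.size_le_size (Nat.mul_le_mul h1 h1)
  unfold width; omega

theorem one_le_width (Q K k : ℕ) : 1 ≤ width Q K k := by unfold width; omega

theorem size_lt_width {Q K k m : ℕ} (h : m ≤ level Q K k) : Nat.size m + 1 ≤ width Q K k := by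
  have := Nat.size_le_size h
  unfold width; omega

theorem realBits_lt_width (h : Growth ε K p q) {Q k : ℕ} (hQ : 2 ≤ Q) {x : ℝ}
    (hx : Fits (level Q K k) x) : realBits x + 1 ≤ width Q K k := by
  have := realBits_le_of_fits (level_pos h hQ k) hx
  unfold width; omega

theorem StoreFits.mono (h : Growth ε K p q) {Q : ℕ} (hQ : 2 ≤ Q) {k l : ℕ} (hkl : k ≤ l)
    {σ : Store} (hσ : StoreFits ε (level Q K k) σ) : StoreFits ε (level Q K l) σ :=
  ⟨hσ.eps, fun a i j => (hσ.nat a i j).trans (level_le h hQ hkl),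
    fun a i j => (hσ.num a i j).level_mono h hQ hkl⟩

theorem add_bits_le {a b c s t w W : ℕ} (ha : a ≤ s * w) (hb : b ≤ t * w) (hw : w ≤ W)
    (hc : c ≤ W) : a + b + c ≤ (s + t + 1) * W := by
  nlinarith

theorem NatExp.bounds (h : Growth ε K p q) {Q k : ℕ} (hQ : 2 ≤ Q) {σ : Store}
    (hσ : StoreFits ε (level Q K k) σ) (e : NatExp) (he : e.Small) :
    e.eval σ ≤ level Q K (k + e.steps) ∧ e.bits σ ≤ e.steps * width Q K (k + e.steps) := by
  have key : ∀ (v a b s t : ℕ), v ≤ level Q K (k + (s + t + 1)) →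
      a ≤ s * width Q K (k + s) → b ≤ t * width Q K (k + t) →
      a + b + Nat.size v + 1 ≤ (s + t + 1) * width Q K (k + (s + t + 1)) := by
    intro v a b s t hv ha hb
    have h1 : a ≤ s * width Q K (k + (s + t + 1)) :=
      ha.trans (Nat.mul_le_mul_left _ (width_mono h hQ (by omega)))
    have h2 : b ≤ t * width Q K (k + (s + t + 1)) :=
      hb.trans (Nat.mul_le_mul_left _ (width_mono h hQ (by omega)))
    rw [add_assoc (a + b)]
    exact add_bits_le h1 h2 le_rfl (size_lt_width hv)
  induction e with
  | const c =>
    have hc : c ≤ level Q K (k + 1) := le_trans he (two_le_level h hQ _)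
    exact ⟨hc, by simpa [NatExp.bits, NatExp.steps] using size_lt_width hc⟩
  | cell a i j ihi ihj =>
    obtain ⟨-, i2⟩ := ihi he.1
    obtain ⟨-, j2⟩ := ihj he.2
    have hv : (cell a i j).eval σ ≤ level Q K (k + (i.steps + j.steps + 1)) :=
      (hσ.nat _ _ _).trans (level_le h hQ (by omega))
    exact ⟨hv, key _ _ _ _ _ hv i2 j2⟩
  | add e f ihe ihf =>
    obtain ⟨e1, e2⟩ := ihe he.1
    obtain ⟨f1, f2⟩ := ihf he.2
    have hv : (add e f).eval σ ≤ level Q K (k + (e.steps + f.steps + 1)) := by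
      have h1 := e1.trans (level_le h hQ (by omega : _ ≤ k + (e.steps + f.steps)))
      have h2 := f1.trans (level_le h hQ (by omega : _ ≤ k + (e.steps + f.steps)))
      have := h.two_le
      rw [← add_assoc, level_succ]
      simp only [NatExp.eval]
      nlinarith
    exact ⟨hv, key _ _ _ _ _ hv e2 f2⟩
  | sub e f ihe ihf =>
    obtain ⟨e1, e2⟩ := ihe he.1
    obtain ⟨f1, f2⟩ := ihf he.2
    have hv : (sub e f).eval σ ≤ level Q K (k + (e.steps + f.steps + 1)) :=
      (Nat.sub_le _ _).trans (e1.trans (level_le h hQ (by omega)))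
    exact ⟨hv, key _ _ _ _ _ hv e2 f2⟩

theorem NumExp.bounds (h : Growth ε K p q) {Q k : ℕ} (hQ : 2 ≤ Q) {σ : Store}
    (hσ : StoreFits ε (level Q K k) σ) (e : NumExp) (he : e.Small) :
    Fits (level Q K (k + e.steps)) (e.eval σ) ∧
      e.bits σ ≤ e.steps * width Q K (k + e.steps) := by
  have key : ∀ (v : ℝ) (a b s t : ℕ), Fits (level Q K (k + (s + t + 1))) v →
      a ≤ s * width Q K (k + s) → b ≤ t * width Q K (k + t) →
      a + b + realBits v + 1 ≤ (s + t + 1) * width Q K (k + (s + t + 1)) := by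
    intro v a b s t hv ha hb
    have h1 : a ≤ s * width Q K (k + (s + t + 1)) :=
      ha.trans (Nat.mul_le_mul_left _ (width_mono h hQ (by omega)))
    have h2 : b ≤ t * width Q K (k + (s + t + 1)) :=
      hb.trans (Nat.mul_le_mul_left _ (width_mono h hQ (by omega)))
    rw [add_assoc (a + b)]
    exact add_bits_le h1 h2 le_rfl (realBits_lt_width h hQ hv)
  have hconst : ∀ c : ℕ, c ≤ 2 → Fits (level Q K (k + 1)) (c : ℝ) := by
    intro c hc
    refine ⟨⟨c * level Q K (k + 1), by push_cast; ring⟩, ?_⟩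
    rw [Nat.abs_cast]
    exact_mod_cast le_trans hc (two_le_level h hQ _)
  induction e with
  | const c =>
    exact ⟨hconst c he, by
      simpa [NumExp.bits, NumExp.steps] using realBits_lt_width h hQ (hconst c he)⟩
  | cell a i j =>
    obtain ⟨-, i2⟩ := NatExp.bounds h hQ hσ i he.1
    obtain ⟨-, j2⟩ := NatExp.bounds h hQ hσ j he.2
    have hv : Fits (level Q K (k + (i.steps + j.steps + 1))) ((cell a i j).eval σ) :=
      (hσ.num _ _ _).level_mono h hQ (by omega)
    exact ⟨hv, key _ _ _ _ _ hv i2 j2⟩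
  | add e f ihe ihf =>
    obtain ⟨e1, e2⟩ := ihe he.1
    obtain ⟨f1, f2⟩ := ihf he.2
    have hv : Fits (level Q K (k + (e.steps + f.steps + 1))) ((add e f).eval σ) := by
      rw [← add_assoc, level_succ]
      exact (Fits.add_sub h (e1.level_mono h hQ (by omega))
        (f1.level_mono h hQ (by omega))).1
    exact ⟨hv, key _ _ _ _ _ hv e2 f2⟩
  | sub e f ihe ihf =>
    obtain ⟨e1, e2⟩ := ihe he.1
    obtain ⟨f1, f2⟩ := ihf he.2
    have hv : Fits (level Q K (k + (e.steps + f.steps + 1))) ((sub e f).eval σ) := by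
      rw [← add_assoc, level_succ]
      exact (Fits.add_sub h (e1.level_mono h hQ (by omega))
        (f1.level_mono h hQ (by omega))).2
    exact ⟨hv, key _ _ _ _ _ hv e2 f2⟩
  | mul e f _ _ => exact absurd he id
  | div e f ihe ihf =>
    obtain ⟨e1, e2⟩ := ihe he.1
    have hf : f.Small := by
      rcases he.2 with rfl | rfl
      · exact le_rfl
      · exact ⟨Nat.zero_le 2, Nat.zero_le 2⟩
    obtain ⟨-, f2⟩ := ihf hf
    have hv : Fits (level Q K (k + (e.steps + f.steps + 1))) ((div e f).eval σ) := by
      rw [← add_assoc, level_succ]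
      have e3 := e1.level_mono h hQ (by omega : _ ≤ k + (e.steps + f.steps))
      rcases he.2 with rfl | rfl
      · have : (div e (const 2)).eval σ = e.eval σ / 2 := by simp [NumExp.eval]
        rw [this]; exact e3.half h
      · have : (div e (numReg 0)).eval σ = e.eval σ / ε := by
          simp [NumExp.eval, NatExp.eval, hσ.eps]
        rw [this]; exact e3.div_eps h
    exact ⟨hv, key _ _ _ _ _ hv e2 f2⟩

theorem Test.bits_le (h : Growth ε K p q) {Q k : ℕ} (hQ : 2 ≤ Q) {σ : Store}
    (hσ : StoreFits ε (level Q K k) σ) (c : Test) (hc : c.Small) :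
    c.bits σ ≤ c.steps * width Q K (k + c.steps) := by
  have key : ∀ a b s t : ℕ, a ≤ s * width Q K (k + s) → b ≤ t * width Q K (k + t) →
      a + b + 1 ≤ (s + t + 1) * width Q K (k + (s + t + 1)) := by
    intro a b s t ha hb
    have h1 : a ≤ s * width Q K (k + (s + t + 1)) :=
      ha.trans (Nat.mul_le_mul_left _ (width_mono h hQ (by omega)))
    have h2 : b ≤ t * width Q K (k + (s + t + 1)) :=
      hb.trans (Nat.mul_le_mul_left _ (width_mono h hQ (by omega)))
    exact add_bits_le h1 h2 le_rfl (one_le_width _ _ _)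
  induction c with
  | natLe e f =>
    exact key _ _ _ _ (NatExp.bounds h hQ hσ e hc.1).2 (NatExp.bounds h hQ hσ f hc.2).2
  | numLe e f =>
    exact key _ _ _ _ (NumExp.bounds h hQ hσ e hc.1).2 (NumExp.bounds h hQ hσ f hc.2).2
  | neg b ih =>
    have := key _ 0 _ 0 (ih hc) (by simp)
    simpa [Test.bits, Test.steps] using this
  | both b c ihb ihc => exact key _ _ _ _ (ihb hc.1) (ihc hc.2)

/-- The logarithmic cost of a run is bounded in terms of its length. -/
theorem Exec.bits_le (h : Growth ε K p q) {Q : ℕ} (hQ : 2 ≤ Q) {P : Program} {σ τ : Store}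
    {t b : ℕ} (hex : Exec P σ t b τ) : ∀ k, P.Small → StoreFits ε (level Q K k) σ →
      StoreFits ε (level Q K (k + t)) τ ∧ b ≤ t * width Q K (k + t) := by
  have wm : ∀ {s b k l : ℕ}, b ≤ s * width Q K k → k ≤ l → b ≤ s * width Q K l :=
    fun hb hkl => hb.trans (Nat.mul_le_mul_left _ (width_mono h hQ hkl))
  induction hex with
  | skip σ =>
    intro k _ hσ
    exact ⟨hσ.mono h hQ (by omega), by simpa using one_le_width _ _ _⟩
  | setNat σ a i j e =>
    intro k hP hσ
    have hi := (NatExp.bounds h hQ hσ i hP.1).2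
    have hj := (NatExp.bounds h hQ hσ j hP.2.1).2
    obtain ⟨hv, he⟩ := NatExp.bounds h hQ hσ e hP.2.2
    refine ⟨⟨hσ.eps, fun a' i' j' => ?_, fun a' i' j' =>
      (hσ.num a' i' j').level_mono h hQ (by omega)⟩, ?_⟩
    · simp only [Store.setNat]
      split_ifs
      · exact hv.trans (level_le h hQ (by omega))
      · exact (hσ.nat a' i' j').trans (level_le h hQ (by omega))
    · have h1 := wm hi (by omega : _ ≤ k + (i.steps + j.steps + e.steps + 1))
      have h2 := wm hj (by omega : _ ≤ k + (i.steps + j.steps + e.steps + 1))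
      have h3 := wm he (by omega : _ ≤ k + (i.steps + j.steps + e.steps + 1))
      have h4 := one_le_width Q K (k + (i.steps + j.steps + e.steps + 1))
      nlinarith
  | setNum σ a i j e =>
    intro k hP hσ
    have hi := (NatExp.bounds h hQ hσ i hP.2.1).2
    have hj := (NatExp.bounds h hQ hσ j hP.2.2.1).2
    obtain ⟨hv, he⟩ := NumExp.bounds h hQ hσ e hP.2.2.2
    refine ⟨⟨?_, fun a' i' j' => (hσ.nat a' i' j').trans (level_le h hQ (by omega)),
      fun a' i' j' => ?_⟩, ?_⟩
    · rw [setNum_num_of_ne _ _ _ _ hP.1.symm]; exact hσ.eps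
    · simp only [Store.setNum]
      split_ifs
      · exact hv.level_mono h hQ (by omega)
      · exact (hσ.num a' i' j').level_mono h hQ (by omega)
    · have h1 := wm hi (by omega : _ ≤ k + (i.steps + j.steps + e.steps + 1))
      have h2 := wm hj (by omega : _ ≤ k + (i.steps + j.steps + e.steps + 1))
      have h3 := wm he (by omega : _ ≤ k + (i.steps + j.steps + e.steps + 1))
      have h4 := one_le_width Q K (k + (i.steps + j.steps + e.steps + 1))
      nlinarith
  | @seq P R σ τ ρ t b t' b' _ _ ihP ihR =>
    intro k hP hσ
    obtain ⟨h1, h2⟩ := ihP k hP.1 hσ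
    obtain ⟨h3, h4⟩ := ihR (k + t) hP.2 h1
    rw [add_assoc] at h3 h4
    have h5 := wm h2 (by omega : _ ≤ k + (t + t'))
    exact ⟨h3, by rw [Nat.add_mul]; omega⟩
  | @condTrue c P R σ τ t b _ _ ih =>
    intro k hP hσ
    have h0 := wm (Test.bits_le h hQ hσ c hP.1) (by omega : _ ≤ k + (c.steps + t))
    obtain ⟨h1, h2⟩ := ih k hP.2.1 hσ
    have h3 := wm h2 (by omega : _ ≤ k + (c.steps + t))
    exact ⟨h1.mono h hQ (by omega), by rw [Nat.add_mul]; omega⟩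
  | @condFalse c P R σ τ t b _ _ ih =>
    intro k hP hσ
    have h0 := wm (Test.bits_le h hQ hσ c hP.1) (by omega : _ ≤ k + (c.steps + t))
    obtain ⟨h1, h2⟩ := ih k hP.2.2 hσ
    have h3 := wm h2 (by omega : _ ≤ k + (c.steps + t))
    exact ⟨h1.mono h hQ (by omega), by rw [Nat.add_mul]; omega⟩
  | loopStop _ =>
    intro k hP hσ
    exact ⟨hσ.mono h hQ (by omega), Test.bits_le h hQ hσ _ hP.1⟩
  | @loopStep c P σ τ ρ t b t' b' _ _ _ ihP ihL =>
    intro k hP hσ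
    have h0 := wm (Test.bits_le h hQ hσ c hP.1) (by omega : _ ≤ k + (c.steps + t + t'))
    obtain ⟨h1, h2⟩ := ihP k hP.2 hσ
    obtain ⟨h3, h4⟩ := ihL (k + t) hP h1
    have h5 := wm h2 (by omega : _ ≤ k + (c.steps + t + t'))
    have h6 := wm h4 (by omega : _ ≤ k + (c.steps + t + t'))
    exact ⟨h3.mono h hQ (by omega), by rw [Nat.add_mul, Nat.add_mul]; omega⟩

end Bits

theorem size_mul_le (a b : ℕ) : Nat.size (a * b) ≤ Nat.size a + Nat.size b := by
  rw [Nat.size_le, pow_add]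
  exact Nat.mul_lt_mul'' (Nat.lt_size_self a) (Nat.lt_size_self b)

theorem size_pow_le (a k : ℕ) : Nat.size (a ^ k) ≤ k * Nat.size a + 1 := by
  induction k with
  | zero => simp
  | succ k ih =>
    rw [pow_succ, Nat.succ_mul]
    have := size_mul_le (a ^ k) a
    omega

theorem size_succ_le (a : ℕ) : Nat.size (a + 1) ≤ Nat.size a + 1 := by
  rw [Nat.size_le, pow_succ]
  have := Nat.lt_size_self a
  omega

theorem size_prod_le {ι : Type*} (s : Finset ι) (f : ι → ℕ) :
    Nat.size (∏ i ∈ s, f i) ≤ ∑ i ∈ s, Nat.size (f i) + 1 := by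
  classical
  induction s using Finset.induction_on with
  | empty => simp
  | insert a s ha ih =>
    rw [Finset.prod_insert ha, Finset.sum_insert ha]
    have := size_mul_le (f a) (∏ i ∈ s, f i)
    omega

theorem width_le (Q K k : ℕ) :
    width Q K k ≤ 3 * (Nat.size Q + (k * Nat.size K + 1)) + 2 := by
  have h1 := size_mul_le (level Q K k) (level Q K k)
  have h2 := size_mul_le Q (K ^ k)
  have h3 := size_pow_le K k
  unfold width
  unfold level at *
  omega

/-- A positive number that a rational number `x` fits. -/
noncomputable def ratScale (x : ℚ) : ℕ := (x.num.natAbs + 1) * x.den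

theorem ratScale_pos (x : ℚ) : 0 < ratScale x := Nat.mul_pos (Nat.succ_pos _) x.den_pos

theorem fits_ratScale (x : ℚ) : Fits (ratScale x) (x : ℝ) := by
  have hd : (0 : ℝ) < x.den := by exact_mod_cast x.den_pos
  have hx : (x : ℝ) * x.den = x.num := by exact_mod_cast Rat.mul_den_eq_num x
  refine ⟨⟨x.num * (x.num.natAbs + 1), ?_⟩, ?_⟩
  · rw [ratScale]
    generalize x.num.natAbs = m
    push_cast
    rw [← hx]; ring
  · have h1 : |(x : ℝ)| * x.den = |(x.num : ℝ)| := by rw [← hx, abs_mul, abs_of_pos hd]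
    have h2 : ((x.num.natAbs : ℕ) : ℝ) = |(x.num : ℝ)| := by
      rw [Nat.cast_natAbs]; push_cast; rfl
    have h3 : (1 : ℝ) ≤ x.den := by exact_mod_cast x.den_pos
    have h4 := abs_nonneg (x : ℝ)
    rw [ratScale]; push_cast
    rw [h2, ← h1]
    nlinarith [mul_le_mul_of_nonneg_left h3 h4]

theorem size_ratScale_le (x : ℚ) : Nat.size (ratScale x) ≤ ratBits x := by
  have h1 := size_mul_le (x.num.natAbs + 1) x.den
  have h2 := size_succ_le x.num.natAbs
  unfold ratScale ratBits
  omega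

end RAM

/-! ### The program

Names for the arrays.  The natural arrays with numbers up to `7` hold the instance and the state of
the algorithm: number of vertices, adjacency matrix, forest, vertex sets of the numbered components,
number of the component of a vertex, activity, labels of the terminals (`LAB u v` belongs to the
terminal at `u` of the pair `uv`), number of components formed.  So do the real arrays up to `6`:
`ε`, costs, penalties, scaled and halved penalties, loads of the edges, potentials, uncharged
growth.  All others are scratch variables.  The dual variables `y` and the shares are not stored:
the algorithm needs `y` only through the loads, and never reads the shares. -/

notation "SIZE" => (0 : ℕ)
notation "ADJ" => (1 : ℕ)
notation "OUT" => (2 : ℕ)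
notation "MEM" => (3 : ℕ)
notation "CID" => (4 : ℕ)
notation "ACT" => (5 : ℕ)
notation "LAB" => (6 : ℕ)
notation "CNT" => (7 : ℕ)
notation "RND" => (8 : ℕ)
notation "RI" => (9 : ℕ)
notation "RU" => (10 : ℕ)
notation "RV" => (11 : ℕ)
notation "RK" => (12 : ℕ)
notation "RX" => (13 : ℕ)
notation "RY" => (14 : ℕ)
notation "RZ" => (15 : ℕ)
notation "EVT" => (16 : ℕ)
notation "EVK" => (17 : ℕ)
notation "EVU" => (18 : ℕ)
notation "EVV" => (19 : ℕ)
notation "CA" => (20 : ℕ)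
notation "CB" => (21 : ℕ)
notation "NEW" => (22 : ℕ)
notation "TAG" => (23 : ℕ)
notation "FLAG" => (24 : ℕ)
notation "LBL" => (25 : ℕ)
notation "LA" => (26 : ℕ)
notation "LB" => (27 : ℕ)
notation "EPS" => (0 : ℕ)
notation "COST" => (1 : ℕ)
notation "PEN" => (2 : ℕ)
notation "HPEN" => (3 : ℕ)
notation "LOAD" => (4 : ℕ)
notation "POT" => (5 : ℕ)
notation "UNC" => (6 : ℕ)
notation "DEL" => (7 : ℕ)
notation "REM" => (8 : ℕ)
notation "SLK" => (9 : ℕ)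

namespace RAM

abbrev zero : NatExp := .const 0

/-- An entry of a one-dimensional array of naturals. -/
abbrev entry (a : ℕ) (i : NatExp) : NatExp := .cell a i zero

/-- An entry of a one-dimensional array of reals. -/
abbrev numEntry (a : ℕ) (i : NatExp) : NumExp := .cell a i zero

abbrev isPos (e : NatExp) : Test := .natLe (.const 1) e

abbrev isZero (e : NatExp) : Test := .natLe e zero

abbrev natEq (e f : NatExp) : Test := .both (.natLe e f) (.natLe f e)

abbrev natLt (e f : NatExp) : Test := .natLe (.add e (.const 1)) f

abbrev numPos (e : NumExp) : Test := .neg (.numLe e (.const 0))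

abbrev ifThen (b : Test) (P : Program) : Program := .cond b P .skip

abbrev setReg (a : ℕ) (e : NatExp) : Program := .setNat a zero zero e

abbrev setNumReg (a : ℕ) (e : NumExp) : Program := .setNum a zero zero e

/-- Run `P` for all values of `c` and `d` below the number of vertices. -/
def forPairs (c d : ℕ) (P : Program) : Program := forLoop c SIZE (forLoop d SIZE P)

/-- ProcessHistory for the terminal at the vertex stored in the variable `x`, with the initial
charge stored in `REM`. -/
def processHistory (x : ℕ) : Program :=
  forLoop RK CNT (ifThen (isPos (.cell MEM (reg RK) (reg x)))
    (.cond (.numLe (numEntry UNC (reg RK)) (numReg REM))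
      (.seq (setNumReg REM (.sub (numReg REM) (numEntry UNC (reg RK))))
        (.setNum UNC (reg RK) zero (.const 0)))
      (.seq (.setNum UNC (reg RK) zero (.sub (numEntry UNC (reg RK)) (numReg REM)))
        (setNumReg REM (.const 0)))))

/-- Scale the penalties and set up the initial state of the algorithm.  The entry of `HPEN` is
`π / ε`, half of the scaled penalty `(2 / ε) π`. -/
def setup : Program :=
  .seq (forPairs RU RV
    (.seq (.setNum HPEN (reg RU) (reg RV) (.div (.cell PEN (reg RU) (reg RV)) (numReg EPS)))
      (ifThen (numPos (.cell HPEN (reg RU) (reg RV)))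
        (.seq (.setNum POT (reg RU) zero
            (.add (numEntry POT (reg RU)) (.cell HPEN (reg RU) (reg RV))))
          (.setNat ACT (reg RU) zero (.const 1))))))
  (.seq (forLoop RU SIZE
    (.seq (.setNat MEM (reg RU) (reg RU) (.const 1)) (.setNat CID (reg RU) zero (reg RU))))
  (.seq (setReg CNT (reg SIZE))
    (setReg RND (.add (reg SIZE) (reg SIZE)))))

/-- Make the event of kind `kind` at time `e` the candidate if it is earlier than the one found so
far. -/
def propose (kind : ℕ) (e : NumExp) (P : Program) : Program :=
  .cond (.both (isPos (reg EVT)) (.numLe (numReg DEL) e)) .skip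
    (.seq (setNumReg DEL e) (.seq (setReg EVT (.const kind)) P))

/-- The number of active components among those of `RU` and `RV`. -/
abbrev slotsExp : NatExp := .add (entry ACT (entry CID (reg RU))) (entry ACT (entry CID (reg RV)))

/-- Consider the exhaustion of the component `RK`. -/
def proposeExhaust : Program :=
  ifThen (isPos (entry ACT (reg RK))) (propose 1 (numEntry POT (reg RK)) (setReg EVK (reg RK)))

/-- Consider the edge `RU`, `RV`. -/
def proposeEdge : Program :=
  ifThen (.both (isPos (.cell ADJ (reg RU) (reg RV)))
      (.both (.neg (natEq (entry CID (reg RU)) (entry CID (reg RV)))) (isPos slotsExp)))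
    (.seq (setNumReg SLK (.sub (.cell COST (reg RU) (reg RV)) (.cell LOAD (reg RU) (reg RV))))
    (.seq (ifThen (.natLe (.const 2) slotsExp) (setNumReg SLK (.div (numReg SLK) (.const 2))))
    (propose 2 (numReg SLK) (.seq (setReg EVU (reg RU)) (setReg EVV (reg RV))))))

/-- Find the first event: the kind in `EVT` (`0` if no component is active, `1` for an exhausted
component, `2` for a tight edge), and its time in `DEL`. -/
def findEvent : Program :=
  .seq (setReg EVT zero) (.seq (forLoop RK CNT proposeExhaust) (forPairs RU RV proposeEdge))

/-- Let the active components grow by `DEL`. -/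
def growAll : Program :=
  .seq (forLoop RK CNT (ifThen (isPos (entry ACT (reg RK)))
    (.seq (.setNum POT (reg RK) zero (.sub (numEntry POT (reg RK)) (numReg DEL)))
      (.setNum UNC (reg RK) zero (.add (numEntry UNC (reg RK)) (numReg DEL))))))
  (forPairs RU RV (ifThen (.neg (natEq (entry CID (reg RU)) (entry CID (reg RV))))
    (.seq (ifThen (isPos (entry ACT (entry CID (reg RU))))
      (.setNum LOAD (reg RU) (reg RV) (.add (.cell LOAD (reg RU) (reg RV)) (numReg DEL))))
    (ifThen (isPos (entry ACT (entry CID (reg RV))))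
      (.setNum LOAD (reg RU) (reg RV) (.add (.cell LOAD (reg RU) (reg RV)) (numReg DEL)))))))

/-- Process the exhausted component number `EVK`. -/
def exhaust : Program :=
  .seq (.setNat ACT (reg EVK) zero zero)
  (forPairs RU RV (ifThen (.both (isPos (.cell MEM (reg EVK) (reg RU)))
      (.both (numPos (.cell HPEN (reg RU) (reg RV))) (isZero (.cell LAB (reg RU) (reg RV)))))
    (.seq (.setNat LAB (reg RU) (reg RV) (.const 2))
    (.seq (setNumReg REM (.cell HPEN (reg RU) (reg RV))) (processHistory RU)))))

/-- Charge the terminal at `x` of the pair `RU`, `RV`, with the other endpoint `y`, if it is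
alive. -/
def payOutProg (x y : ℕ) : Program :=
  ifThen (isZero (.cell LAB (reg x) (reg y)))
    (.seq (setNumReg REM (.cell HPEN (reg RU) (reg RV)))
    (.seq (processHistory x)
      (.setNum POT (reg NEW) zero (.sub (numEntry POT (reg NEW)) (numReg REM)))))

/-- Treat the pair `RU`, `RV`, which is united by the new component. -/
def unite : Program :=
  .seq (.cond (.both (isZero (.cell LAB (reg RU) (reg RV))) (isZero (.cell LAB (reg RV) (reg RU))))
    (setReg TAG (.const 1)) (setReg TAG (.const 2)))
  (.seq (payOutProg RU RV)
  (.seq (payOutProg RV RU)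
  (.seq (.setNat LAB (reg RU) (reg RV) (reg TAG)) (.setNat LAB (reg RV) (reg RU) (reg TAG)))))

/-- Add the edge `EVU`, `EVV` and merge the components `CA` and `CB` of its endpoints.  The new
component gets the number `NEW`. -/
def mergeComps : Program :=
  .seq (setReg CA (entry CID (reg EVU)))
  (.seq (setReg CB (entry CID (reg EVV)))
  (.seq (setReg NEW (reg CNT))
  (.seq (.setNat OUT (reg EVU) (reg EVV) (.const 1))
  (.seq (.setNat OUT (reg EVV) (reg EVU) (.const 1))
  (.seq (forLoop RX SIZE
    (.seq (.setNat MEM (reg NEW) (reg RX)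
      (.add (.cell MEM (reg CA) (reg RX)) (.cell MEM (reg CB) (reg RX))))
    (ifThen (isPos (.cell MEM (reg NEW) (reg RX))) (.setNat CID (reg RX) zero (reg NEW)))))
  (.seq (.setNat ACT (reg CA) zero zero)
  (.seq (.setNat ACT (reg CB) zero zero)
  (.seq (.setNat ACT (reg NEW) zero (.const 1))
  (.seq (.setNum POT (reg NEW) zero (.add (numEntry POT (reg CA)) (numEntry POT (reg CB))))
  (.seq (.setNum UNC (reg NEW) zero (.const 0))
    (setReg CNT (.add (reg CNT) (.const 1)))))))))))))

/-- Merge the components of the endpoints of the tight edge `EVU`, `EVV`, and treat all pairs that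
are united. -/
def mergeEvent : Program :=
  .seq mergeComps
  (forPairs RU RV (ifThen (.both (natLt (reg RU) (reg RV))
      (.both (numPos (.cell HPEN (reg RU) (reg RV)))
      (.both (isPos (.cell MEM (reg NEW) (reg RU))) (.both (isPos (.cell MEM (reg NEW) (reg RV)))
      (natEq (.add (.cell MEM (reg CA) (reg RU)) (.cell MEM (reg CA) (reg RV))) (.const 1))))))
    unite))

/-- One iteration of the main loop. -/
def round : Program :=
  .seq findEvent (ifThen (isPos (reg EVT))
    (.seq growAll (.cond (isPos (.sub (reg EVT) (.const 1))) mergeEvent exhaust)))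

/-- Label the components of the current forest: `LBL` is constant on each of them.  For every edge
the label of one endpoint is replaced everywhere by that of the other. -/
def components : Program :=
  .seq (forLoop RX SIZE (.setNat LBL (reg RX) zero (reg RX)))
  (forPairs RX RY (ifThen (isPos (.cell OUT (reg RX) (reg RY)))
    (.seq (setReg LA (entry LBL (reg RX)))
    (.seq (setReg LB (entry LBL (reg RY)))
    (forLoop RZ SIZE (ifThen (natEq (entry LBL (reg RZ)) (reg LA))
      (.setNat LBL (reg RZ) zero (reg LB))))))))

/-- Set `FLAG` if the current forest separates a pair of satisfied terminals. -/
def checkSatisfied : Program :=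
  .seq (setReg FLAG zero)
  (forPairs RX RY (ifThen (.both (natLt (reg RX) (reg RY))
      (.both (numPos (.cell HPEN (reg RX) (reg RY)))
      (.both (natEq (.cell LAB (reg RX) (reg RY)) (.const 1))
      (.both (natEq (.cell LAB (reg RY) (reg RX)) (.const 1))
      (.neg (natEq (entry LBL (reg RX)) (entry LBL (reg RY))))))))
    (setReg FLAG (.const 1))))

/-- Give the entry of the edge `RU`, `RV` in the forest the value `k`. -/
def setEdge (k : ℕ) : Program :=
  .seq (.setNat OUT (reg RU) (reg RV) (.const k)) (.setNat OUT (reg RV) (reg RU) (.const k))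

/-- The deletion phase. -/
def pruneAll : Program :=
  forPairs RU RV (ifThen (.both (natLt (reg RU) (reg RV)) (isPos (.cell OUT (reg RU) (reg RV))))
    (.seq (setEdge 0) (.seq components (.seq checkSatisfied
      (ifThen (isPos (reg FLAG)) (setEdge 1))))))

/-- Primal-Dual Forest with the penalties scaled by `2 / ε`.  The main loop makes `2 n` rounds; those
after the last event do nothing. -/
def primalDualForest : Program := .seq setup (.seq (forLoop RI RND round) pruneAll)

theorem small_primalDualForest : primalDualForest.Small := by
  simp [primalDualForest, setup, round, pruneAll, forPairs, forLoop, findEvent, proposeExhaust,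
    proposeEdge, growAll, exhaust,
    mergeEvent, mergeComps, unite, payOutProg, processHistory, components, checkSatisfied, setEdge,
    propose, Program.Small, Test.Small, NumExp.Small, NatExp.Small]

/-- The rule for loops over all pairs of vertices; `Inv i j` holds when all pairs before `(i, j)` in
the lexicographic order are done. -/
theorem wp_forPairs {N c d : ℕ} {P : Program} {Q : Store → Prop} {σ : Store}
    (Inv : ℕ → ℕ → Store → Prop) (hcd : c ≠ d) (hc0 : c ≠ SIZE) (hd0 : d ≠ SIZE)
    (hP0 : P.writesNat SIZE = false) (hc : P.writesNat c = false) (hd : P.writesNat d = false)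
    (hN : σ.nat SIZE 0 0 ≤ N)
    (hset : ∀ i j τ x, Inv i j τ → Inv i j (τ.setNat c 0 0 x) ∧ Inv i j (τ.setNat d 0 0 x))
    (h0 : Inv 0 0 σ)
    (hrow : ∀ i τ, i < σ.nat SIZE 0 0 → Inv i (σ.nat SIZE 0 0) τ → Inv (i + 1) 0 τ)
    (hstep : ∀ i j τ, i < σ.nat SIZE 0 0 → j < σ.nat SIZE 0 0 → Frame (forPairs c d P) σ τ →
      τ.nat c 0 0 = i → τ.nat d 0 0 = j → Inv i j τ → wp N P (Inv i (j + 1)) τ)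
    (hQ : ∀ τ, Frame (forPairs c d P) σ τ → Inv (σ.nat SIZE 0 0) 0 τ → Q τ) :
    wp N (forPairs c d P) Q σ := by
  have hw : ∀ a, (forLoop d SIZE P).writesNat a = (a == d || (P.writesNat a || a == d)) :=
    fun a => rfl
  have hw' : ∀ a, (forPairs c d P).writesNat a =
      (a == c || ((forLoop d SIZE P).writesNat a || a == c)) := fun a => rfl
  have hb : (forLoop d SIZE P).writesNat SIZE = false := by
    simp [hw, hP0, hd0.symm]
  refine wp_forLoop (fun i τ => Inv i 0 τ) ?_ ?_ hN (fun i τ x h => (hset i 0 τ x h).1) h0 ?_ hQ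
  · change (forPairs c d P).writesNat SIZE = false
    simp [hw', hb, hc0.symm]
  · simp [hw, hc, hcd]
  · intro i τ hi hf hci hI
    have hs : τ.nat SIZE 0 0 = σ.nat SIZE 0 0 := by
      rw [hf.nat SIZE (by change (forPairs c d P).writesNat SIZE = false; simp [hw', hb, hc0.symm])]
    refine wp_forLoop (fun j τ => Inv i j τ) hb hd (by rw [hs]; exact hN)
      (fun j τ x h => (hset i j τ x h).2) hI ?_ fun ρ _ hρ => ?_
    · intro j ρ hj hfρ hdj hIρ
      refine hstep i j ρ hi (by rwa [hs] at hj) ?_ ?_ hdj hIρ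
      · refine hf.trans (hfρ.of_writes (fun a ha => ?_) fun a ha => ?_)
        · have ha' : (forPairs c d P).writesNat a = false := ha
          rw [hw'] at ha'
          simp only [Bool.or_eq_false_iff] at ha'
          exact ha'.2.1
        · simpa [forPairs, forLoop, Program.writesNum] using ha
      · rw [hfρ.nat c (by simp [hw, hc, hcd]), hci]
    · rw [hs] at hρ
      exact hrow i ρ hi hρ

end RAM

/-! ### The representation of states in memory -/

namespace RAM

open PrimalDual

variable {n : ℕ}

/-- The set of vertices with number `k`. -/
def idSet (σ : Store) (k : ℕ) : Finset (Fin n) := {v | 1 ≤ σ.nat MEM k v}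

theorem mem_idSet {σ : Store} {k : ℕ} {v : Fin n} : v ∈ idSet σ k ↔ 1 ≤ σ.nat MEM k v := by
  simp [idSet]

theorem idSet_congr {σ τ : Store} (h : τ.nat MEM = σ.nat MEM) (k : ℕ) :
    (idSet τ k : Finset (Fin n)) = idSet σ k := by
  unfold idSet; rw [h]

/-- The pair with the endpoints `u` and `v`. -/
def pairOf (u v : Fin n) : Fin n × Fin n := (min u v, max u v)

theorem pairOf_of_lt {u v : Fin n} (h : u < v) : pairOf u v = (u, v) := by
  simp [pairOf, h.le]

theorem pairOf_comm (u v : Fin n) : pairOf u v = pairOf v u := by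
  simp [pairOf, min_comm, max_comm]

theorem mk_pairOf (u v : Fin n) : s((pairOf u v).1, (pairOf u v).2) = s(u, v) := by
  rcases le_total u v with h | h
  · simp [pairOf, h]
  · simp [pairOf, h, Sym2.eq_swap]

/-- The numerical code of a label. -/
def enc : Status → ℕ
  | .alive => 0
  | .satisfied => 1
  | .dead => 2

theorem enc_eq_zero {a : Status} : enc a = 0 ↔ a = .alive := by cases a <;> simp [enc]

theorem enc_eq_one {a : Status} : enc a = 1 ↔ a = .satisfied := by cases a <;> simp [enc]

/-- The store holds the instance `J`; the entry `HPEN u v` is the charge `π / 2` of a terminal of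
the pair `uv`. -/
structure RepInput (J : PCSF n) (σ : Store) : Prop where
  size : σ.nat SIZE 0 0 = n
  adj : ∀ u v : Fin n, 1 ≤ σ.nat ADJ u v ↔ J.graph.Adj u v
  cost : ∀ u v : Fin n, J.graph.Adj u v → σ.num COST u v = J.cost s(u, v)
  hpen : ∀ u v : Fin n, u ≠ v → σ.num HPEN u v = J.penalty s(u, v) / 2
  hpen_diag : ∀ u : Fin n, σ.num HPEN u u = 0

/-- The numbering of the components: the vertices come first, then the components formed by merging
in the order of their formation. -/
structure RepIds (F : SimpleGraph (Fin n)) (formed : Finset (Finset (Fin n))) (σ : Store) :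
    Prop where
  le_cnt : n ≤ σ.nat CNT 0 0
  mem_le : ∀ k < σ.nat CNT 0 0, ∀ u : Fin n, σ.nat MEM k u ≤ 1
  singleton : ∀ u : Fin n, idSet σ u = {u}
  chain : ∀ k l, k < l → l < σ.nat CNT 0 0 → ∀ v : Fin n, v ∈ idSet σ k → v ∈ idSet σ l →
    (idSet σ k : Finset (Fin n)) ⊂ idSet σ l
  nonempty : ∀ k < σ.nat CNT 0 0, (idSet σ k : Finset (Fin n)).Nonempty
  mem_formed : ∀ k, n ≤ k → k < σ.nat CNT 0 0 → idSet σ k ∈ formed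
  exists_id : ∀ T ∈ formed, ∃ k < σ.nat CNT 0 0, idSet σ k = T
  cid_lt : ∀ u : Fin n, σ.nat CID u 0 < σ.nat CNT 0 0
  cid : ∀ u v : Fin n, v ∈ idSet σ (σ.nat CID u 0) ↔ F.Reachable u v
  out_le : ∀ u v : Fin n, σ.nat OUT u v ≤ 1
  out : ∀ u v : Fin n, 1 ≤ σ.nat OUT u v ↔ F.Adj u v

/-- The store `σ` represents the state `st` of the algorithm. -/
structure Rep (J : PCSF n) (σ : Store) (st : State n) : Prop where
  input : RepInput J σ
  ids : RepIds st.forest st.formed σ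
  act_le : ∀ k < σ.nat CNT 0 0, σ.nat ACT k 0 ≤ 1
  act : ∀ k < σ.nat CNT 0 0, 1 ≤ σ.nat ACT k 0 ↔ idSet σ k ∈ st.active
  pot : ∀ k < σ.nat CNT 0 0, σ.num POT k 0 = st.potential (idSet σ k)
  unc : ∀ k < σ.nat CNT 0 0, σ.num UNC k 0 = st.uncharged (idSet σ k)
  load : ∀ u v : Fin n, J.graph.Adj u v → σ.num LOAD u v = load st s(u, v)
  lab : ∀ u v : Fin n, u ≠ v → σ.nat LAB u v = enc (st.status (pairOf u v) u)

theorem RepInput.congr {J : PCSF n} {σ τ : Store} (h : RepInput J σ)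
    (hn : ∀ a ≤ 1, τ.nat a = σ.nat a) (hm : ∀ a, a = COST ∨ a = HPEN → τ.num a = σ.num a) :
    RepInput J τ where
  size := by rw [hn _ (by omega)]; exact h.size
  adj := by rw [hn _ (by omega)]; exact h.adj
  cost := by rw [hm _ (by simp)]; exact h.cost
  hpen := by rw [hm _ (by simp)]; exact h.hpen
  hpen_diag := by rw [hm _ (by simp)]; exact h.hpen_diag

theorem RepIds.congr {F : SimpleGraph (Fin n)} {formed : Finset (Finset (Fin n))} {σ τ : Store}
    (h : RepIds F formed σ) (hn : ∀ a, a = OUT ∨ a = MEM ∨ a = CID ∨ a = CNT → τ.nat a = σ.nat a) :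
    RepIds F formed τ := by
  have h7 := hn CNT (by simp)
  have h3 := idSet_congr (n := n) (hn MEM (by simp))
  exact {
    le_cnt := by rw [h7]; exact h.le_cnt
    mem_le := by rw [h7, hn MEM (by simp)]; exact h.mem_le
    singleton := by simp only [h3]; exact h.singleton
    chain := by simp only [h7, h3]; exact h.chain
    nonempty := by simp only [h7, h3]; exact h.nonempty
    mem_formed := by simp only [h7, h3]; exact h.mem_formed
    exists_id := by simp only [h7, h3]; exact h.exists_id
    cid_lt := by rw [h7, hn CID (by simp)]; exact h.cid_lt
    cid := by simp only [h3]; rw [hn CID (by simp)]; exact h.cid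
    out_le := by rw [hn OUT (by simp)]; exact h.out_le
    out := by rw [hn OUT (by simp)]; exact h.out }

/-- Only the arrays with small numbers matter for the represented state. -/
theorem Rep.congr {J : PCSF n} {σ τ : Store} {st : State n} (h : Rep J σ st)
    (hn : ∀ a < 8, τ.nat a = σ.nat a) (hm : ∀ a, 1 ≤ a → a < 7 → a ≠ PEN → τ.num a = σ.num a) :
    Rep J τ st := by
  have h7 := hn CNT (by simp)
  have h3 := idSet_congr (n := n) (hn MEM (by simp))
  exact {
    input := h.input.congr (fun a ha => hn a (by omega))
      (fun a ha => hm a (by omega) (by omega) (by omega))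
    ids := h.ids.congr fun a ha => hn a (by omega)
    act_le := by rw [h7, hn ACT (by simp)]; exact h.act_le
    act := by simp only [h7, h3]; rw [hn ACT (by simp)]; exact h.act
    pot := by simp only [h7, h3]; rw [hm POT (by simp) (by simp) (by simp)]; exact h.pot
    unc := by simp only [h7, h3]; rw [hm UNC (by simp) (by simp) (by simp)]; exact h.unc
    load := by rw [hm LOAD (by simp) (by simp) (by simp)]; exact h.load
    lab := by rw [hn LAB (by simp)]; exact h.lab }

theorem Rep.setNat {J : PCSF n} {σ : Store} {st : State n} (h : Rep J σ st) {a : ℕ} (ha : 8 ≤ a)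
    (i j x : ℕ) : Rep J (σ.setNat a i j x) st :=
  h.congr (fun b hb => setNat_nat_of_ne _ _ _ _ (by omega)) fun _ _ _ _ => rfl

theorem Rep.setNum {J : PCSF n} {σ : Store} {st : State n} (h : Rep J σ st) {a : ℕ} (ha : 7 ≤ a)
    (i j : ℕ) (x : ℝ) : Rep J (σ.setNum a i j x) st :=
  h.congr (fun _ _ => rfl) fun b _ hb _ => setNum_num_of_ne _ _ _ _ (by omega)

theorem Rep.cid_eq {J : PCSF n} {σ : Store} {st : State n} (h : Rep J σ st) (u : Fin n) :
    idSet σ (σ.nat CID u 0) = comp st u := by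
  ext v; rw [h.ids.cid, mem_comp]

theorem RepIds.inj {F : SimpleGraph (Fin n)} {formed : Finset (Finset (Fin n))} {σ : Store}
    (h : RepIds F formed σ) {k l : ℕ} (hk : k < σ.nat CNT 0 0) (hl : l < σ.nat CNT 0 0)
    (he : (idSet σ k : Finset (Fin n)) = idSet σ l) : k = l := by
  obtain ⟨v, hv⟩ := h.nonempty k hk
  rcases lt_trichotomy k l with hlt | rfl | hlt
  · exact absurd he (h.chain k l hlt hl v hv (he ▸ hv)).ne
  · rfl
  · exact absurd he.symm (h.chain l k hlt hk v (he ▸ hv) hv).ne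

/-- Two vertices have the same component number exactly if they are connected. -/
theorem Rep.cid_eq_iff {J : PCSF n} {σ : Store} {st : State n} (h : Rep J σ st) (u v : Fin n) :
    σ.nat CID u 0 = σ.nat CID v 0 ↔ st.forest.Reachable u v := by
  rw [← mem_comp, ← h.cid_eq]
  constructor
  · intro he; rw [he, h.cid_eq]; exact mem_comp_self st v
  · intro hv
    refine h.ids.inj (h.ids.cid_lt u) (h.ids.cid_lt v) ?_
    rw [h.cid_eq] at hv ⊢
    rw [h.cid_eq, comp_eq_of_mem hv]

/-! ### ProcessHistory -/

/-- ProcessHistory treats the last set of the list as if it came after a run on the others, which is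
what a loop needs.  After a run that stopped early no charge is left, so that the remaining sets
keep their uncharged growth. -/
theorem chargeLoop_concat (L : List (Finset (Fin n))) (S : Finset (Fin n)) :
    ∀ (r : ℝ) (unch sh : Finset (Fin n) → ℝ), 0 ≤ r → (∀ T, 0 ≤ unch T) →
      let p := chargeLoop r unch sh L
      let q := chargeLoop r unch sh (L ++ [S])
      q.1 = (if p.2.1 S ≤ p.1 then p.1 - p.2.1 S else 0) ∧
        q.2.1 = Function.update p.2.1 S (if p.2.1 S ≤ p.1 then 0 else p.2.1 S - p.1) := by
  induction L with
  | nil =>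
    intro r unch sh _ _
    simp only [List.nil_append, chargeLoop]
    by_cases h : unch S ≤ r <;> simp [h]
  | cons T L ih =>
    intro r unch sh hr hu
    simp only [List.cons_append, chargeLoop]
    by_cases h1 : unch T ≤ r
    · simp only [if_pos h1]
      exact ih _ _ _ (by linarith) fun A => by
        by_cases hA : A = T
        · subst hA; simp
        · simpa [hA] using hu A
    · -- nothing is left to be charged
      simp only [if_neg h1]
      have h0 : 0 ≤ Function.update unch T (unch T - r) S := by
        by_cases hA : S = T
        · subst hA; simp only [Function.update_self]; linarith
        · simpa [hA] using hu S
      by_cases h2 : Function.update unch T (unch T - r) S ≤ 0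
      · simp only [if_pos h2]
        rw [le_antisymm h2 h0, sub_zero]
        refine ⟨rfl, ?_⟩
        conv_rhs => rw [← le_antisymm h2 h0, Function.update_eq_self]
      · simp only [if_neg h2, sub_zero, Function.update_eq_self, and_self]

/-- The sets with numbers below `k` that contain `u`, in the order of their numbers. -/
def idList (σ : Store) (u : Fin n) (k : ℕ) : List (Finset (Fin n)) :=
  ((List.range k).filter (fun l => u ∈ (idSet σ l : Finset (Fin n)))).map (idSet σ)

theorem idList_succ (σ : Store) (u : Fin n) (k : ℕ) : idList σ u (k + 1) =
    if u ∈ (idSet σ k : Finset (Fin n)) then idList σ u k ++ [idSet σ k] else idList σ u k := by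
  unfold idList
  rw [List.range_succ, List.filter_append, List.map_append]
  split_ifs with h <;> simp [h]

/-- The order of the numbers agrees with the order of the sizes. -/
theorem Rep.idList_eq_history {J : PCSF n} {σ : Store} {st : State n} (h : Rep J σ st) {u : Fin n}
    (hu : {u} ∈ st.formed) : idList σ u (σ.nat CNT 0 0) = history st u := by
  have hmem : ∀ S, S ∈ idList σ u (σ.nat CNT 0 0) ↔ S ∈ st.formed ∧ u ∈ S := by
    intro S
    simp only [idList, List.mem_map, List.mem_filter, List.mem_range, decide_eq_true_eq]
    constructor
    · rintro ⟨k, ⟨hk, huk⟩, rfl⟩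
      refine ⟨?_, huk⟩
      by_cases hkn : n ≤ k
      · exact h.ids.mem_formed k hkn hk
      · have := h.ids.singleton ⟨k, by omega⟩
        simp only at this
        rw [this] at huk ⊢
        rwa [← Finset.mem_singleton.1 huk]
    · rintro ⟨hS, huS⟩
      obtain ⟨k, hk, rfl⟩ := h.ids.exists_id S hS
      exact ⟨k, ⟨hk, huS⟩, rfl⟩
  have hpw : (idList σ u (σ.nat CNT 0 0)).Pairwise (fun S T => S.card < T.card) := by
    rw [idList, List.pairwise_map]
    refine (List.pairwise_lt_range.filter _).imp_of_mem fun {k l} hk hl hkl => ?_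
    simp only [List.mem_filter, List.mem_range, decide_eq_true_eq] at hk hl
    exact Finset.card_lt_card (h.ids.chain k l hkl hl.1 u hk.2 hl.2)
  refine List.Perm.eq_of_pairwise (le := fun S T : Finset (Fin n) => S.card ≤ T.card) ?_
    (hpw.imp le_of_lt) (pairwise_history st u) ?_
  · intro S T hS hT h1 h2
    obtain ⟨hS, huS⟩ := (hmem S).1 hS
    obtain ⟨hT, huT⟩ := mem_history.1 hT
    obtain ⟨k, hk, rfl⟩ := h.ids.exists_id S hS
    obtain ⟨l, hl, rfl⟩ := h.ids.exists_id T hT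
    rcases lt_trichotomy k l with hlt | rfl | hlt
    · exact absurd (Finset.card_lt_card (h.ids.chain k l hlt hl u huS huT)) (by omega)
    · rfl
    · exact absurd (Finset.card_lt_card (h.ids.chain l k hlt hk u huT huS)) (by omega)
  · refine (List.perm_ext_iff_of_nodup ?_ (nodup_history st u)).2 fun S => ?_
    · exact hpw.imp fun hlt he => by rw [he] at hlt; exact lt_irrefl _ hlt
    · rw [hmem, mem_history]

/-- The program charges the components in the order of their numbers; those that contain a given
vertex form a chain, in which this is the order of size. -/
theorem wp_processHistory {N x : ℕ} {J : PCSF n} {σ : Store} {st : State n} {i : Fin n × Fin n}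
    {u : Fin n} {Q : Store → Prop} (h : Rep J σ st) (hx : x ≠ RK)
    (hunch : ∀ S, 0 ≤ st.uncharged S) (hu : {u} ∈ st.formed) (hxu : σ.nat x 0 0 = u)
    (hr : σ.num REM 0 0 = pen J i / 2) (hN : σ.nat CNT 0 0 ≤ N)
    (hQ : ∀ τ, Frame (processHistory x) σ τ → Rep J τ (historyState J st i u) →
      τ.num REM 0 0 = historyRest J st i u → Q τ) : wp N (processHistory x) Q σ := by
  have hr0 : 0 ≤ pen J i / 2 := div_nonneg (pen_nonneg J i) zero_le_two
  have key := fun L S => chargeLoop_concat L S (pen J i / 2) st.uncharged (st.share i) hr0 hunch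
  refine wp_forLoop (fun k τ =>
    τ.num REM 0 0 = (chargeLoop (pen J i / 2) st.uncharged (st.share i) (idList σ u k)).1 ∧
    ∀ l < σ.nat CNT 0 0, τ.num UNC l 0 =
      (chargeLoop (pen J i / 2) st.uncharged (st.share i) (idList σ u k)).2.1 (idSet σ l))
    rfl rfl hN (fun _ _ _ h => h) ⟨hr, h.unc⟩ ?_ ?_
  · rintro k τ hk hf hRK ⟨h1, h2⟩
    have hmem : Test.Holds τ (isPos (.cell MEM (reg RK) (reg x))) ↔
        u ∈ (idSet σ k : Finset (Fin n)) := by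
      simp only [Test.Holds, NatExp.eval, hRK, hf.nat x (by simp [forLoop, Program.writesNat, hx]),
        hf.nat MEM rfl, hxu, mem_idSet]
    refine ⟨fun hc => ?_, fun hc => ?_⟩
    · rw [hmem] at hc
      have hk2 := h2 k hk
      obtain ⟨e1, e2⟩ := key (idList σ u k) (idSet σ k)
      rw [idList_succ, if_pos hc, e1, e2]
      refine ⟨fun hle => ?_, fun hle => ?_⟩
      · simp only [Test.Holds, NumExp.eval, NatExp.eval, hRK] at hle
        rw [hk2, h1] at hle
        simp only [wp, NumExp.eval, NatExp.eval, setNum_nat, hRK]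
        rw [if_pos hle, if_pos hle]
        refine ⟨by simp [Store.setNum, h1, hk2], fun l hl => ?_⟩
        by_cases hlk : l = k
        · subst hlk; simp [Store.setNum]
        · rw [Function.update_of_ne fun he => hlk (h.ids.inj hl hk he)]
          simpa [Store.setNum, hlk] using h2 l hl
      · simp only [Test.Holds, NumExp.eval, NatExp.eval, hRK] at hle
        rw [hk2, h1] at hle
        simp only [wp, NumExp.eval, NatExp.eval, hRK]
        rw [if_neg hle, if_neg hle]
        refine ⟨by simp [Store.setNum], fun l hl => ?_⟩
        by_cases hlk : l = k
        · subst hlk; simp [Store.setNum, h1, hk2]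
        · rw [Function.update_of_ne fun he => hlk (h.ids.inj hl hk he)]
          simpa [Store.setNum, hlk] using h2 l hl
    · rw [hmem] at hc
      rw [idList_succ, if_neg hc]
      exact ⟨h1, h2⟩
  · rintro τ hf ⟨h1, h2⟩
    rw [h.idList_eq_history hu] at h1 h2
    have h7 := hf.nat CNT rfl
    have h3 := idSet_congr (n := n) (hf.nat MEM rfl)
    refine hQ τ hf ?_ h1
    exact {
      input := h.input.congr (fun a ha => hf.nat a (by interval_cases a <;> rfl))
        (fun a ha => hf.num a (by rcases ha with rfl | rfl <;> rfl))
      ids := h.ids.congr fun a ha => hf.nat a (by rcases ha with rfl | rfl | rfl | rfl <;> rfl)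
      act_le := by rw [h7, hf.nat ACT rfl]; exact h.act_le
      act := by simp only [h7, h3]; rw [hf.nat ACT rfl]; exact h.act
      pot := by simp only [h7, h3]; rw [hf.num POT rfl]; exact h.pot
      unc := by simp only [h7, h3]; exact h2
      load := by rw [hf.num LOAD rfl]; exact h.load
      lab := by rw [hf.nat LAB rfl]; exact h.lab }

end RAM

/-! ### The next event -/

namespace PrimalDual

variable {n : ℕ}

open Classical in
/-- The number of active components that the edge `uv` leaves. -/
noncomputable def activeDeg (st : State n) (u v : Fin n) : ℕ :=
  (st.active.filter (fun S => Cuts S s(u, v))).card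

theorem Struct.activeDeg_of_reachable {I : PCSF n} {st : State n} (h : Struct I st) {u v : Fin n}
    (huv : st.forest.Reachable u v) : activeDeg st u v = 0 := by
  classical
  rw [activeDeg, Finset.card_eq_zero, Finset.filter_eq_empty_iff]
  intro S hS hc
  exact ((cuts_cluster_mk (h.active_clusters hS)).1 hc).1 huv

open Classical in
theorem Struct.activeDeg_of_not_reachable {I : PCSF n} {st : State n} (h : Struct I st)
    {u v : Fin n} (huv : ¬ st.forest.Reachable u v) : activeDeg st u v =
      (if comp st u ∈ st.active then 1 else 0) + if comp st v ∈ st.active then 1 else 0 := by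
  have hne : comp st u ≠ comp st v := fun he =>
    huv (mem_comp.1 (he ▸ mem_comp_self st v))
  have : st.active.filter (fun S => Cuts S s(u, v)) =
      ({comp st u, comp st v} : Finset (Finset (Fin n))).filter (· ∈ st.active) := by
    ext S
    simp only [Finset.mem_filter, Finset.mem_insert, Finset.mem_singleton]
    constructor
    · rintro ⟨hS, hc⟩
      have := ((cuts_cluster_mk (h.active_clusters hS)).1 hc).2
      rw [← comp_eq_cluster, ← comp_eq_cluster] at this
      exact ⟨this, hS⟩
    · rintro ⟨hc, hS⟩
      rw [comp_eq_cluster, comp_eq_cluster] at hc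
      exact ⟨hS, (cuts_cluster_mk (h.active_clusters hS)).2 ⟨huv, hc⟩⟩
  rw [activeDeg, this, Finset.filter_insert, Finset.filter_singleton]
  split_ifs <;> simp [hne]

/-- The edge `uv` can go tight when the active components grow. -/
def Eligible (I : PCSF n) (st : State n) (u v : Fin n) : Prop :=
  I.graph.Adj u v ∧ ¬ st.forest.Reachable u v ∧ (comp st u ∈ st.active ∨ comp st v ∈ st.active)

/-- The time until the edge `uv` goes tight. -/
noncomputable def slack (I : PCSF n) (st : State n) (u v : Fin n) : ℝ :=
  (I.cost s(u, v) - load st s(u, v)) / activeDeg st u v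

theorem Struct.activeDeg_pos_iff {I : PCSF n} {st : State n} (h : Struct I st) {u v : Fin n}
    (huv : I.graph.Adj u v) : 0 < activeDeg st u v ↔ Eligible I st u v := by
  by_cases hr : st.forest.Reachable u v
  · simp [h.activeDeg_of_reachable hr, Eligible, hr]
  · rw [h.activeDeg_of_not_reachable hr, Eligible]
    by_cases h1 : comp st u ∈ st.active <;> by_cases h2 : comp st v ∈ st.active <;>
      simp [huv, hr, h1, h2]

theorem Inv.potential_nonneg {I : PCSF n} {st : State n} (h : Inv I st) {S : Finset (Fin n)}
    (hS : S ∈ st.active) : 0 ≤ st.potential S := by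
  obtain ⟨u, rfl⟩ := h.struct.active_comp S hS
  rw [h.pot u]
  exact sub_nonneg.2 (h.charges.hall _)

theorem Struct.slack_nonneg {I : PCSF n} {st : State n} (h : Struct I st) {u v : Fin n}
    (huv : I.graph.Adj u v) : 0 ≤ slack I st u v :=
  div_nonneg (sub_nonneg.2 (h.load_le _ huv)) (Nat.cast_nonneg _)

theorem Struct.load_grow_eq {I : PCSF n} {st : State n} (h : Struct I st) (d : ℝ) (u v : Fin n) :
    load (PrimalDual.grow st d) s(u, v) = load st s(u, v) + d * activeDeg st u v := by
  rw [load_grow h]; rfl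

theorem Struct.withinLimits_grow {I : PCSF n} {st : State n} (h : Struct I st) {d : ℝ}
    (hpot : ∀ S ∈ st.active, d ≤ st.potential S)
    (hslack : ∀ u v, Eligible I st u v → d ≤ slack I st u v) :
    WithinLimits I (PrimalDual.grow st d) := by
  refine ⟨fun e he => ?_, fun S hS => ?_⟩
  · induction e with | _ u v
    rw [h.load_grow_eq]
    rcases Nat.eq_zero_or_pos (activeDeg st u v) with h0 | h0
    · rw [h0, Nat.cast_zero, mul_zero, add_zero]; exact h.load_le _ he
    · have := hslack u v ((h.activeDeg_pos_iff he).1 h0)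
      rw [slack, le_div_iff₀ (by exact_mod_cast h0)] at this
      linarith
  · have hS' : S ∈ st.active := hS
    simp only [PrimalDual.grow, if_pos hS']
    linarith [hpot S hS']

theorem Struct.tightEdge_grow {I : PCSF n} {st : State n} (h : Struct I st) {u v : Fin n}
    (he : Eligible I st u v) : TightEdge I (PrimalDual.grow st (slack I st u v)) u v := by
  refine ⟨he.1, he.2.1, he.2.2, ?_⟩
  have h0 : (activeDeg st u v : ℝ) ≠ 0 := by
    have := (h.activeDeg_pos_iff he.1).2 he
    exact_mod_cast this.ne'
  rw [h.load_grow_eq, slack, div_mul_cancel₀ _ h0]; ring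

end PrimalDual

namespace RAM

open PrimalDual

variable {n : ℕ}

/-- Lexicographic order: the pair `(u, v)` is inspected before `(i, j)`. -/
def Before (i j u v : ℕ) : Prop := u < i ∨ u = i ∧ v < j

instance (i j u v : ℕ) : Decidable (Before i j u v) := by unfold Before; infer_instance

theorem not_before_zero (u v : ℕ) : ¬ Before 0 0 u v := by simp [Before]

theorem before_row {i u v : ℕ} (hv : v < n) : Before (i + 1) 0 u v ↔ Before i n u v := by
  unfold Before; omega

theorem before_succ {i j u v : ℕ} : Before i (j + 1) u v ↔ Before i j u v ∨ u = i ∧ v = j := by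
  unfold Before; omega

theorem Before.of_lt {i j u v : ℕ} (h : u < i) : Before i j u v := Or.inl h

/-- The event stored in `EVT` and the other event variables is one of the possible next events,
and `DEL` is its time. -/
def Candidate (J : PCSF n) (st : State n) (τ : Store) : Prop :=
  τ.nat EVT 0 0 = 0 ∨
  (τ.nat EVT 0 0 = 1 ∧ τ.nat EVK 0 0 < τ.nat CNT 0 0 ∧ idSet τ (τ.nat EVK 0 0) ∈ st.active ∧
    τ.num DEL 0 0 = st.potential (idSet τ (τ.nat EVK 0 0))) ∨
  (τ.nat EVT 0 0 = 2 ∧ ∃ u v : Fin n, τ.nat EVU 0 0 = u ∧ τ.nat EVV 0 0 = v ∧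
    Eligible J st u v ∧ τ.num DEL 0 0 = slack J st u v)

/-- The event found is not later than `x`. -/
def NotLater (τ : Store) (x : ℝ) : Prop := 1 ≤ τ.nat EVT 0 0 ∧ τ.num DEL 0 0 ≤ x

theorem wp_propose {N kind : ℕ} {e : NumExp} {P : Program} {Q : Store → Prop} {σ : Store}
    (h1 : NotLater σ (e.eval σ) → Q σ)
    (h2 : (σ.nat EVT 0 0 = 0 ∨ e.eval σ ≤ σ.num DEL 0 0) →
      wp N P Q ((σ.setNum DEL 0 0 (e.eval σ)).setNat EVT 0 0 kind)) :
    wp N (propose kind e P) Q σ := by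
  refine ⟨fun h => h1 h, fun h => h2 ?_⟩
  simp only [Test.Holds, NatExp.eval, NumExp.eval, not_and, not_le] at h
  by_cases h0 : σ.nat EVT 0 0 = 0
  · exact Or.inl h0
  · exact Or.inr (h (by omega)).le

theorem wp_proposeExhaust {N k : ℕ} {J : PCSF n} {σ : Store} {st : State n} (h : Rep J σ st)
    (hk : σ.nat RK 0 0 = k) (hkc : k < σ.nat CNT 0 0) (hc : Candidate J st σ) :
    wp N proposeExhaust (fun τ => Candidate J st τ ∧
      (idSet σ k ∈ st.active → NotLater τ (st.potential (idSet σ k))) ∧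
      ∀ x, NotLater σ x → NotLater τ x) σ := by
  have hact : Test.Holds σ (isPos (entry ACT (reg RK))) ↔ idSet σ k ∈ st.active := by
    simp only [Test.Holds, NatExp.eval, hk, h.act k hkc]
  have hev : NumExp.eval σ (numEntry POT (reg RK)) = st.potential (idSet σ k) := by
    simp only [NumExp.eval, NatExp.eval, hk, h.pot k hkc]
  refine ⟨fun ha => ?_, fun ha => ⟨hc, fun hS => absurd (hact.2 hS) ha, fun _ hx => hx⟩⟩
  rw [hact] at ha
  refine wp_propose (fun hnl => ⟨hc, fun _ => by rwa [hev] at hnl, fun _ hx => hx⟩) fun hlt => ?_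
  rw [hev] at hlt ⊢
  refine ⟨Or.inr (Or.inl ?_), fun _ => ⟨by simp [Store.setNat], by simp [Store.setNum]⟩,
    fun x hx => ⟨by simp [Store.setNat], ?_⟩⟩
  · simpa [Store.setNat, Store.setNum, NatExp.eval, hk, hkc] using ⟨ha, rfl⟩
  · rcases hlt with hlt | hlt
    · have := hx.1; omega
    · simpa [Store.setNum] using hlt.trans hx.2

theorem Rep.act_eq {J : PCSF n} {σ : Store} {st : State n} (h : Rep J σ st) (u : Fin n)
    [Decidable (comp st u ∈ st.active)] :
    σ.nat ACT (σ.nat CID u 0) 0 = if comp st u ∈ st.active then 1 else 0 := by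
  have h1 := h.act_le _ (h.ids.cid_lt u)
  have h2 := h.act _ (h.ids.cid_lt u)
  rw [h.cid_eq] at h2
  split_ifs with hc
  · have := h2.2 hc; omega
  · have := mt h2.1 hc; omega

theorem wp_proposeEdge {N : ℕ} {J : PCSF n} {σ : Store} {st : State n} (h : Rep J σ st)
    (hS : Struct J st) {u v : Fin n} (hu : σ.nat RU 0 0 = u) (hv : σ.nat RV 0 0 = v)
    (hc : Candidate J st σ) :
    wp N proposeEdge (fun τ => Candidate J st τ ∧
      (Eligible J st u v → NotLater τ (slack J st u v)) ∧ ∀ x, NotLater σ x → NotLater τ x) σ := by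
  classical
  have hslots : ¬ st.forest.Reachable u v →
      σ.nat ACT (σ.nat CID u 0) 0 + σ.nat ACT (σ.nat CID v 0) 0 = activeDeg st u v := fun hr => by
    rw [hS.activeDeg_of_not_reachable hr, h.act_eq, h.act_eq]
  refine ⟨fun hg => ?_, fun hg => ⟨hc, fun he => absurd ?_ hg, fun _ hx => hx⟩⟩
  · simp only [Test.Holds, NatExp.eval, hu, hv, h.input.adj, ← le_antisymm_iff,
      h.cid_eq_iff] at hg
    obtain ⟨hadj, hr, hpos⟩ := hg
    have hsl := hslots hr
    rw [hsl] at hpos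
    have he := (hS.activeDeg_pos_iff hadj).1 hpos
    have key : ∀ ρ : Store, ρ.nat = σ.nat → (∀ a, a ≠ SLK → ρ.num a = σ.num a) →
        ρ.num SLK 0 0 = slack J st u v →
        wp N (propose 2 (numReg SLK) (.seq (setReg EVU (reg RU)) (setReg EVV (reg RV))))
          (fun τ => Candidate J st τ ∧ (Eligible J st u v → NotLater τ (slack J st u v)) ∧
            ∀ x, NotLater σ x → NotLater τ x) ρ := by
      intro ρ hn hm hs
      have hd := hm DEL (by simp)
      have hev : NumExp.eval ρ (numReg SLK) = slack J st u v := hs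
      have hxe : ∀ x, NotLater ρ x ↔ NotLater σ x := fun x => by
        unfold NotLater; rw [hn, hd]
      refine wp_propose (fun hnl => ⟨?_, fun _ => by rwa [hev] at hnl, fun x hx => (hxe x).2 hx⟩)
        fun hlt => ?_
      · unfold Candidate idSet; rw [hn, hd]; exact hc
      · rw [hev] at hlt ⊢
        refine ⟨Or.inr (Or.inr ?_), fun _ => ⟨by simp [Store.setNat], by simp [Store.setNum]⟩,
          fun x hx => ⟨by simp [Store.setNat], ?_⟩⟩
        · refine ⟨by simp [Store.setNat], u, v, ?_, ?_, he, ?_⟩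
          · simp [Store.setNat, NatExp.eval, hn, hu]
          · simp [Store.setNat, NatExp.eval, hn, hv]
          · simp [Store.setNum]
        · rw [← hxe] at hx
          rcases hlt with hlt | hlt
          · have := hx.1; omega
          · simpa [Store.setNum] using hlt.trans hx.2
    have hval : J.cost s(u, v) - load st s(u, v) = slack J st u v * activeDeg st u v := by
      rw [slack, div_mul_cancel₀ _ (by exact_mod_cast (show activeDeg st u v ≠ 0 by omega))]
    have h2 : activeDeg st u v ≤ 2 := by
      rw [hS.activeDeg_of_not_reachable hr]; split_ifs <;> simp
    refine ⟨fun ht => ?_, fun ht => ?_⟩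
    · simp only [Test.Holds, NatExp.eval, setNum_nat, hu, hv, hsl] at ht
      refine key _ rfl (fun a ha => ?_) ?_
      · rw [setNum_num_of_ne _ _ _ _ ha, setNum_num_of_ne _ _ _ _ ha]
      · have : activeDeg st u v = 2 := by omega
        simp [Store.setNum, NumExp.eval, NatExp.eval, hu, hv, h.input.cost u v hadj,
          h.load u v hadj, hval, this]
    · simp only [Test.Holds, NatExp.eval, setNum_nat, hu, hv, hsl] at ht
      refine key _ rfl (fun a ha => ?_) ?_
      · rw [setNum_num_of_ne _ _ _ _ ha]
      · have : activeDeg st u v = 1 := by omega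
        simp [Store.setNum, NumExp.eval, NatExp.eval, hu, hv, h.input.cost u v hadj,
          h.load u v hadj, hval, this]
  · simp only [Test.Holds, NatExp.eval, hu, hv, h.input.adj, ← le_antisymm_iff, h.cid_eq_iff]
    refine ⟨he.1, he.2.1, ?_⟩
    rw [hslots he.2.1]
    exact (hS.activeDeg_pos_iff he.1).2 he

/-- The event found is a possible next event of the algorithm: growing by `DEL` stays within the
limits, and the event then occurs. -/
theorem wp_findEvent {N : ℕ} {J : PCSF n} {σ : Store} {st : State n} {Q : Store → Prop}
    (h : Rep J σ st) (hI : Inv J st) (hN : σ.nat CNT 0 0 ≤ N)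
    (h0 : ∀ τ, Frame findEvent σ τ → τ.nat EVT 0 0 = 0 → st.active = ∅ → Q τ)
    (h1 : ∀ τ, Frame findEvent σ τ → τ.nat EVT 0 0 = 1 → 0 ≤ τ.num DEL 0 0 →
      WithinLimits J (grow st (τ.num DEL 0 0)) → τ.nat EVK 0 0 < τ.nat CNT 0 0 →
      idSet τ (τ.nat EVK 0 0) ∈ st.active →
      (grow st (τ.num DEL 0 0)).potential (idSet τ (τ.nat EVK 0 0)) = 0 → Q τ)
    (h2 : ∀ τ (u v : Fin n), Frame findEvent σ τ → τ.nat EVT 0 0 = 2 → 0 ≤ τ.num DEL 0 0 →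
      WithinLimits J (grow st (τ.num DEL 0 0)) → τ.nat EVU 0 0 = u → τ.nat EVV 0 0 = v →
      TightEdge J (grow st (τ.num DEL 0 0)) u v → Q τ) :
    wp N findEvent Q σ := by
  suffices wp N findEvent (fun τ => Candidate J st τ ∧
      (∀ S ∈ st.active, NotLater τ (st.potential S)) ∧
      ∀ u v : Fin n, Eligible J st u v → NotLater τ (slack J st u v)) σ by
    refine wp_call this fun τ hτ hf => ?_
    obtain ⟨hc, hk, huv⟩ := hτ
    have hw : WithinLimits J (grow st (τ.num DEL 0 0)) := hI.struct.withinLimits_grow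
      (fun S hS => (hk S hS).2) fun u v he => (huv u v he).2
    rcases hc with hc | ⟨c1, c2, c3, c4⟩ | ⟨c1, u, v, c2, c3, c4, c5⟩
    · refine h0 τ hf hc (Finset.eq_empty_of_forall_notMem fun S hS => ?_)
      have := (hk S hS).1
      omega
    · refine h1 τ hf c1 ?_ hw c2 c3 ?_
      · rw [c4]; exact hI.potential_nonneg c3
      · simp only [grow, if_pos c3]; rw [c4, sub_self]
    · refine h2 τ u v hf c1 ?_ hw c2 c3 ?_
      · rw [c5]; exact hI.struct.slack_nonneg c4.1
      · rw [c5]; exact hI.struct.tightEdge_grow c4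
  have hrep : ∀ {P : Program} {σ τ : Store}, Rep J σ st → Frame P σ τ →
      (∀ a < 8, P.writesNat a = false) → (∀ a < 7, P.writesNum a = false) → Rep J τ st :=
    fun h hf h1 h2 => h.congr (fun a ha => hf.nat a (h1 a ha)) fun a _ ha _ => hf.num a (h2 a ha)
  refine wp_forLoop (fun k τ => Candidate J st τ ∧ ∀ l < k,
      idSet τ l ∈ st.active → NotLater τ (st.potential (idSet τ l))) rfl rfl hN
      (fun _ _ _ hh => hh) ⟨Or.inl ?_, by simp⟩ ?_ ?_
  · simp [Store.setNat, NatExp.eval]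
  · rintro k τ hk hf hRK ⟨hc, hl⟩
    have h7 : τ.nat CNT = σ.nat CNT := hf.nat CNT rfl
    have hR : Rep J τ st := hrep (h.setNat (by simp) _ _ _) hf (by decide) (by decide)
    refine wp_call (wp_proposeExhaust hR hRK (by rw [h7]; exact hk) hc) ?_
    rintro ρ ⟨b1, b2, b3⟩ hfρ
    have h3 := idSet_congr (n := n) (hfρ.nat MEM rfl)
    refine ⟨b1, fun l hlk hla => ?_⟩
    rw [h3] at hla ⊢
    rcases Nat.lt_succ_iff_lt_or_eq.1 hlk with hlk | rfl
    · exact b3 _ (hl l hlk hla)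
    · exact b2 hla
  rintro σ₁ hf₁ ⟨hc₁, hl₁⟩
  have hR₁ : Rep J σ₁ st := hrep (h.setNat (by simp) _ _ _) hf₁ (by decide) (by decide)
  have h7 : σ₁.nat CNT = σ.nat CNT := hf₁.nat CNT rfl
  refine wp_forPairs (fun i j τ => Candidate J st τ ∧
      (∀ S ∈ st.active, NotLater τ (st.potential S)) ∧
      ∀ u v : Fin n, Before i j u v → Eligible J st u v → NotLater τ (slack J st u v))
    (by simp) (by simp) (by simp) rfl rfl rfl ?_ (fun _ _ _ _ hh => ⟨hh, hh⟩)
    ⟨hc₁, fun S hS => ?_, fun u v hb => absurd hb (not_before_zero _ _)⟩ ?_ ?_ ?_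
  · rw [hR₁.input.size]; exact h.ids.le_cnt.trans hN
  · obtain ⟨k, hk, rfl⟩ := hR₁.ids.exists_id S (hI.struct.active_sub hS)
    rw [h7] at hk
    exact hl₁ k hk hS
  · rintro i τ - ⟨a, b, c⟩
    refine ⟨a, b, fun u v hb => c u v ?_⟩
    rw [hR₁.input.size]; exact (before_row v.2).1 hb
  · rintro i j τ hi hj hf hRU hRV ⟨hc, hk, he⟩
    rw [hR₁.input.size] at hi hj
    have hR : Rep J τ st := hrep hR₁ hf (by decide) (by decide)
    refine wp_mono (wp_proposeEdge hR hI.struct (u := ⟨i, hi⟩) (v := ⟨j, hj⟩) hRU hRV hc) ?_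
    rintro ρ ⟨b1, b2, b3⟩
    refine ⟨b1, fun S hS => b3 _ (hk S hS), fun u v hb hel => ?_⟩
    rcases before_succ.1 hb with hb | ⟨h1, h2⟩
    · exact b3 _ (he u v hb hel)
    · obtain rfl : u = ⟨i, hi⟩ := Fin.ext h1
      obtain rfl : v = ⟨j, hj⟩ := Fin.ext h2
      exact b2 hel
  · rintro τ hf ⟨a, b, c⟩
    rw [hR₁.input.size] at c
    exact ⟨a, b, fun u v => c u v (.of_lt u.2)⟩

end RAM

/-! ### Growing the active components -/

namespace RAM

open PrimalDual

variable {n : ℕ}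

theorem wp_growAll {N : ℕ} {J : PCSF n} {σ : Store} {st : State n} {Q : Store → Prop}
    (h : Rep J σ st) (hS : Struct J st) (hN : σ.nat CNT 0 0 ≤ N)
    (hQ : ∀ τ, Frame growAll σ τ → Rep J τ (grow st (σ.num DEL 0 0)) → Q τ) :
    wp N growAll Q σ := by
  classical
  set d := σ.num DEL 0 0 with hd
  suffices wp N growAll (fun τ => (∀ k < σ.nat CNT 0 0,
      τ.num POT k 0 = (grow st d).potential (idSet σ k) ∧
      τ.num UNC k 0 = (grow st d).uncharged (idSet σ k)) ∧
      ∀ u v : Fin n, τ.num LOAD u v = σ.num LOAD u v + d * activeDeg st u v) σ by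
    refine wp_call this fun τ ⟨h1, h2⟩ hf => hQ τ hf ?_
    have h7 := hf.nat CNT rfl
    have h3 := idSet_congr (n := n) (hf.nat MEM rfl)
    exact {
      input := h.input.congr (fun a ha => hf.nat a (by interval_cases a <;> rfl))
        (fun a ha => hf.num a (by rcases ha with rfl | rfl <;> rfl))
      ids := h.ids.congr fun a ha => hf.nat a (by rcases ha with rfl | rfl | rfl | rfl <;> rfl)
      act_le := by rw [h7, hf.nat ACT rfl]; exact h.act_le
      act := by simp only [h7, h3]; rw [hf.nat ACT rfl]; exact h.act
      pot := by simp only [h7, h3]; exact fun k hk => (h1 k hk).1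
      unc := by simp only [h7, h3]; exact fun k hk => (h1 k hk).2
      load := fun u v huv => by rw [h2, h.load u v huv, hS.load_grow_eq]
      lab := by rw [hf.nat LAB rfl]; exact h.lab }
  refine wp_forLoop (fun k τ => ∀ l < σ.nat CNT 0 0,
      τ.num POT l 0 = (if l < k then (grow st d).potential (idSet σ l) else σ.num POT l 0) ∧
      τ.num UNC l 0 = (if l < k then (grow st d).uncharged (idSet σ l) else σ.num UNC l 0))
      rfl rfl hN (fun _ _ _ hh => hh) (fun l _ => ⟨rfl, rfl⟩) ?_ ?_
  · intro k τ hk hf hRK hI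
    have hk : k < σ.nat CNT 0 0 := hk
    obtain ⟨p1, p2⟩ := hI k hk
    rw [if_neg (lt_irrefl k)] at p1 p2
    have hact : Test.Holds τ (isPos (entry ACT (reg RK))) ↔ idSet σ k ∈ st.active := by
      simp only [Test.Holds, NatExp.eval, hRK, hf.nat ACT rfl, h.act k hk]
    have hdel : τ.num DEL 0 0 = d := by rw [hf.num DEL rfl]
    -- the entries with other numbers keep their values
    have hother : ∀ l, l ≠ k → (l < k + 1 ↔ l < k) := fun l hl => by omega
    refine ⟨fun ha l hl => ?_, fun ha l hl => ?_⟩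
    · rw [hact] at ha
      by_cases hlk : l = k
      · subst hlk
        simp [Store.setNum, NumExp.eval, NatExp.eval, hRK, p1, p2, hdel, grow, ha, h.pot l hl,
          h.unc l hl]
      · simpa [Store.setNum, NumExp.eval, NatExp.eval, hRK, hlk, hother l hlk] using hI l hl
    · rw [hact] at ha
      by_cases hlk : l = k
      · subst hlk
        simp [p1, p2, grow, ha, h.pot l hl, h.unc l hl]
      · simpa [hother l hlk] using hI l hl
  intro σ₁ hf₁ hI₁
  have hf₁' : ∀ a, a ≠ RK → σ₁.nat a = σ.nat a := fun a ha =>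
    hf₁.nat a (by simp [forLoop, Program.writesNat, ha])
  have hs : σ₁.nat SIZE 0 0 = n := by rw [hf₁' SIZE (by simp)]; exact h.input.size
  have hLOAD : σ₁.num LOAD = σ.num LOAD := hf₁.num LOAD rfl
  refine wp_forPairs (fun i j τ => ∀ u v : Fin n, τ.num LOAD u v =
      if Before i j u v then σ.num LOAD u v + d * activeDeg st u v else σ.num LOAD u v)
    (by simp) (by simp) (by simp) rfl rfl rfl (by rw [hs]; exact h.ids.le_cnt.trans hN)
    (fun _ _ _ _ hh => ⟨hh, hh⟩) (fun u v => ?_) ?_ ?_ ?_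
  · rw [if_neg (not_before_zero _ _), hLOAD]
  · intro i τ _ hI u v
    simp only [before_row v.2]
    rw [hs] at hI
    exact hI u v
  · intro i j τ hi hj hf hRU hRV hI
    rw [hs] at hi hj
    set a : Fin n := ⟨i, hi⟩ with ha
    set b : Fin n := ⟨j, hj⟩ with hb
    have hCID : τ.nat CID = σ.nat CID := (hf.nat CID rfl).trans (hf₁' CID (by simp))
    have hACT : τ.nat ACT = σ.nat ACT := (hf.nat ACT rfl).trans (hf₁' ACT (by simp))
    have hdel : τ.num DEL 0 0 = d := by rw [hf.num DEL rfl, hf₁.num DEL rfl]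
    have hval : τ.num LOAD i j = σ.num LOAD i j := by
      have := hI a b
      rwa [if_neg (by simp [Before, a, b])] at this
    -- it suffices to find the right value at the present pair
    have key : ∀ ρ : Store, ρ.num LOAD i j = σ.num LOAD i j + d * activeDeg st a b →
        (∀ i' j', ¬ (i' = i ∧ j' = j) → ρ.num LOAD i' j' = τ.num LOAD i' j') →
        ∀ u v : Fin n, ρ.num LOAD u v = if Before i (j + 1) u v then
          σ.num LOAD u v + d * activeDeg st u v else σ.num LOAD u v := by
      intro ρ h1 h2 u v
      by_cases huv : (u : ℕ) = i ∧ (v : ℕ) = j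
      · obtain ⟨h3, h4⟩ := huv
        obtain rfl : u = a := Fin.ext h3
        obtain rfl : v = b := Fin.ext h4
        rw [if_pos (before_succ.2 (Or.inr ⟨rfl, rfl⟩))]
        exact h1
      · rw [h2 _ _ huv, hI u v]
        simp only [before_succ, huv, or_false]
    have hA : σ.nat ACT (σ.nat CID i 0) 0 = if comp st a ∈ st.active then 1 else 0 := h.act_eq a
    have hB : σ.nat ACT (σ.nat CID j 0) 0 = if comp st b ∈ st.active then 1 else 0 := h.act_eq b
    have hr : σ.nat CID i 0 = σ.nat CID j 0 ↔ st.forest.Reachable a b := h.cid_eq_iff a b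
    refine ⟨fun hg => ?_, fun hg => ?_⟩
    · simp only [Test.Holds, NatExp.eval, hRU, hRV, hCID, ← le_antisymm_iff, hr] at hg
      have hdeg := hS.activeDeg_of_not_reachable hg
      simp only [wp, Test.Holds, NatExp.eval, NumExp.eval, setNum_nat, hRU, hRV, hCID, hACT, hA, hB]
      refine ⟨fun h1 => ⟨fun h2 => ?_, fun h2 => ?_⟩, fun h1 => ⟨fun h2 => ?_, fun h2 => ?_⟩⟩ <;>
        refine key _ ?_ fun i' j' hne => ?_
      all_goals first
        | simp [Store.setNum, hne]
        | rw [hdeg]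
          split_ifs at h1 h2 ⊢ <;> simp [Store.setNum, hval, hdel] at h1 h2 ⊢ <;> ring
    · simp only [Test.Holds, NatExp.eval, hRU, hRV, hCID, ← le_antisymm_iff, hr, not_not] at hg
      refine key _ ?_ fun i' j' _ => rfl
      rw [hS.activeDeg_of_reachable hg, hval]; simp
  · intro τ hf hI
    refine ⟨fun k hk => ?_, fun u v => ?_⟩
    · have := hI₁ k hk
      rw [hf.num POT rfl, hf.num UNC rfl]
      simpa [show k < σ.nat CNT 0 0 from hk] using this
    · rw [hI u v, if_pos]
      rw [hs]; exact .of_lt u.2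

end RAM

/-! ### Exhausted components -/

namespace RAM

open PrimalDual

variable {n : ℕ}

theorem pairOf_inj {u u' v v' : Fin n} (h : pairOf u v = pairOf u' v') (hu : u = u') : v = v' := by
  subst hu
  have := mk_pairOf u v
  rw [h, mk_pairOf] at this
  exact (Sym2.congr_right.1 this).symm

theorem pairOf_mem_pairs {J : PCSF n} {u v : Fin n} :
    pairOf u v ∈ pairs J ↔ u ≠ v ∧ 0 < J.penalty s(u, v) := by
  rw [mem_pairs, mk_pairOf]
  simp [pairOf, eq_comm]

theorem eq_pairOf_or {u v : Fin n} : u = (pairOf u v).1 ∨ u = (pairOf u v).2 := by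
  rcases le_total u v with h | h <;> simp [pairOf, h]

theorem pairOf_mem_terms {J : PCSF n} {u v : Fin n} (h : pairOf u v ∈ pairs J) :
    (pairOf u v, u) ∈ terms J := mem_terms.2 ⟨h, eq_pairOf_or⟩

theorem RepInput.hpen_pos {J : PCSF n} {σ : Store} (h : RepInput J σ) (u v : Fin n) :
    0 < σ.num HPEN u v ↔ pairOf u v ∈ pairs J := by
  rw [pairOf_mem_pairs]
  by_cases huv : u = v
  · subst huv; simp [h.hpen_diag]
  · rw [h.hpen u v huv]; simp [huv]

theorem RepInput.hpen_pair {J : PCSF n} {σ : Store} (h : RepInput J σ) {u v : Fin n} (huv : u ≠ v) :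
    σ.num HPEN u v = pen J (pairOf u v) / 2 := by
  rw [h.hpen u v huv, pen, mk_pairOf]

theorem Rep.mark {J : PCSF n} {σ : Store} {st : State n} (h : Rep J σ st) {u v : Fin n}
    (huv : u ≠ v) (c : Status) :
    Rep J (σ.setNat LAB u v (enc c)) (mark st (pairOf u v) u c) where
  input := h.input.congr (fun a ha => setNat_nat_of_ne _ _ _ _ (by omega)) fun _ _ => rfl
  ids := h.ids.congr fun a ha => setNat_nat_of_ne _ _ _ _ (by omega)
  act_le := h.act_le
  act := h.act
  pot := h.pot
  unc := h.unc
  load := h.load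
  lab u' v' huv' := by
    rw [setNat_nat_self, status_mark]
    by_cases h1 : u' = u ∧ v' = v
    · obtain ⟨rfl, rfl⟩ := h1
      simp
    · rw [if_neg (by rwa [Fin.val_inj, Fin.val_inj]), if_neg]
      · exact h.lab u' v' huv'
      · rintro ⟨h2, h3⟩; exact h1 ⟨h3, pairOf_inj h2 h3⟩

theorem Rep.setPot {J : PCSF n} {σ : Store} {st : State n} (h : Rep J σ st) {k : ℕ}
    (hk : k < σ.nat CNT 0 0) (x : ℝ) :
    Rep J (σ.setNum POT k 0 x)
      { st with potential := Function.update st.potential (idSet σ k) x } where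
  input := h.input.congr (fun _ _ => rfl) fun a ha => setNum_num_of_ne _ _ _ _ (by omega)
  ids := h.ids.congr fun _ _ => rfl
  act_le := h.act_le
  act := h.act
  pot l hl := by
    rw [setNum_num_self]
    by_cases hlk : l = k
    · subst hlk; rw [if_pos ⟨rfl, rfl⟩]; exact (Function.update_self (idSet σ l) x st.potential).symm
    · rw [if_neg (by simp [hlk]), h.pot l hl]
      exact (Function.update_of_ne (fun he => hlk (h.ids.inj hl hk he)) _ _).symm
  unc := h.unc
  load := h.load
  lab := h.lab

theorem Rep.deactivate {J : PCSF n} {σ : Store} {st : State n} (h : Rep J σ st) {k : ℕ}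
    (hk : k < σ.nat CNT 0 0) :
    Rep J (σ.setNat ACT k 0 0) { st with active := st.active.erase (idSet σ k) } where
  input := h.input.congr (fun a ha => setNat_nat_of_ne _ _ _ _ (by omega)) fun _ _ => rfl
  ids := h.ids.congr fun a ha => setNat_nat_of_ne _ _ _ _ (by omega)
  act_le l hl := by
    rw [setNat_nat_self]
    split_ifs
    · simp
    · exact h.act_le l hl
  act l hl := by
    rw [setNat_nat_self]
    change _ ↔ idSet σ l ∈ st.active.erase (idSet σ k)
    by_cases hlk : l = k
    · subst hlk; simp
    · rw [if_neg (by simp [hlk]), Finset.mem_erase, h.act l hl]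
      exact ⟨fun hh => ⟨fun he => hlk (h.ids.inj hl hk he), hh⟩, fun hh => hh.2⟩
  pot := h.pot
  unc := h.unc
  load := h.load
  lab := h.lab

theorem chargeLoop_nonneg (L : List (Finset (Fin n))) :
    ∀ (r : ℝ) (unch sh : Finset (Fin n) → ℝ), (∀ T, 0 ≤ unch T) →
      ∀ T, 0 ≤ (chargeLoop r unch sh L).2.1 T := by
  induction L with
  | nil => exact fun _ _ _ h => h
  | cons S L ih =>
    intro r unch sh h T
    simp only [chargeLoop]
    split_ifs with hS
    · refine ih _ _ _ (fun A => ?_) T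
      by_cases hA : A = S
      · subst hA; simp
      · simpa [hA] using h A
    · by_cases hA : T = S
      · subst hA; simp only [Function.update_self]; linarith
      · simpa [hA] using h T

/-- Processing an exhausted component. -/
theorem wp_exhaust {N k : ℕ} {J : PCSF n} {σ : Store} {st : State n} {Q : Store → Prop}
    (h : Rep J σ st) (hI : Inv J st) (hN : σ.nat CNT 0 0 ≤ N) (hEVK : σ.nat EVK 0 0 = k)
    (hk : k < σ.nat CNT 0 0) (hS : idSet σ k ∈ st.active) (hpot : st.potential (idSet σ k) = 0)
    (hQ : ∀ τ (L : List ((Fin n × Fin n) × Fin n)), Frame exhaust σ τ → L.Nodup →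
      (∀ x, x ∈ L ↔ x.1 ∈ pairs J ∧ (x.2 = x.1.1 ∨ x.2 = x.1.2) ∧ x.2 ∈ idSet σ k ∧
        st.status x.1 x.2 = Status.alive) →
      Rep J τ (L.foldl (expire J) { st with active := st.active.erase (idSet σ k) }) → Q τ) :
    wp N exhaust Q σ := by
  set S : Finset (Fin n) := idSet σ k with hSdef
  set st₁ : State n := { st with active := st.active.erase S } with hst₁
  -- the terminals inspected before the pair `(i, j)`
  let C : ℕ → ℕ → (Fin n × Fin n) × Fin n → Prop := fun i j x => ∃ u v : Fin n,
    x = (pairOf u v, u) ∧ Before i j u v ∧ pairOf u v ∈ pairs J ∧ u ∈ S ∧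
      st.status (pairOf u v) u = Status.alive
  suffices wp N exhaust (fun τ => ∃ L : List ((Fin n × Fin n) × Fin n), L.Nodup ∧
      (∀ x, x ∈ L ↔ C n 0 x) ∧ Rep J τ (L.foldl (expire J) st₁)) σ by
    refine wp_call this fun τ ⟨L, h1, h2, h3⟩ hf => hQ τ L hf h1 (fun x => ?_) h3
    rw [h2]
    constructor
    · rintro ⟨u, v, rfl, -, hp, hu, hal⟩
      exact ⟨hp, eq_pairOf_or, hu, hal⟩
    · rcases x with ⟨⟨a, b⟩, w⟩
      rintro ⟨hp, hw | hw, hu, hal⟩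
      · simp only at hw
        subst hw
        have := pairOf_of_lt (mem_pairs.1 hp).1
        exact ⟨w, b, by rw [this], .of_lt w.2, by rwa [this], hu, by rwa [this]⟩
      · simp only at hw
        subst hw
        have := (pairOf_comm w a).trans (pairOf_of_lt (mem_pairs.1 hp).1)
        exact ⟨w, a, by rw [this], .of_lt w.2, by rwa [this], hu, by rwa [this]⟩
  have hσ₁ : Rep J (σ.setNat ACT (NatExp.eval σ (reg EVK)) (NatExp.eval σ zero)
      (NatExp.eval σ zero)) st₁ := by
    simp only [NatExp.eval, hEVK]
    exact h.deactivate hk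
  refine wp_forPairs (fun i j τ => ∃ L : List ((Fin n × Fin n) × Fin n), L.Nodup ∧
      (∀ x, x ∈ L ↔ C i j x) ∧ Rep J τ (L.foldl (expire J) st₁))
    (by simp) (by simp) (by simp) rfl rfl rfl
    (by rw [hσ₁.input.size]; exact h.ids.le_cnt.trans hN) ?_ ⟨[], List.nodup_nil, ?_, hσ₁⟩ ?_ ?_ ?_
  · rintro i j τ x ⟨L, h1, h2, h3⟩
    exact ⟨⟨L, h1, h2, h3.setNat (by simp) _ _ _⟩, ⟨L, h1, h2, h3.setNat (by simp) _ _ _⟩⟩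
  · intro x
    simp [C, not_before_zero]
  · rintro i τ - ⟨L, h1, h2, h3⟩
    rw [hσ₁.input.size] at h2
    refine ⟨L, h1, fun x => (h2 x).trans ?_, h3⟩
    simp only [C]
    exact exists_congr fun u => exists_congr fun v => by rw [before_row v.2]
  · rintro i j τ hi hj hf hRU hRV ⟨L, hL, hLm, hR⟩
    rw [hσ₁.input.size] at hi hj
    set a : Fin n := ⟨i, hi⟩ with ha
    set b : Fin n := ⟨j, hj⟩ with hb
    have hRU : τ.nat RU 0 0 = a := hRU
    have hRV : τ.nat RV 0 0 = b := hRV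
    have hnb : ¬ Before i j a b := by simp [Before, a, b]
    obtain ⟨hB, -, hsame, hst, -⟩ := (hI.erase_balanced S).foldl_expire (S := S) L hL
      (fun x hx => by
        obtain ⟨u, v, rfl, -, hp, hu, hal⟩ := (hLm x).1 hx
        exact hI.expirable hS (pairOf_mem_terms hp) hu hal) hpot
    set s := L.foldl (expire J) st₁ with hs
    have hnotin : (pairOf a b, a) ∉ L := by
      rw [hLm]
      rintro ⟨u, v, he, hbef, -⟩
      obtain ⟨h1, rfl⟩ := Prod.mk.inj he
      exact hnb (pairOf_inj h1 rfl ▸ hbef)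
    have hstat : s.status (pairOf a b) a = st.status (pairOf a b) a := hst _ _ hnotin
    have hEVKτ : τ.nat EVK 0 0 = k := by rw [hf.nat EVK rfl]; exact hEVK
    have hMEM : a ∈ idSet τ k ↔ a ∈ S := by
      rw [idSet_congr (hf.nat MEM rfl)]; rfl
    have hguard : Test.Holds τ (.both (isPos (.cell MEM (reg EVK) (reg RU)))
        (.both (numPos (.cell HPEN (reg RU) (reg RV))) (isZero (.cell LAB (reg RU) (reg RV))))) ↔
        a ∈ S ∧ pairOf a b ∈ pairs J ∧ st.status (pairOf a b) a = Status.alive := by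
      simp only [Test.Holds, NatExp.eval, NumExp.eval, hRU, hRV, hEVKτ, ← mem_idSet, hMEM,
        Nat.cast_zero, not_le, hR.input.hpen_pos, nonpos_iff_eq_zero]
      refine and_congr_right fun _ => and_congr_right fun hp => ?_
      rw [hR.lab a b (pairOf_mem_pairs.1 hp).1, enc_eq_zero, hstat]
    refine ⟨fun hg => ?_, fun hg => ?_⟩
    · rw [hguard] at hg
      obtain ⟨haS, hp, hal⟩ := hg
      have hab := (pairOf_mem_pairs.1 hp).1
      have hR' : Rep J (τ.setNat LAB a b 2) (mark s (pairOf a b) a Status.dead) :=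
        hR.mark hab Status.dead
      simp only [wp, NatExp.eval, NumExp.eval, hRU, hRV, setNat_num]
      have h7 : τ.nat CNT 0 0 = σ.nat CNT 0 0 := by rw [hf.nat CNT rfl]; rfl
      refine wp_processHistory (i := pairOf a b) (u := a) (hR'.setNum (by simp) 0 0 _) (by simp)
        hB.charges.unch_nonneg ?_ ?_ ?_ ?_ fun ρ _ hρ _ =>
          ⟨L ++ [(pairOf a b, a)], ?_, fun x => ?_, ?_⟩
      · exact hB.struct.term_formed _ _ (pairOf_mem_terms hp)
      · simpa [Store.setNat] using hRU
      · rw [← hR.input.hpen_pair hab]; simp [Store.setNum, Store.setNat, hRU, hRV]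
      · exact h7.le.trans hN
      · exact List.nodup_append.2 ⟨hL, by simp, by
          intro x hx y hy he
          rw [List.mem_singleton] at hy
          subst he; subst hy; exact hnotin hx⟩
      · rw [List.mem_append, hLm, List.mem_singleton]
        constructor
        · rintro (⟨u, v, h1, h2, h3⟩ | rfl)
          · exact ⟨u, v, h1, before_succ.2 (Or.inl h2), h3⟩
          · exact ⟨a, b, rfl, before_succ.2 (Or.inr ⟨rfl, rfl⟩), hp, haS, hal⟩
        · rintro ⟨u, v, h1, h2, h3⟩
          rcases before_succ.1 h2 with h2 | ⟨h4, h5⟩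
          · exact Or.inl ⟨u, v, h1, h2, h3⟩
          · obtain rfl : u = a := Fin.ext h4
            obtain rfl : v = b := Fin.ext h5
            exact Or.inr h1
      · rw [List.foldl_append]
        exact hρ
    · rw [hguard] at hg
      refine ⟨L, hL, fun x => (hLm x).trans ⟨?_, ?_⟩, hR⟩
      · rintro ⟨u, v, h1, h2, h3⟩
        exact ⟨u, v, h1, before_succ.2 (Or.inl h2), h3⟩
      · rintro ⟨u, v, h1, h2, h3⟩
        rcases before_succ.1 h2 with h2 | ⟨h4, h5⟩
        · exact ⟨u, v, h1, h2, h3⟩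
        · obtain rfl : u = a := Fin.ext h4
          obtain rfl : v = b := Fin.ext h5
          exact absurd ⟨h3.2.1, h3.1, h3.2.2⟩ hg
  · rintro τ - ⟨L, h1, h2, h3⟩
    rw [hσ₁.input.size] at h2
    exact ⟨L, h1, h2, h3⟩

end RAM

/-! ### Tight edges -/

namespace RAM

open PrimalDual

variable {n : ℕ}

/-- What `mergeComps` does to the memory; `c` is the number of the new component. -/
structure Merged (σ τ : Store) (n u v ka kb c : ℕ) : Prop where
  frame : Frame mergeComps σ τ
  ca : τ.nat CA 0 0 = ka
  new : τ.nat NEW 0 0 = c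
  cnt : τ.nat CNT 0 0 = c + 1
  out : ∀ i j, τ.nat OUT i j = if (i = u ∧ j = v) ∨ (i = v ∧ j = u) then 1 else σ.nat OUT i j
  mem_new : ∀ x < n, τ.nat MEM c x = σ.nat MEM ka x + σ.nat MEM kb x
  mem_old : ∀ l, l ≠ c → τ.nat MEM l = σ.nat MEM l
  cid : ∀ x < n, τ.nat CID x 0 =
    if 1 ≤ σ.nat MEM ka x + σ.nat MEM kb x then c else σ.nat CID x 0
  act : ∀ l, τ.nat ACT l 0 = if l = c then 1 else if l = ka ∨ l = kb then 0 else σ.nat ACT l 0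
  pot : ∀ l, τ.num POT l 0 = if l = c then σ.num POT ka 0 + σ.num POT kb 0 else σ.num POT l 0
  unc : ∀ l, τ.num UNC l 0 = if l = c then 0 else σ.num UNC l 0

theorem wp_mergeComps {N u v ka kb c : ℕ} {σ : Store} {Q : Store → Prop}
    (hu : σ.nat EVU 0 0 = u) (hv : σ.nat EVV 0 0 = v) (hka : σ.nat CID u 0 = ka)
    (hkb : σ.nat CID v 0 = kb) (hc : σ.nat CNT 0 0 = c) (hac : ka ≠ c) (hbc : kb ≠ c)
    (hn : σ.nat SIZE 0 0 = n) (hnN : n ≤ N) (hQ : ∀ τ, Merged σ τ n u v ka kb c → Q τ) :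
    wp N mergeComps Q σ := by
  suffices wp N mergeComps (fun τ => Frame mergeComps σ τ → Merged σ τ n u v ka kb c) σ from
    wp_call this fun τ h1 h2 => hQ τ (h1 h2)
  refine wp_forLoop (fun k τ => (∀ x < n, τ.nat MEM c x =
        if x < k then σ.nat MEM ka x + σ.nat MEM kb x else σ.nat MEM c x) ∧
      (∀ l, l ≠ c → τ.nat MEM l = σ.nat MEM l) ∧
      ∀ x < n, τ.nat CID x 0 = if x < k ∧ 1 ≤ σ.nat MEM ka x + σ.nat MEM kb x
        then c else σ.nat CID x 0)
    rfl rfl ?_ (fun _ _ _ hh => hh) ?_ ?_ ?_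
  · simpa [Store.setNat, NatExp.eval, hn] using hnN
  · simp [Store.setNat, NatExp.eval]
  · rintro k τ hk hf hRX ⟨h1, h2, h3⟩
    have hk : k < n := by simpa [Store.setNat, NatExp.eval, hn] using hk
    have hCA : τ.nat CA 0 0 = ka := by
      rw [hf.nat CA rfl]; simp [Store.setNat, NatExp.eval, hu, hka]
    have hCB : τ.nat CB 0 0 = kb := by
      rw [hf.nat CB rfl]; simp [Store.setNat, NatExp.eval, hv, hkb]
    have hNEW : τ.nat NEW 0 0 = c := by
      rw [hf.nat NEW rfl]; simp [Store.setNat, NatExp.eval, hc]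
    have hA : τ.nat MEM ka k = σ.nat MEM ka k := by rw [h2 ka hac]
    have hB : τ.nat MEM kb k = σ.nat MEM kb k := by rw [h2 kb hbc]
    have hother : ∀ l, l ≠ k → (l < k + 1 ↔ l < k) := fun l hl => by omega
    simp only [wp, Test.Holds, NatExp.eval, hCA, hCB, hNEW, hRX]
    have e1 : ∀ ρ : Store, ρ.nat MEM = (τ.setNat MEM c k (σ.nat MEM ka k + σ.nat MEM kb k)).nat MEM →
        (∀ x < n, ρ.nat MEM c x =
          if x < k + 1 then σ.nat MEM ka x + σ.nat MEM kb x else σ.nat MEM c x) ∧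
        ∀ l, l ≠ c → ρ.nat MEM l = σ.nat MEM l := by
      intro ρ hρ
      rw [hρ]
      refine ⟨fun x hx => ?_, fun l hl => ?_⟩
      · rw [setNat_nat_self]
        by_cases hxk : x = k
        · subst hxk; simp
        · rw [if_neg (by simp [hxk]), h1 x hx]; simp only [hother x hxk]
      · rw [← h2 l hl]; funext x; simp [Store.setNat, hl]
    have hval : (τ.setNat MEM c k (τ.nat MEM ka k + τ.nat MEM kb k)).nat MEM c k =
        σ.nat MEM ka k + σ.nat MEM kb k := by simp [Store.setNat, hA, hB]
    have hregs : ∀ a x y, a ≠ MEM → (τ.setNat MEM c k (τ.nat MEM ka k + τ.nat MEM kb k)).nat a x y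
        = τ.nat a x y := fun a x y ha => by rw [setNat_nat_of_ne _ _ _ _ ha]
    simp only [hregs RX _ _ (by simp), hregs NEW _ _ (by simp), hRX, hNEW, hval]
    rw [hA, hB]
    refine ⟨fun hg => ⟨(e1 _ ?_).1, (e1 _ ?_).2, fun x hx => ?_⟩,
      fun hg => ⟨(e1 _ rfl).1, (e1 _ rfl).2, fun x hx => ?_⟩⟩
    · exact setNat_nat_of_ne _ _ _ _ (by simp)
    · exact setNat_nat_of_ne _ _ _ _ (by simp)
    · rw [setNat_nat_self]
      by_cases hxk : x = k
      · subst hxk; simp [hg]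
      · rw [if_neg (by simp [hxk]), setNat_nat_of_ne _ _ _ _ (by simp), h3 x hx]
        simp only [hother x hxk]
    · rw [setNat_nat_of_ne _ _ _ _ (by simp), h3 x hx]
      by_cases hxk : x = k
      · subst hxk; simp [hg]
      · simp only [hother x hxk]
  · rintro τ hf ⟨h1, h2, h3⟩
    have hCA : τ.nat CA 0 0 = ka := by
      rw [hf.nat CA rfl]; simp [Store.setNat, NatExp.eval, hu, hka]
    have hCB : τ.nat CB 0 0 = kb := by
      rw [hf.nat CB rfl]; simp [Store.setNat, NatExp.eval, hv, hkb]
    have hNEW : τ.nat NEW 0 0 = c := by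
      rw [hf.nat NEW rfl]; simp [Store.setNat, NatExp.eval, hc]
    have hCNT : τ.nat CNT 0 0 = c := by
      rw [hf.nat CNT rfl]; simp [Store.setNat, NatExp.eval, hc]
    have hACT : τ.nat ACT = σ.nat ACT := hf.nat ACT rfl
    have hPOT : τ.num POT = σ.num POT := hf.num POT rfl
    have hUNC : τ.num UNC = σ.num UNC := hf.num UNC rfl
    have hOUT : ∀ i j, τ.nat OUT i j =
        if (i = u ∧ j = v) ∨ (i = v ∧ j = u) then 1 else σ.nat OUT i j := by
      intro i j
      rw [hf.nat OUT rfl]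
      simp only [Store.setNat, NatExp.eval, hu, hv]
      by_cases q1 : i = u ∧ j = v <;> by_cases q2 : i = v ∧ j = u <;> simp [q1, q2]
    have h1' : ∀ x < n, τ.nat MEM c x = σ.nat MEM ka x + σ.nat MEM kb x := fun x hx => by
      rw [h1 x hx, if_pos (by simpa [Store.setNat, hn] using hx)]
    have h3' : ∀ x < n, τ.nat CID x 0 =
        if 1 ≤ σ.nat MEM ka x + σ.nat MEM kb x then c else σ.nat CID x 0 := fun x hx => by
      rw [h3 x hx]
      simp [Store.setNat, hn, hx]
    clear h1 h3 hf
    simp only [wp, NatExp.eval, NumExp.eval]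
    intro hf
    refine ⟨hf, ?_, ?_, ?_, ?_, ?_, ?_, ?_, ?_, ?_, ?_⟩
    · simpa [Store.setNat] using hCA
    · simpa [Store.setNat] using hNEW
    · simpa [Store.setNat] using hCNT
    · simpa [Store.setNat] using hOUT
    · simpa [Store.setNat] using h1'
    · intro l hl
      rw [← h2 l hl]
      funext x
      simp [Store.setNat]
    · simpa [Store.setNat] using h3'
    · intro l
      by_cases q1 : l = c <;> by_cases q2 : l = kb <;> by_cases q3 : l = ka <;>
        simp [Store.setNat, hCA, hCB, hNEW, hACT, q1, q2, q3]
    · intro l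
      by_cases q1 : l = c <;> simp [Store.setNum, Store.setNat, hCA, hCB, hNEW, hPOT, q1]
    · intro l
      by_cases q1 : l = c <;> simp [Store.setNum, Store.setNat, hNEW, hUNC, q1]

/-- The set with the number `k` is contained in a component. -/
theorem Rep.idSet_subset_comp {J : PCSF n} {σ : Store} {st : State n} (h : Rep J σ st)
    (hS : Struct J st) {k : ℕ} (hk : k < σ.nat CNT 0 0) {v : Fin n} (hv : v ∈ idSet σ k) :
    idSet σ k ⊆ comp st v := by
  by_cases hkn : n ≤ k
  · exact hS.formed_sub _ (h.ids.mem_formed k hkn hk) v hv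
  · have := h.ids.singleton ⟨k, by omega⟩
    simp only at this
    rw [this] at hv ⊢
    rw [Finset.mem_singleton.1 hv, Finset.singleton_subset_iff]
    exact mem_comp_self st _

theorem Rep.merge {J : PCSF n} {σ τ : Store} {st : State n} (h : Rep J σ st) (hS : Struct J st)
    {u v : Fin n} (huv : ¬ st.forest.Reachable u v)
    (hm : Merged σ τ n u v (σ.nat CID u 0) (σ.nat CID v 0) (σ.nat CNT 0 0)) :
    Rep J τ (merge st u v) ∧ idSet τ (σ.nat CNT 0 0) = comp st u ∪ comp st v ∧
      idSet τ (σ.nat CID u 0) = comp st u := by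
  set c := σ.nat CNT 0 0 with hc
  set ka := σ.nat CID u 0 with hka
  set kb := σ.nat CID v 0 with hkb
  have hac : ka < c := h.ids.cid_lt u
  have hbc : kb < c := h.ids.cid_lt v
  have hA : idSet σ ka = comp st u := h.cid_eq u
  have hB : idSet σ kb = comp st v := h.cid_eq v
  have hold : ∀ l, l ≠ c → (idSet τ l : Finset (Fin n)) = idSet σ l := fun l hl => by
    unfold idSet; rw [hm.mem_old l hl]
  have hmemU : ∀ x : Fin n, 1 ≤ σ.nat MEM ka x + σ.nat MEM kb x ↔ x ∈ comp st u ∪ comp st v := by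
    intro x
    rw [Finset.mem_union, ← hA, ← hB, mem_idSet, mem_idSet]; omega
  have hnew : idSet τ c = comp st u ∪ comp st v := by
    ext x
    rw [mem_idSet, hm.mem_new x x.2, hmemU]
  have hne : ∀ l < c, ∀ x, x ∈ idSet σ l → ¬ comp st u ∪ comp st v ⊆ idSet σ l := fun l hl x hx hs =>
    comp_union_ne huv x (hs.trans (h.idSet_subset_comp hS hl hx))
  have hne' : ∀ l < c, (idSet σ l : Finset (Fin n)) ≠ comp st u ∪ comp st v := fun l hl he => by
    obtain ⟨x, hx⟩ := h.ids.nonempty l hl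
    exact hne l hl x hx he.ge
  have hid : ∀ l, l < c + 1 → l = c ∨ l < c := fun l hl => by omega
  have hcnt := hm.cnt
  refine ⟨?_, hnew, by rw [hold ka hac.ne, hA]⟩
  have hcomp : ∀ x : Fin n, idSet τ (τ.nat CID x 0) = comp (PrimalDual.merge st u v) x := by
    intro x
    rw [hm.cid x x.2]
    simp only [hmemU]
    split_ifs with hx
    · rw [hnew, comp_merge_of_mem hx]
    · rw [hold _ (h.ids.cid_lt x).ne, comp_merge_of_notMem hx, h.cid_eq]
  refine ⟨h.input.congr (fun a ha => hm.frame.nat a (by interval_cases a <;> rfl))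
      (fun a ha => hm.frame.num a (by rcases ha with rfl | rfl <;> rfl)),
    ⟨?_, ?_, ?_, ?_, ?_, ?_, ?_, ?_, ?_, ?_, ?_⟩, ?_, ?_, ?_, ?_, ?_, ?_⟩
  · rw [hcnt]; exact h.ids.le_cnt.trans (Nat.le_succ _)
  · rw [hcnt]
    intro l hl x
    rcases hid l hl with rfl | hl
    · rw [hm.mem_new x x.2]
      have h1 := h.ids.mem_le ka hac x
      have h2 := h.ids.mem_le kb hbc x
      have h3 : ¬ (1 ≤ σ.nat MEM ka x ∧ 1 ≤ σ.nat MEM kb x) := by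
        rintro ⟨h3, h4⟩
        rw [← mem_idSet (n := n)] at h3 h4
        rw [hA] at h3
        rw [hB] at h4
        exact Finset.disjoint_left.1 (comp_disjoint huv) h3 h4
      omega
    · rw [hm.mem_old l hl.ne]; exact h.ids.mem_le l hl x
  · intro x
    rw [hold _ (x.2.trans_le h.ids.le_cnt).ne]; exact h.ids.singleton x
  · rw [hcnt]
    intro k l hkl hl x hk hlx
    have hkc : k < c := by omega
    rw [hold k hkc.ne] at hk ⊢
    rcases hid l hl with rfl | hl
    · rw [hnew] at hlx ⊢
      have hsub : comp st x ⊆ comp st u ∪ comp st v := by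
        rcases Finset.mem_union.1 hlx with hx | hx
        · rw [comp_eq_of_mem hx]; exact Finset.subset_union_left
        · rw [comp_eq_of_mem hx]; exact Finset.subset_union_right
      exact ⟨(h.idSet_subset_comp hS hkc hk).trans hsub, hne k hkc x hk⟩
    · rw [hold l hl.ne] at hlx ⊢
      exact h.ids.chain k l hkl hl x hk hlx
  · rw [hcnt]
    intro l hl
    rcases hid l hl with rfl | hl
    · rw [hnew]; exact ⟨u, Finset.mem_union_left _ (mem_comp_self st u)⟩
    · rw [hold l hl.ne]; exact h.ids.nonempty l hl
  · rw [hcnt]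
    intro l hnl hl
    rcases hid l hl with rfl | hl
    · rw [hnew]; exact Finset.mem_insert_self _ _
    · rw [hold l hl.ne]; exact Finset.mem_insert_of_mem (h.ids.mem_formed l hnl hl)
  · rw [hcnt]
    intro T hT
    rcases Finset.mem_insert.1 hT with rfl | hT
    · exact ⟨c, Nat.lt_succ_self c, hnew⟩
    · obtain ⟨l, hl, rfl⟩ := h.ids.exists_id T hT
      exact ⟨l, hl.trans (Nat.lt_succ_self c), hold l hl.ne⟩
  · intro x
    rw [hcnt, hm.cid x x.2]
    have := h.ids.cid_lt x
    split_ifs <;> omega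
  · intro x y
    rw [hcomp, mem_comp]
  · intro x y
    rw [hm.out]
    split_ifs
    · rfl
    · exact h.ids.out_le x y
  · intro x y
    have hxy : u ≠ v := fun he => huv (he ▸ .refl _)
    rw [hm.out]
    change _ ↔ (st.forest ⊔ SimpleGraph.edge u v).Adj x y
    rw [SimpleGraph.sup_adj, SimpleGraph.edge_adj, ← h.ids.out x y]
    simp only [Fin.val_inj]
    split_ifs with hc
    · have : x ≠ y := by rcases hc with ⟨rfl, rfl⟩ | ⟨rfl, rfl⟩; exacts [hxy, hxy.symm]
      simp [hc, this]
    · simp [hc]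
  · rw [hcnt]
    intro l hl
    rw [hm.act]
    split_ifs with h1 h2
    · rfl
    · exact zero_le_one
    · exact h.act_le l (by omega)
  · rw [hcnt]
    intro l hl
    rw [hm.act]
    change _ ↔ idSet τ l ∈ insert (comp st u ∪ comp st v)
      ((st.active.erase (comp st u)).erase (comp st v))
    rcases hid l hl with rfl | hl
    · simp [hnew]
    · rw [if_neg hl.ne, hold l hl.ne, Finset.mem_insert, or_iff_right (hne' l hl), Finset.mem_erase,
        Finset.mem_erase, ← h.act l hl, ← hA, ← hB]
      by_cases h1 : l = ka
      · simp [h1]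
      · by_cases h2 : l = kb
        · simp [h2]
        · simp only [h1, h2, or_self, if_false, ne_eq]
          exact ⟨fun hh => ⟨fun he => h2 (h.ids.inj hl hbc he),
            fun he => h1 (h.ids.inj hl hac he), hh⟩, fun hh => hh.2.2⟩
  · rw [hcnt]
    intro l hl
    rw [hm.pot]
    change _ = Function.update st.potential _ _ (idSet τ l)
    rcases hid l hl with rfl | hl
    · rw [if_pos rfl, hnew, Function.update_self, h.pot ka hac, h.pot kb hbc, hA, hB]
    · rw [if_neg hl.ne, hold l hl.ne, Function.update_of_ne (hne' l hl), h.pot l hl]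
  · rw [hcnt]
    intro l hl
    rw [hm.unc]
    change _ = Function.update st.uncharged _ _ (idSet τ l)
    rcases hid l hl with rfl | hl
    · rw [if_pos rfl, hnew, Function.update_self]
    · rw [if_neg hl.ne, hold l hl.ne, Function.update_of_ne (hne' l hl), h.unc l hl]
  · intro x y hxy
    rw [hm.frame.num LOAD rfl, load_merge hS huv]; exact h.load x y hxy
  · rw [hm.frame.nat LAB rfl]; exact h.lab

theorem wp_payOutProg {N x y k : ℕ} {J : PCSF n} {σ : Store} {st : State n} {u v a b : Fin n}
    {Q : Store → Prop} (h : Rep J σ st) (hxK : x ≠ RK)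
    (hunch : ∀ S, 0 ≤ st.uncharged S) (hu : {u} ∈ st.formed) (huv : u ≠ v)
    (hx : σ.nat x 0 0 = u) (hy : σ.nat y 0 0 = v) (ha : σ.nat RU 0 0 = a) (hb : σ.nat RV 0 0 = b)
    (hab : s(a, b) = s(u, v)) (hk : σ.nat NEW 0 0 = k) (hkc : k < σ.nat CNT 0 0)
    (hN : σ.nat CNT 0 0 ≤ N)
    (hQ : ∀ τ, Frame (payOutProg x y) σ τ → Rep J τ (payOut J (idSet σ k) st (pairOf u v) u) →
      Q τ) : wp N (payOutProg x y) Q σ := by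
  suffices wp N (payOutProg x y) (fun τ => Rep J τ (payOut J (idSet σ k) st (pairOf u v) u)) σ from
    wp_call this fun τ h1 h2 => hQ τ h2 h1
  have hguard : Test.Holds σ (isZero (.cell LAB (reg x) (reg y))) ↔
      st.status (pairOf u v) u = Status.alive := by
    simp only [Test.Holds, NatExp.eval, hx, hy, nonpos_iff_eq_zero]
    rw [h.lab u v huv, enc_eq_zero]
  have hab' : a ≠ b := by
    rintro rfl
    have h1 : u ∈ s(a, a) := hab ▸ Sym2.mem_mk_left u v
    have h2 : v ∈ s(a, a) := hab ▸ Sym2.mem_mk_right u v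
    simp only [Sym2.mem_iff, or_self] at h1 h2
    exact huv (h1.trans h2.symm)
  refine ⟨fun hg => ?_, fun hg => ?_⟩
  · rw [hguard] at hg
    simp only [wp, NatExp.eval, NumExp.eval, ha, hb]
    refine wp_processHistory (i := pairOf u v) (u := u) (h.setNum (by simp) 0 0 _) hxK hunch hu hx
      ?_ hN fun ρ hf hρ hrest => ?_
    · rw [setNum_num_self, if_pos ⟨rfl, rfl⟩, h.input.hpen a b hab', hab, pen, mk_pairOf]
    · have hNEW : ρ.nat NEW 0 0 = k := by rw [hf.nat NEW rfl]; exact hk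
      have hCNT : k < ρ.nat CNT 0 0 := by rw [hf.nat CNT rfl]; exact hkc
      simp only [hNEW, hrest]
      have h3 : (idSet ρ k : Finset (Fin n)) = idSet σ k :=
        idSet_congr (n := n) (τ := ρ) (σ := σ) (hf.nat MEM rfl) k
      have := hρ.setPot hCNT (st.potential (idSet σ k) - historyRest J st (pairOf u v) u)
      rw [h3] at this
      rw [payOut, if_pos hg, hρ.pot k hCNT, h3]
      exact this
  · rw [hguard] at hg
    rw [payOut, if_neg hg]
    exact h

theorem payOut_unch_nonneg {J : PCSF n} {S : Finset (Fin n)} {st : State n} {i : Fin n × Fin n}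
    {u : Fin n} (h : ∀ T, 0 ≤ st.uncharged T) (T : Finset (Fin n)) :
    0 ≤ (payOut J S st i u).uncharged T := by
  unfold payOut
  split_ifs
  · exact chargeLoop_nonneg _ _ _ _ h T
  · exact h T

theorem wp_unite {N k : ℕ} {J : PCSF n} {σ : Store} {st : State n} {a b : Fin n}
    {Q : Store → Prop} (h : Rep J σ st) (hS : Struct J st)
    (hunch : ∀ S, 0 ≤ st.uncharged S) (ha : σ.nat RU 0 0 = a) (hb : σ.nat RV 0 0 = b)
    (hab : (a, b) ∈ pairs J) (hk : σ.nat NEW 0 0 = k) (hkc : k < σ.nat CNT 0 0)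
    (hN : σ.nat CNT 0 0 ≤ N)
    (hQ : ∀ τ, Frame unite σ τ → Rep J τ (unitePair J (idSet σ k) st (a, b)) → Q τ) :
    wp N unite Q σ := by
  suffices wp N unite (fun τ => Rep J τ (unitePair J (idSet σ k) st (a, b))) σ from
    wp_call this fun τ h1 h2 => hQ τ h2 h1
  have hlt := (mem_pairs.1 hab).1
  have hne : a ≠ b := hlt.ne
  have hpo : pairOf a b = (a, b) := pairOf_of_lt hlt
  have hpo' : pairOf b a = (a, b) := (pairOf_comm b a).trans hpo
  have hla : σ.nat LAB a b = enc (st.status (a, b) a) := by rw [h.lab a b hne, hpo]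
  have hlb : σ.nat LAB b a = enc (st.status (a, b) b) := by rw [h.lab b a hne.symm, hpo']
  have key : ∀ ρ : Store, Rep J ρ st → ρ.nat RU 0 0 = a → ρ.nat RV 0 0 = b → ρ.nat NEW 0 0 = k →
      ρ.nat CNT = σ.nat CNT → (idSet ρ k : Finset (Fin n)) = idSet σ k →
      ρ.nat TAG 0 0 = enc (unitedLabel st (a, b)) →
      wp N (.seq (payOutProg RU RV) (.seq (payOutProg RV RU)
        (.seq (.setNat LAB (reg RU) (reg RV) (reg TAG))
          (.setNat LAB (reg RV) (reg RU) (reg TAG)))))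
        (fun τ => Rep J τ (unitePair J (idSet σ k) st (a, b))) ρ := by
    intro ρ hρ hρa hρb hρk hcnt hid htag
    refine wp_seq (wp_payOutProg hρ (by simp) hunch
      (hS.term_formed _ _ (left_mem_terms hab)) hne hρa hρb hρa hρb rfl hρk (by rwa [hcnt])
      (by rwa [hcnt]) fun ρ₁ hf₁ h₁ => ?_)
    rw [hid, hpo] at h₁
    have r1 : ρ₁.nat RU 0 0 = a := by rw [hf₁.nat RU rfl, hρa]
    have r2 : ρ₁.nat RV 0 0 = b := by rw [hf₁.nat RV rfl, hρb]
    have r3 : ρ₁.nat NEW 0 0 = k := by rw [hf₁.nat NEW rfl, hρk]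
    have r4 : ρ₁.nat CNT = σ.nat CNT := by rw [hf₁.nat CNT rfl, hcnt]
    have r5 : (idSet ρ₁ k : Finset (Fin n)) = idSet σ k := by
      rw [idSet_congr (hf₁.nat MEM rfl), hid]
    refine wp_seq (wp_payOutProg h₁ (by simp) (payOut_unch_nonneg hunch) ?_ hne.symm r2 r1 r1 r2
      Sym2.eq_swap r3 (by rwa [r4]) (by rwa [r4]) fun ρ₂ hf₂ h₂ => ?_)
    · rw [(sameStruct_payOut J _ st _ _).formed]
      exact hS.term_formed _ _ (right_mem_terms hab)
    rw [r5, hpo'] at h₂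
    have s1 : ρ₂.nat RU 0 0 = a := by rw [hf₂.nat RU rfl, r1]
    have s2 : ρ₂.nat RV 0 0 = b := by rw [hf₂.nat RV rfl, r2]
    have s3 : ρ₂.nat TAG 0 0 = enc (unitedLabel st (a, b)) := by
      rw [hf₂.nat TAG rfl, hf₁.nat TAG rfl, htag]
    have h₃ := (h₂.mark hne (unitedLabel st (a, b))).mark hne.symm (unitedLabel st (a, b))
    rw [hpo, hpo'] at h₃
    have e1 : ∀ x y z, (ρ₂.setNat LAB x y z).nat RU 0 0 = a := fun x y z => by
      rw [setNat_nat_of_ne _ _ _ _ (by simp), s1]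
    have e2 : ∀ x y z, (ρ₂.setNat LAB x y z).nat RV 0 0 = b := fun x y z => by
      rw [setNat_nat_of_ne _ _ _ _ (by simp), s2]
    have e3 : ∀ x y z, (ρ₂.setNat LAB x y z).nat TAG 0 0 = enc (unitedLabel st (a, b)) :=
      fun x y z => by rw [setNat_nat_of_ne _ _ _ _ (by simp), s3]
    simp only [wp, NatExp.eval, s1, s2, s3, e1, e2, e3]
    exact h₃
  have hguard : Test.Holds σ (.both (isZero (.cell LAB (reg RU) (reg RV)))
      (isZero (.cell LAB (reg RV) (reg RU)))) ↔
      st.status (a, b) a = Status.alive ∧ st.status (a, b) b = Status.alive := by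
    simp only [Test.Holds, NatExp.eval, ha, hb, nonpos_iff_eq_zero, hla, hlb, enc_eq_zero]
  refine ⟨fun hg => ?_, fun hg => ?_⟩
  · rw [hguard] at hg
    refine key _ (h.setNat (by simp) _ _ _) ?_ ?_ ?_ ?_ ?_ ?_
    · simpa [Store.setNat] using ha
    · simpa [Store.setNat] using hb
    · simpa [Store.setNat] using hk
    · exact setNat_nat_of_ne _ _ _ _ (by simp)
    · exact idSet_congr (setNat_nat_of_ne _ _ _ _ (by simp)) k
    · rw [unitedLabel, if_pos hg]; simp [Store.setNat, NatExp.eval, enc]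
  · rw [hguard] at hg
    refine key _ (h.setNat (by simp) _ _ _) ?_ ?_ ?_ ?_ ?_ ?_
    · simpa [Store.setNat] using ha
    · simpa [Store.setNat] using hb
    · simpa [Store.setNat] using hk
    · exact setNat_nat_of_ne _ _ _ _ (by simp)
    · exact idSet_congr (setNat_nat_of_ne _ _ _ _ (by simp)) k
    · rw [unitedLabel, if_neg hg]; simp [Store.setNat, NatExp.eval, enc]

/-- Processing a tight edge. -/
theorem wp_mergeEvent {N : ℕ} {J : PCSF n} {σ : Store} {st : State n} {u v : Fin n}
    {Q : Store → Prop} (h : Rep J σ st) (hI : PrimalDual.Inv J st) (ht : TightEdge J st u v)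
    (hN : σ.nat CNT 0 0 + 1 ≤ N) (hu : σ.nat EVU 0 0 = u) (hv : σ.nat EVV 0 0 = v)
    (hQ : ∀ τ (L : List (Fin n × Fin n)), τ.nat CNT 0 0 = σ.nat CNT 0 0 + 1 → L.Nodup →
      (∀ i, i ∈ L ↔ i ∈ pairs J ∧ Unites (merge st u v) (comp st u ∪ comp st v) i) →
      Rep J τ (L.foldl (unitePair J (comp st u ∪ comp st v)) (merge st u v)) → Q τ) :
    wp N mergeEvent Q σ := by
  have huv := ht.2.1
  have hcN := (Nat.le_succ _).trans hN
  refine wp_seq (wp_mergeComps hu hv rfl rfl rfl (h.ids.cid_lt u).ne (h.ids.cid_lt v).ne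
    h.input.size (h.ids.le_cnt.trans hcN) fun σ₁ hm => ?_)
  obtain ⟨hσ₁, hnew, hca⟩ := h.merge hI.struct huv hm
  set S := comp st u ∪ comp st v with hS
  set st₁ := merge st u v with hst₁
  set c := σ.nat CNT 0 0 with hc
  have hB₁ : PrimalDual.Balanced J st₁ := hI.merge_balanced ht
  refine wp_forPairs (fun i j τ => ∃ L : List (Fin n × Fin n), L.Nodup ∧
      (∀ p, p ∈ L ↔ p ∈ pairs J ∧ Unites st₁ S p ∧ Before i j p.1 p.2) ∧
      Rep J τ (L.foldl (unitePair J S) st₁))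
    (by simp) (by simp) (by simp) rfl rfl rfl
    (by rw [hσ₁.input.size]; exact h.ids.le_cnt.trans hcN) ?_ ⟨[], List.nodup_nil, ?_, hσ₁⟩ ?_ ?_ ?_
  · rintro i j τ x ⟨L, h1, h2, h3⟩
    exact ⟨⟨L, h1, h2, h3.setNat (by simp) _ _ _⟩, ⟨L, h1, h2, h3.setNat (by simp) _ _ _⟩⟩
  · intro x
    simp [not_before_zero]
  · rintro i τ - ⟨L, h1, h2, h3⟩
    rw [hσ₁.input.size] at h2
    refine ⟨L, h1, fun p => ?_, h3⟩
    rw [h2, before_row p.2.2]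
  · rintro i j τ hi hj hf hRU hRV ⟨L, hL, hLm, hR⟩
    rw [hσ₁.input.size] at hi hj
    set a : Fin n := ⟨i, hi⟩ with ha
    set b : Fin n := ⟨j, hj⟩ with hb
    have hRU : τ.nat RU 0 0 = a := hRU
    have hRV : τ.nat RV 0 0 = b := hRV
    obtain ⟨hB, -, -, -, -⟩ := hB₁.foldl_unitePair (S := S) L hL
      (fun p hp => hI.unitable huv ((hLm p).1 hp).1 ((hLm p).1 hp).2.1)
      (by simp [st₁, S, merge])
    have hNEW : τ.nat NEW 0 0 = c := by rw [hf.nat NEW rfl, hm.new]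
    have hCA : τ.nat CA 0 0 = σ.nat CID u 0 := by rw [hf.nat CA rfl, hm.ca]
    have hCNT : τ.nat CNT 0 0 = c + 1 := by rw [hf.nat CNT rfl, hm.cnt]
    have hid : ∀ k, (idSet τ k : Finset (Fin n)) = idSet σ₁ k := idSet_congr (hf.nat MEM rfl)
    have hSid : idSet τ c = S := (hid c).trans hnew
    have hcaid : ∀ x : Fin n, 1 ≤ τ.nat MEM (σ.nat CID u 0) x ↔ st.forest.Reachable u x := by
      intro x; rw [← mem_idSet, hid, hca, mem_comp]
    have hcale : ∀ x : Fin n, τ.nat MEM (σ.nat CID u 0) x ≤ 1 := fun x =>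
      hR.ids.mem_le _ (by rw [hCNT]; exact (h.ids.cid_lt u).trans (Nat.lt_succ_self _)) x
    have hguard : Test.Holds τ (.both (natLt (reg RU) (reg RV))
        (.both (numPos (.cell HPEN (reg RU) (reg RV)))
        (.both (isPos (.cell MEM (reg NEW) (reg RU))) (.both (isPos (.cell MEM (reg NEW) (reg RV)))
        (natEq (.add (.cell MEM (reg CA) (reg RU)) (.cell MEM (reg CA) (reg RV)))
          (.const 1)))))) ↔ (a, b) ∈ pairs J ∧ Unites st₁ S (a, b) := by
      have hlt : (a : ℕ) + 1 ≤ b ↔ a < b := Iff.rfl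
      simp only [Test.Holds, NatExp.eval, NumExp.eval, hRU, hRV, hNEW, hCA, ← mem_idSet, hSid,
        Nat.cast_zero, not_le, hR.input.hpen_pos, ← le_antisymm_iff, hlt]
      by_cases hab : a < b
      swap
      · simp [hab, mem_pairs]
      rw [pairOf_of_lt hab]
      simp only [hab, true_and]
      refine and_congr_right fun _ => ?_
      rw [hI.struct.unites_merge_iff huv hab.ne, and_assoc]
      refine and_congr_right fun haS => and_congr_right fun hbS => ?_
      have h1 := hcale a
      have h2 := hcale b
      have h3 := hcaid a
      have h4 := hcaid b
      have h5 : ∀ x, x ∈ S → ¬ st.forest.Reachable u x → st.forest.Reachable v x := fun x hx hn =>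
        (Finset.mem_union.1 hx).elim (fun hh => absurd (mem_comp.1 hh) hn) mem_comp.1
      constructor
      · intro hsum hab'
        by_cases hua : st.forest.Reachable u a
        · have := h3.2 hua
          have := h4.2 (hua.trans hab')
          omega
        · have := mt h3.1 hua
          have := mt h4.1 fun hub => hua (hub.trans hab'.symm)
          omega
      · intro hab'
        by_cases hua : st.forest.Reachable u a
        · have := h3.2 hua
          have := mt h4.1 fun hub => hab' (hua.symm.trans hub)
          omega
        · have hub : st.forest.Reachable u b := by
            by_contra hub
            exact hab' ((h5 a haS hua).symm.trans (h5 b hbS hub))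
          have := mt h3.1 hua
          have := h4.2 hub
          omega
    refine ⟨fun hg => ?_, fun hg => ?_⟩
    · rw [hguard] at hg
      refine wp_unite hR hB.struct hB.charges.unch_nonneg hRU hRV hg.1 hNEW (by omega) (by omega)
        fun ρ _ hρ => ⟨L ++ [(a, b)], ?_, fun p => ?_, ?_⟩
      · refine List.nodup_append.2 ⟨hL, by simp, ?_⟩
        intro x hx y hy he
        rw [List.mem_singleton] at hy
        subst he; subst hy
        have := ((hLm _).1 hx).2.2
        simp [Before, a, b] at this
      · rw [List.mem_append, hLm, List.mem_singleton, before_succ]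
        constructor
        · rintro (⟨h1, h2, h3⟩ | rfl)
          · exact ⟨h1, h2, Or.inl h3⟩
          · exact ⟨hg.1, hg.2, Or.inr ⟨rfl, rfl⟩⟩
        · rintro ⟨h1, h2, h3 | ⟨h4, h5⟩⟩
          · exact Or.inl ⟨h1, h2, h3⟩
          · exact Or.inr (Prod.ext (Fin.ext h4) (Fin.ext h5))
      · rw [hSid] at hρ
        rw [List.foldl_append]
        exact hρ
    · rw [hguard] at hg
      refine ⟨L, hL, fun p => ?_, hR⟩
      rw [hLm, before_succ]
      constructor
      · rintro ⟨h1, h2, h3⟩; exact ⟨h1, h2, Or.inl h3⟩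
      · rintro ⟨h1, h2, h3 | ⟨h4, h5⟩⟩
        · exact ⟨h1, h2, h3⟩
        · obtain rfl : p = (a, b) := Prod.ext (Fin.ext h4) (Fin.ext h5)
          exact absurd ⟨h1, h2⟩ hg
  · rintro τ hf ⟨L, h1, h2, h3⟩
    rw [hσ₁.input.size] at h2
    refine hQ τ L (by rw [hf.nat CNT rfl, hm.cnt]) h1 (fun i => ?_) h3
    rw [h2]
    exact ⟨fun hh => ⟨hh.1, hh.2.1⟩, fun hh => ⟨hh.1, hh.2, .of_lt i.1.2⟩⟩

end RAM

/-! ### The main loop -/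

namespace PrimalDual

variable {n : ℕ}

theorem SameStruct.foldl {α : Type*} {f : State n → α → State n} (h : ∀ s x, SameStruct s (f s x))
    (L : List α) (s : State n) : SameStruct s (L.foldl f s) := by
  induction L generalizing s with
  | nil => exact .refl s
  | cons x L ih => exact (h s x).trans (ih _)

/-- Every iteration decreases the number of components plus the number of active components. -/
theorem Step.measure {I : PCSF n} {st st' : State n} (h : Step I st st') :
    (clusters st'.forest).card + st'.active.card + 1 ≤
      (clusters st.forest).card + st.active.card := by
  classical
  cases h with
  | edge d u v L _ _ ht _ _ =>
    have hs := SameStruct.foldl (sameStruct_unitePair I (comp st u ∪ comp st v)) L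
      (merge (grow st d) u v)
    rw [hs.forest, hs.active]
    have h1 : (clusters (st.forest ⊔ SimpleGraph.edge u v)).card + 1 ≤ (clusters st.forest).card :=
      card_clusters_sup_edge ht.2.1
    have h2 : (insert (comp st u ∪ comp st v)
        ((st.active.erase (comp st u)).erase (comp st v))).card ≤ st.active.card := by
      refine (Finset.card_insert_le _ _).trans ?_
      have hlt : ((st.active.erase (comp st u)).erase (comp st v)).card < st.active.card := by
        refine Finset.card_lt_card ⟨(Finset.erase_subset _ _).trans (Finset.erase_subset _ _),
          fun hsub => ?_⟩
        rcases ht.2.2.1 with hu | hv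
        · have := hsub hu
          simp [comp_eq_cluster, grow] at this
        · have := hsub hv
          simp [comp_eq_cluster, grow] at this
      omega
    change (clusters (st.forest ⊔ SimpleGraph.edge u v)).card + (insert (comp st u ∪ comp st v)
        ((st.active.erase (comp st u)).erase (comp st v))).card + 1 ≤ _
    omega
  | exhausted d S L _ _ hS _ _ _ =>
    have hs := SameStruct.foldl (sameStruct_expire I) L
      { grow st d with active := st.active.erase S }
    have h1 := hs.forest
    have h2 := hs.active
    unfold expire at h1 h2
    rw [h1, h2]
    have := Finset.card_erase_add_one hS
    change (clusters st.forest).card + (st.active.erase S).card + 1 ≤ _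
    omega

end PrimalDual

namespace RAM

open PrimalDual

variable {n : ℕ}

theorem Rep.of_frame {J : PCSF n} {P : Program} {σ τ : Store} {st : State n} (h : Rep J σ st)
    (hf : Frame P σ τ) (h1 : ∀ a < 8, P.writesNat a = false) (h2 : ∀ a < 7, P.writesNum a = false) :
    Rep J τ st :=
  h.congr (fun a ha => hf.nat a (h1 a ha)) fun a _ ha _ => hf.num a (h2 a ha)

/-- One round performs an iteration of the algorithm unless no component is active. -/
theorem wp_round {N : ℕ} {J : PCSF n} {σ : Store} {st : State n} {Q : Store → Prop}
    (h : Rep J σ st) (hI : PrimalDual.Inv J st) (hN : σ.nat CNT 0 0 + 1 ≤ N)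
    (h0 : ∀ τ, st.active = ∅ → τ.nat CNT 0 0 = σ.nat CNT 0 0 → Rep J τ st → Q τ)
    (h1 : ∀ τ st', Step J st st' → τ.nat CNT 0 0 ≤ σ.nat CNT 0 0 + 1 → Rep J τ st' → Q τ) :
    wp N round Q σ := by
  have hcN := (Nat.le_succ _).trans hN
  refine wp_seq (wp_findEvent h hI hcN ?_ ?_ ?_)
  · intro τ hf he hact
    refine ⟨fun hg => ?_, fun _ => h0 τ hact (by rw [hf.nat CNT rfl])
      (h.of_frame hf (by decide) (by decide))⟩
    simp [Test.Holds, NatExp.eval, he] at hg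
  · intro τ hf he hd hw hk hS hpot
    have hR : Rep J τ st := h.of_frame hf (by decide) (by decide)
    have h7 : τ.nat CNT = σ.nat CNT := hf.nat CNT rfl
    refine ⟨fun _ => ?_, fun hg => absurd ?_ hg⟩
    swap
    · simp [Test.Holds, NatExp.eval, he]
    refine wp_seq (wp_growAll hR hI.struct (by rwa [h7]) fun ρ hfρ hρ => ⟨fun hg => ?_, fun _ => ?_⟩)
    · simp [Test.Holds, NatExp.eval, hfρ.nat EVT rfl, he] at hg
    · have hid : ∀ k, (idSet ρ k : Finset (Fin n)) = idSet τ k := idSet_congr (hfρ.nat MEM rfl)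
      have hK : ρ.nat EVK 0 0 = τ.nat EVK 0 0 := by rw [hfρ.nat EVK rfl]
      have h7' : ρ.nat CNT = τ.nat CNT := hfρ.nat CNT rfl
      refine wp_exhaust hρ (hI.grow hd hw) (by rwa [h7', h7]) hK (by rwa [h7'])
        (by rw [hid]; exact hS) (by rw [hid]; exact hpot) fun π L hfπ hL hLm hπ => ?_
      rw [hid] at hπ
      simp only [hid] at hLm
      refine h1 π _ (Step.exhausted st _ _ L hd hw hS hpot hL hLm) ?_ hπ
      rw [hfπ.nat CNT rfl, h7', h7]; exact Nat.le_succ _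
  · intro τ u v hf he hd hw hu hv ht
    have hR : Rep J τ st := h.of_frame hf (by decide) (by decide)
    have h7 : τ.nat CNT = σ.nat CNT := hf.nat CNT rfl
    refine ⟨fun _ => ?_, fun hg => absurd ?_ hg⟩
    swap
    · simp [Test.Holds, NatExp.eval, he]
    refine wp_seq (wp_growAll hR hI.struct (by rwa [h7]) fun ρ hfρ hρ => ⟨fun _ => ?_,
      fun hg => absurd ?_ hg⟩)
    swap
    · simp [Test.Holds, NatExp.eval, hfρ.nat EVT rfl, he]
    have h7' : ρ.nat CNT = τ.nat CNT := hfρ.nat CNT rfl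
    refine wp_mergeEvent hρ (hI.grow hd hw) ht (by rwa [h7', h7]) (by rw [hfρ.nat EVU rfl, hu])
      (by rw [hfρ.nat EVV rfl, hv]) fun π L hc hL hLm hπ => ?_
    refine h1 π _ (Step.edge st _ u v L hd hw ht hL hLm) ?_ hπ
    rw [hc, h7', h7]

/-- `2 n` rounds suffice, since the measure starts at `2 n` at most and every round with an active
component decreases it.  At most `n + 2 n` components get a number. -/
theorem wp_mainLoop {N : ℕ} {J : PCSF n} {σ : Store} {Q : Store → Prop}
    (h : Rep J σ (init J)) (hcnt : σ.nat CNT 0 0 = n) (hrnd : σ.nat RND 0 0 = n + n)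
    (hN : 3 * n ≤ N)
    (hQ : ∀ τ st, Relation.ReflTransGen (Step J) (init J) st → st.active = ∅ → Rep J τ st → Q τ) :
    wp N (forLoop RI RND round) Q σ := by
  have hcard : ∀ st : State n, (clusters st.forest).card ≤ n := fun st => by
    simpa using card_clusters_le st.forest
  refine wp_forLoop (fun k τ => ∃ st, Relation.ReflTransGen (Step J) (init J) st ∧ Rep J τ st ∧
      τ.nat CNT 0 0 ≤ n + k ∧
      (st.active = ∅ ∨ (clusters st.forest).card + st.active.card + k ≤ n + n))
    rfl rfl (by omega) ?_ ?_ ?_ ?_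
  · rintro k τ x ⟨st, a, b, c, d⟩
    exact ⟨st, a, b.setNat (by simp) _ _ _, by simpa [Store.setNat] using c, d⟩
  · refine ⟨init J, .refl, h, by omega, Or.inr ?_⟩
    have h1 := hcard (init J)
    have h2 := Finset.card_le_card (inv_init J).struct.active_clusters
    omega
  · rintro k τ hk - - ⟨st, a, b, c, d⟩
    rw [hrnd] at hk
    refine wp_round b (inv_of_reaches a) (by omega)
      (fun ρ h1 h2 h3 => ⟨st, a, h3, by omega, Or.inl h1⟩)
      fun ρ st' hs h2 h3 => ⟨st', a.tail hs, h3, by omega, ?_⟩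
    have hm := hs.measure
    rcases d with d | d
    · left
      by_contra hne
      cases hs with
      | edge d' u v L _ _ ht _ _ =>
        have : comp st u ∈ st.active ∨ comp st v ∈ st.active := ht.2.2.1
        simp [d] at this
      | exhausted d' S L _ _ hS _ _ _ => simp [d] at hS
    · right; omega
  · rintro τ - ⟨st, a, b, c, d⟩
    rw [hrnd] at d
    refine hQ τ st a ?_ b
    rcases d with d | d
    · exact d
    · exact Finset.card_eq_zero.1 (by omega)

end RAM

/-! ### The initial state -/

namespace RAM

open PrimalDual

variable {n : ℕ}

/-- The potential of a vertex is the sum of half of the penalties of all pairs with that vertex. -/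
theorem potential_init_eq_sum (J : PCSF n) (u : Fin n) :
    (init J).potential {u} = ∑ v, if u = v then 0 else J.penalty s(u, v) / 2 := by
  classical
  have h1 : (∑ v, if u = v then 0 else J.penalty s(u, v) / 2) =
      ∑ v with pairOf u v ∈ pairs J, pen J (pairOf u v) / 2 := by
    rw [Finset.sum_filter]
    refine Finset.sum_congr rfl fun v _ => ?_
    have h0 := J.penalty_nonneg s(u, v)
    simp only [pairOf_mem_pairs, pen, mk_pairOf]
    by_cases huv : u = v
    · simp [huv]
    · by_cases hp : 0 < J.penalty s(u, v)
      · simp [huv, hp]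
      · have : J.penalty s(u, v) = 0 := by linarith
        simp [this]
  rw [h1]
  simp only [init]
  symm
  refine Finset.sum_bij (fun v _ => pairOf u v) ?_ ?_ ?_ ?_
  · intro v hv
    refine Finset.mem_filter.2 ⟨(Finset.mem_filter.1 hv).2, ?_⟩
    simp only [Finset.singleton_inj]
    exact eq_pairOf_or
  · intro v _ v' _ he
    exact pairOf_inj he rfl
  · intro i hi
    obtain ⟨hi, h⟩ := Finset.mem_filter.1 hi
    simp only [Finset.singleton_inj] at h
    have hp := pairOf_of_lt (mem_pairs.1 hi).1
    rcases h with rfl | rfl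
    · exact ⟨i.2, Finset.mem_filter.2 ⟨Finset.mem_univ _, by rwa [hp]⟩, hp⟩
    · exact ⟨i.1, Finset.mem_filter.2 ⟨Finset.mem_univ _, by rwa [pairOf_comm, hp]⟩,
        (pairOf_comm _ _).trans hp⟩
  · intro v _; rfl

theorem wp_setup {N : ℕ} (I : PCSF n) {ε : ℝ} (hε : 0 < ε) {Q : Store → Prop} (hN : n ≤ N)
    (hQ : ∀ τ, Rep (I.scale (2 / ε) (div_nonneg zero_le_two hε.le)) τ
      (init (I.scale (2 / ε) (div_nonneg zero_le_two hε.le))) → τ.nat CNT 0 0 = n →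
      τ.nat RND 0 0 = n + n → Q τ) : wp N setup Q (I.input ε) := by
  classical
  set J := I.scale (2 / ε) (div_nonneg zero_le_two hε.le) with hJ
  set σ := I.input ε with hσ
  have hs : σ.nat SIZE 0 0 = n := rfl
  have hEPS : σ.num EPS 0 0 = ε := rfl
  have hADJ : ∀ u v : Fin n, 1 ≤ σ.nat ADJ u v ↔ J.graph.Adj u v := by
    intro u v
    simp only [hσ, PCSF.input, hJ, PCSF.scale]
    simp only [Nat.reduceEqDiff, false_and, if_false, u.2, v.2, and_self, dif_pos]
    split_ifs <;> simp_all
  have hCOST : ∀ u v : Fin n, J.graph.Adj u v → σ.num COST u v = J.cost s(u, v) := by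
    intro u v huv
    have huv' : I.graph.Adj u v := huv
    simp [hσ, PCSF.input, hJ, PCSF.scale, PCSF.costEntry, huv']
  let w : Fin n → Fin n → ℝ := fun u v => if u = v then 0 else J.penalty s(u, v) / 2
  have hw0 : ∀ u v, 0 ≤ w u v := fun u v => by
    simp only [w]
    split_ifs
    · exact le_rfl
    · exact div_nonneg (J.penalty_nonneg _) zero_le_two
  have hPEN : ∀ u v : Fin n, σ.num PEN u v / ε = w u v := by
    intro u v
    simp only [w, hσ, PCSF.input, PCSF.penaltyEntry, hJ, PCSF.scale]
    by_cases huv : u = v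
    · simp [huv]
    · simp [huv]; field_simp
  have hz : ∀ a i j, 2 ≤ a → σ.nat a i j = 0 := fun a i j ha => by
    simp [hσ, PCSF.input, show a ≠ 0 by omega, show a ≠ 1 by omega]
  have hz' : ∀ a i j, 3 ≤ a → σ.num a i j = 0 := fun a i j ha => by
    simp [hσ, PCSF.input, show a ≠ 0 by omega, show a ≠ 1 by omega, show a ≠ 2 by omega]
  refine wp_seq (wp_forPairs (fun i j τ =>
      (∀ u v : Fin n, τ.num HPEN u v = if Before i j u v then w u v else 0) ∧
      (∀ u : Fin n, τ.num POT u 0 = ∑ v : Fin n, if Before i j u v then w u v else 0) ∧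
      (∀ u : Fin n, τ.nat ACT u 0 ≤ 1 ∧
        (1 ≤ τ.nat ACT u 0 ↔ ∃ v : Fin n, Before i j u v ∧ 0 < w u v)))
    (by simp) (by simp) (by simp) rfl rfl rfl (by rw [hs]; exact hN)
    (fun _ _ _ _ hh => ⟨hh, hh⟩) ⟨fun u v => ?_, fun u => ?_, fun u => ?_⟩ ?_ ?_ ?_)
  · rw [if_neg (not_before_zero _ _), hz' _ _ _ (by simp)]
  · simp [not_before_zero, hz']
  · simp [not_before_zero, hz]
  · rintro i τ - ⟨h1, h2, h3⟩
    rw [hs] at h1 h2 h3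
    refine ⟨fun u v => ?_, fun u => ?_, fun u => ?_⟩
    · rw [h1]; simp only [before_row v.2]
    · rw [h2]; exact Finset.sum_congr rfl fun v _ => by simp only [before_row v.2]
    · refine ⟨(h3 u).1, (h3 u).2.trans (exists_congr fun v => by rw [before_row v.2])⟩
  · rintro i j τ hi hj hf hRU hRV ⟨h1, h2, h3⟩
    rw [hs] at hi hj
    set a : Fin n := ⟨i, hi⟩ with ha
    set b : Fin n := ⟨j, hj⟩ with hb
    have hRU : τ.nat RU 0 0 = a := hRU
    have hRV : τ.nat RV 0 0 = b := hRV
    have hpen : τ.num PEN a b / τ.num EPS 0 0 = w a b := by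
      rw [hf.num PEN rfl, hf.num EPS rfl, hEPS, hPEN]
    have hbef : ∀ u v : Fin n, Before i (j + 1) u v ↔ Before i j u v ∨ u = a ∧ v = b := by
      intro u v
      rw [before_succ]
      simp [a, b, Fin.ext_iff]
    have hnb : ¬ Before i j a b := by simp [Before, a, b]
    have hsum : ∀ u : Fin n, (∑ v : Fin n, if Before i (j + 1) u v then w u v else 0) =
        (∑ v : Fin n, if Before i j u v then w u v else 0) + if u = a then w a b else 0 := by
      intro u
      have : (if u = a then w a b else 0) = ∑ v : Fin n, if u = a ∧ v = b then w u v else 0 := by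
        by_cases hua : u = a
        · subst hua; simp
        · simp [hua]
      rw [this, ← Finset.sum_add_distrib]
      refine Finset.sum_congr rfl fun v _ => ?_
      simp only [hbef]
      by_cases q : u = a ∧ v = b
      · obtain ⟨rfl, rfl⟩ := q
        simp [hnb]
      · simp [q]
    have hh : ∀ ρ : Store, ρ.num HPEN = (τ.setNum HPEN a b (w a b)).num HPEN →
        ∀ u v : Fin n, ρ.num HPEN u v = if Before i (j + 1) u v then w u v else 0 := by
      intro ρ hρ u v
      rw [hρ, setNum_num_self, h1 u v]
      simp only [hbef, Fin.val_inj]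
      by_cases q : u = a ∧ v = b
      · obtain ⟨rfl, rfl⟩ := q
        simp
      · simp [q]
    simp only [wp, NatExp.eval, NumExp.eval, Test.Holds, hRU, hRV, hpen, setNum_nat]
    rw [setNum_num_self, if_pos ⟨rfl, rfl⟩, Nat.cast_zero, not_le]
    refine ⟨fun hp => ⟨hh _ ?_, fun u => ?_, fun u => ?_⟩, fun hp => ⟨hh _ rfl, fun u => ?_, fun u => ?_⟩⟩
    · rw [setNat_num]; exact setNum_num_of_ne _ _ _ _ (by simp)
    · rw [hsum, ← h2]
      by_cases hua : u = a
      · subst hua; simp [Store.setNat, Store.setNum]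
      · simp [Store.setNat, Store.setNum, hua, Fin.val_inj]
    · by_cases hua : u = a
      · subst hua
        simp only [Store.setNat, and_self, if_true, le_refl, true_and, true_iff]
        exact ⟨b, (hbef a b).2 (Or.inr ⟨rfl, rfl⟩), hp⟩
      · have : ∀ v : Fin n, Before i (j + 1) u v ↔ Before i j u v := fun v => by rw [hbef]; simp [hua]
        simp only [this]
        simpa [Store.setNat, hRU, Fin.val_inj, hua] using h3 u
    · rw [hsum, ← h2]
      have : w a b = 0 := le_antisymm (not_lt.1 hp) (hw0 a b)
      simp [Store.setNum, this]
    · refine ⟨(h3 u).1, (h3 u).2.trans (exists_congr fun v => ?_)⟩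
      rw [hbef]
      constructor
      · rintro ⟨h4, h5⟩; exact ⟨Or.inl h4, h5⟩
      · rintro ⟨h4 | ⟨rfl, rfl⟩, h5⟩
        · exact ⟨h4, h5⟩
        · exact absurd h5 hp
  rintro σ₁ hf₁ ⟨h1, h2, h3⟩
  rw [hs] at h1 h2 h3
  have hb : ∀ u v : Fin n, Before n 0 u v := fun u v => .of_lt u.2
  simp only [hb, if_true, true_and] at h1 h2 h3
  have hs₁ : σ₁.nat SIZE 0 0 = n := by rw [hf₁.nat SIZE rfl, hs]
  refine wp_seq (wp_forLoop (fun k τ => (∀ l x, τ.nat MEM l x = if l < k ∧ x = l then 1 else 0) ∧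
      ∀ l, τ.nat CID l 0 = if l < k then l else 0) rfl rfl (by rw [hs₁]; exact hN)
      (fun _ _ _ hh => hh) ⟨fun l x => ?_, fun l => ?_⟩ ?_ ?_)
  · simp [hf₁.nat MEM rfl, hz]
  · simp [hf₁.nat CID rfl, hz]
  · rintro k τ hk hf hRU ⟨h4, h5⟩
    simp only [wp, NatExp.eval, hRU]
    refine ⟨fun l x => ?_, fun l => ?_⟩
    · by_cases hlk : l = k
      · subst hlk; by_cases hx : x = l <;> simp [Store.setNat, hRU, h4, hx]
      · simp [Store.setNat, hRU, h4, hlk, show l < k + 1 ↔ l < k by omega]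
    · by_cases hlk : l = k
      · subst hlk; simp [Store.setNat, hRU]
      · simp [Store.setNat, hRU, h5, hlk, show l < k + 1 ↔ l < k by omega]
  rintro σ₂ hf₂ ⟨h4, h5⟩
  rw [hs₁] at h4 h5
  have hs₂ : σ₂.nat SIZE 0 0 = n := by rw [hf₂.nat SIZE rfl, hs₁]
  have hLAB : σ₂.nat LAB = σ.nat LAB := (hf₂.nat LAB rfl).trans (hf₁.nat LAB rfl)
  have hOUT : σ₂.nat OUT = σ.nat OUT := (hf₂.nat OUT rfl).trans (hf₁.nat OUT rfl)
  have hADJ' : σ₂.nat ADJ = σ.nat ADJ := (hf₂.nat ADJ rfl).trans (hf₁.nat ADJ rfl)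
  have hACT : σ₂.nat ACT = σ₁.nat ACT := hf₂.nat ACT rfl
  have hCOST' : σ₂.num COST = σ.num COST := (hf₂.num COST rfl).trans (hf₁.num COST rfl)
  have hUNC : σ₂.num UNC = σ.num UNC := (hf₂.num UNC rfl).trans (hf₁.num UNC rfl)
  have hLOAD : σ₂.num LOAD = σ.num LOAD := (hf₂.num LOAD rfl).trans (hf₁.num LOAD rfl)
  have hHPEN : σ₂.num HPEN = σ₁.num HPEN := hf₂.num HPEN rfl
  have hPOT : σ₂.num POT = σ₁.num POT := hf₂.num POT rfl
  set τ := (σ₂.setNat CNT 0 0 n).setNat RND 0 0 (n + n) with hτ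
  have hτn : ∀ a, a ≠ CNT → a ≠ RND → τ.nat a = σ₂.nat a := fun a h1 h2 => by
    rw [hτ, setNat_nat_of_ne _ _ _ _ h2, setNat_nat_of_ne _ _ _ _ h1]
  have hcnt : τ.nat CNT 0 0 = n := by simp [hτ, Store.setNat]
  have hrnd : τ.nat RND 0 0 = n + n := by simp [hτ, Store.setNat]
  have hid : ∀ u : Fin n, (idSet τ u : Finset (Fin n)) = {u} := by
    intro u
    ext v
    rw [mem_idSet, hτn MEM (by simp) (by simp), h4, Finset.mem_singleton, ← Fin.val_inj]
    by_cases hvu : (v : ℕ) = u <;> simp [hvu]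
  have hid' : ∀ k (hk : k < n), (idSet τ k : Finset (Fin n)) = {⟨k, hk⟩} := fun k hk => hid ⟨k, hk⟩
  have hRep : Rep J τ (init J) := {
    input := {
      size := by rw [hτn _ (by simp) (by simp)]; exact hs₂
      adj := by rw [hτn _ (by simp) (by simp), hADJ']; exact hADJ
      cost := by
        intro u v huv
        change σ₂.num COST u v = _
        rw [hCOST']; exact hCOST u v huv
      hpen := by
        intro u v huv
        change σ₂.num HPEN u v = _
        rw [hHPEN, h1]; simp [w, huv]
      hpen_diag := by
        intro u
        change σ₂.num HPEN u u = _
        rw [hHPEN, h1]; simp [w] }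
    ids := {
      le_cnt := hcnt.ge
      mem_le := by
        intro k _ u
        rw [hτn MEM (by simp) (by simp), h4]; split_ifs <;> simp
      singleton := hid
      chain := by
        intro k l hkl hl v hk hlv
        rw [hcnt] at hl
        rw [hid' k (hkl.trans hl), Finset.mem_singleton] at hk
        rw [hid' l hl, Finset.mem_singleton, hk, Fin.mk.injEq] at hlv
        omega
      nonempty := by
        intro k hk
        rw [hcnt] at hk
        rw [hid' k hk]; exact Finset.singleton_nonempty _
      mem_formed := by
        intro k h1 h2
        omega
      exists_id := by
        intro T hT
        obtain ⟨i, u, -, rfl⟩ := mem_formed_init.1 hT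
        exact ⟨u, by rw [hcnt]; exact u.2, hid u⟩
      cid_lt := by
        intro u
        rw [hτn CID (by simp) (by simp), h5, if_pos u.2, hcnt]; exact u.2
      cid := by
        intro u v
        rw [hτn CID (by simp) (by simp), h5, if_pos u.2, hid, ← comp_init J u, mem_comp]
      out_le := by
        intro u v
        rw [hτn OUT (by simp) (by simp), hOUT, hz _ _ _ (by simp)]; simp
      out := by
        intro u v
        rw [hτn OUT (by simp) (by simp), hOUT, hz _ _ _ (by simp)]; simp [init] }
    act_le := by
      intro k hk
      rw [hcnt] at hk
      rw [hτn ACT (by simp) (by simp), hACT]; exact (h3 ⟨k, hk⟩).1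
    act := by
      intro k hk
      rw [hcnt] at hk
      rw [hτn ACT (by simp) (by simp), hACT, hid' k hk, active_init, mem_formed_init]
      refine (h3 ⟨k, hk⟩).2.trans ?_
      set u : Fin n := ⟨k, hk⟩
      have hpos : ∀ v, 0 < w u v ↔ pairOf u v ∈ pairs J := by
        intro v
        rw [pairOf_mem_pairs]
        by_cases huv : u = v <;> simp [w, huv]
      constructor
      · rintro ⟨v, hv⟩
        exact ⟨pairOf u v, u, pairOf_mem_terms ((hpos v).1 hv), rfl⟩
      · rintro ⟨i, x, hx, he⟩
        obtain rfl := Finset.singleton_inj.1 he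
        obtain ⟨hi, h | h⟩ := pairs_cases hx
        · refine ⟨i.2, (hpos _).2 ?_⟩
          rwa [h, pairOf_of_lt (mem_pairs.1 hi).1]
        · refine ⟨i.1, (hpos _).2 ?_⟩
          rwa [h, pairOf_comm, pairOf_of_lt (mem_pairs.1 hi).1]
    pot := by
      intro k hk
      rw [hcnt] at hk
      change σ₂.num POT k 0 = _
      rw [hPOT, hid' k hk, potential_init_eq_sum]
      exact h2 ⟨k, hk⟩
    unc := by
      intro k hk
      change σ₂.num UNC k 0 = 0
      rw [hUNC, hz' _ _ _ (by simp)]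
    load := by
      intro u v _
      change σ₂.num LOAD u v = _
      rw [hLOAD, hz' _ _ _ (by simp), load_init]
    lab := by
      intro u v _
      rw [hτn LAB (by simp) (by simp), hLAB, hz _ _ _ (by simp)]; rfl }
  have := hQ τ hRep hcnt hrnd
  have e : (σ₂.setNat CNT 0 0 n).nat SIZE 0 0 = n := by
    rw [setNat_nat_of_ne _ _ _ _ (by simp), hs₂]
  simp only [wp, NatExp.eval, hs₂, e]
  exact this

end RAM

/-! ### The deletion phase -/

namespace RAM

open PrimalDual

variable {n : ℕ}

/-- The edges of `F` that are inspected before the pair `(i, j)`. -/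
def edgesBefore (F : SimpleGraph (Fin n)) (i j : ℕ) : SimpleGraph (Fin n) where
  Adj u v := F.Adj u v ∧ (Before i j u v ∨ Before i j v u)
  symm := ⟨fun _ _ h => ⟨h.1.symm, h.2.symm⟩⟩
  loopless := ⟨fun _ h => h.1.ne rfl⟩

theorem edgesBefore_succ {F : SimpleGraph (Fin n)} {a b : Fin n} (h : F.Adj a b) :
    edgesBefore F a (b + 1) = edgesBefore F a b ⊔ SimpleGraph.edge a b := by
  ext u v
  rw [SimpleGraph.sup_adj, SimpleGraph.edge_adj]
  simp only [edgesBefore, before_succ, Fin.val_inj]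
  constructor
  · rintro ⟨h1, (h2 | ⟨rfl, rfl⟩) | (h2 | ⟨rfl, rfl⟩)⟩
    · exact Or.inl ⟨h1, Or.inl h2⟩
    · exact Or.inr ⟨Or.inl ⟨rfl, rfl⟩, h1.ne⟩
    · exact Or.inl ⟨h1, Or.inr h2⟩
    · exact Or.inr ⟨Or.inr ⟨rfl, rfl⟩, h1.ne⟩
  · rintro (⟨h1, h2⟩ | ⟨⟨rfl, rfl⟩ | ⟨rfl, rfl⟩, h1⟩)
    · exact ⟨h1, h2.imp Or.inl Or.inl⟩
    · exact ⟨h, Or.inl (Or.inr ⟨rfl, rfl⟩)⟩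
    · exact ⟨h.symm, Or.inr (Or.inr ⟨rfl, rfl⟩)⟩

theorem edgesBefore_succ_of_not_adj {F : SimpleGraph (Fin n)} {a b : Fin n} (h : ¬ F.Adj a b) :
    edgesBefore F a (b + 1) = edgesBefore F a b := by
  ext u v
  simp only [edgesBefore, before_succ, Fin.val_inj]
  refine and_congr_right fun huv => ?_
  constructor
  · rintro ((h2 | ⟨rfl, rfl⟩) | (h2 | ⟨rfl, rfl⟩))
    · exact Or.inl h2
    · exact absurd huv h
    · exact Or.inr h2
    · exact absurd huv.symm h
  · exact fun h2 => h2.imp Or.inl Or.inl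

/-- The labels computed by `components` are equal exactly on the connected components. -/
theorem wp_components {N : ℕ} {σ : Store} {F : SimpleGraph (Fin n)} {Q : Store → Prop}
    (hs : σ.nat SIZE 0 0 = n) (hN : n ≤ N)
    (hout : ∀ u v : Fin n, 1 ≤ σ.nat OUT u v ↔ F.Adj u v)
    (hQ : ∀ τ, Frame components σ τ →
      (∀ u v : Fin n, τ.nat LBL u 0 = τ.nat LBL v 0 ↔ F.Reachable u v) → Q τ) :
    wp N components Q σ := by
  suffices wp N components
      (fun τ => ∀ u v : Fin n, τ.nat LBL u 0 = τ.nat LBL v 0 ↔ F.Reachable u v) σ from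
    wp_call this fun τ h1 h2 => hQ τ h2 h1
  refine wp_seq (wp_forLoop (fun k τ => ∀ l < k, τ.nat LBL l 0 = l) rfl rfl (by rwa [hs])
    (fun _ _ _ hh => hh) (by simp) ?_ ?_)
  · intro k τ _ _ hRX hI l hl
    rcases Nat.lt_succ_iff_lt_or_eq.1 hl with hl | rfl
    · simp [Store.setNat, NatExp.eval, hRX, hl.ne, hI l hl]
    · simp [Store.setNat, NatExp.eval, hRX]
  intro σ₁ hf₁ hI₁
  rw [hs] at hI₁
  have hs₁ : σ₁.nat SIZE 0 0 = n := by rw [hf₁.nat SIZE rfl, hs]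
  refine wp_forPairs (fun i j τ => ∀ u v : Fin n, τ.nat LBL u 0 = τ.nat LBL v 0 ↔
      (edgesBefore F i j).Reachable u v) (by simp) (by simp) (by simp) rfl rfl rfl
    (by rwa [hs₁]) (fun _ _ _ _ hh => ⟨hh, hh⟩) ?_ ?_ ?_ ?_
  · intro u v
    have : edgesBefore F 0 0 = ⊥ := by
      ext x y; simp [edgesBefore, not_before_zero]
    rw [this, SimpleGraph.reachable_bot, hI₁ _ u.2, hI₁ _ v.2, Fin.val_inj]
  · intro i τ _ hI
    rw [hs₁] at hI
    have : edgesBefore F (i + 1) 0 = edgesBefore F i n := by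
      ext x y; simp only [edgesBefore, before_row x.2, before_row y.2]
    rw [this]; exact hI
  · intro i j τ hi hj hf hRX hRY hI
    rw [hs₁] at hi hj
    set a : Fin n := ⟨i, hi⟩ with ha
    set b : Fin n := ⟨j, hj⟩ with hb
    have hRX : τ.nat RX 0 0 = a := hRX
    have hRY : τ.nat RY 0 0 = b := hRY
    have hg : Test.Holds τ (isPos (.cell OUT (reg RX) (reg RY))) ↔ F.Adj a b := by
      simp only [Test.Holds, NatExp.eval, hRX, hRY, hf.nat OUT rfl, hf₁.nat OUT rfl, hout]
    refine ⟨fun h => ?_, fun h => ?_⟩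
    · rw [hg] at h
      have hG : edgesBefore F i (j + 1) = edgesBefore F i j ⊔ SimpleGraph.edge a b :=
        edgesBefore_succ h
      rw [hG]
      refine wp_forLoop (fun k ρ => ∀ l, ρ.nat LBL l 0 =
          if l < k ∧ τ.nat LBL l 0 = τ.nat LBL a 0 then τ.nat LBL b 0 else τ.nat LBL l 0)
        rfl rfl ?_ (fun _ _ _ hh => hh) ?_ ?_ ?_
      · simpa [Store.setNat, hf.nat SIZE rfl, hs₁] using hN
      · intro l; simp [Store.setNat]
      · intro k ρ _ hfρ hRZ hk
        have hLA : ρ.nat LA 0 0 = τ.nat LBL a 0 := by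
          rw [hfρ.nat LA rfl]; simp [Store.setNat, NatExp.eval, hRX]
        have hLB : ρ.nat LB 0 0 = τ.nat LBL b 0 := by
          rw [hfρ.nat LB rfl]; simp [Store.setNat, NatExp.eval, hRY]
        have hkk := hk k
        simp only [lt_irrefl, false_and, if_false] at hkk
        refine ⟨fun h1 l => ?_, fun h1 l => ?_⟩
        · simp only [Test.Holds, NatExp.eval, hRZ, hLA, ← le_antisymm_iff, hkk] at h1
          by_cases hlk : l = k
          · subst hlk; simp [Store.setNat, NatExp.eval, hRZ, hLB, h1]
          · simp [Store.setNat, NatExp.eval, hRZ, hlk, hk l, show l < k + 1 ↔ l < k by omega]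
        · simp only [Test.Holds, NatExp.eval, hRZ, hLA, ← le_antisymm_iff, hkk] at h1
          by_cases hlk : l = k
          · subst hlk; simp [hkk, h1]
          · simp [hk l, show l < k + 1 ↔ l < k by omega]
      · intro ρ _ hρ u v
        have hρ' : ∀ x : Fin n, ρ.nat LBL x 0 =
            if τ.nat LBL x 0 = τ.nat LBL a 0 then τ.nat LBL b 0 else τ.nat LBL x 0 := by
          intro x
          rw [hρ x]
          simp [Store.setNat, hf.nat SIZE rfl, hs₁]
        rw [reachable_sup_edge_iff, ← hI, ← hI, ← hI, ← hI, ← hI, hρ', hρ']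
        split_ifs <;> omega
    · rw [hg] at h
      have hG : edgesBefore F i (j + 1) = edgesBefore F i j := edgesBefore_succ_of_not_adj h
      rw [hG]; exact hI
  · intro τ _ hI u v
    rw [hs₁] at hI
    rw [hI]
    have : edgesBefore F n 0 = F := by
      ext x y
      simp [edgesBefore, Before]
    rw [this]

/-- The store holds the instance `J`, the labels of the terminals, and the forest `F`. -/
structure RepForest (J : PCSF n) (st : State n) (F : SimpleGraph (Fin n)) (σ : Store) : Prop where
  input : RepInput J σ
  lab : ∀ u v : Fin n, u ≠ v → σ.nat LAB u v = enc (st.status (pairOf u v) u)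
  out : σ.Represents F

theorem RepForest.congr {J : PCSF n} {st : State n} {F : SimpleGraph (Fin n)} {σ τ : Store}
    (h : RepForest J st F σ) (hn : ∀ a, a ≤ 2 ∨ a = LAB → τ.nat a = σ.nat a)
    (hm : ∀ a, a = COST ∨ a = HPEN → τ.num a = σ.num a) : RepForest J st F τ where
  input := h.input.congr (fun a ha => hn a (by omega)) hm
  lab := by rw [hn LAB (by simp)]; exact h.lab
  out := by
    unfold Store.Represents
    rw [hn 2 (by simp)]; exact h.out

theorem Represents.one_le_iff {σ : Store} {F : SimpleGraph (Fin n)} (h : σ.Represents F)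
    (u v : Fin n) : 1 ≤ σ.nat OUT u v ↔ F.Adj u v := by
  by_cases huv : F.Adj u v
  · simp [huv, (h u v).1 huv]
  · simp [huv, (h u v).2 huv]

theorem RepForest.of_frame {J : PCSF n} {st : State n} {F : SimpleGraph (Fin n)} {σ τ : Store}
    {P : Program} (h : RepForest J st F σ) (hf : Frame P σ τ)
    (h1 : ∀ a < 7, P.writesNat a = false) (h2 : ∀ a < 7, P.writesNum a = false) :
    RepForest J st F τ :=
  h.congr (fun a ha => hf.nat a (h1 a (by omega))) fun a ha => hf.num a (h2 a (by omega))

theorem wp_checkSatisfied {N : ℕ} {J : PCSF n} {st : State n} {F : SimpleGraph (Fin n)} {σ : Store}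
    {Q : Store → Prop} (h : RepForest J st F σ) (hN : n ≤ N)
    (hlbl : ∀ u v : Fin n, σ.nat LBL u 0 = σ.nat LBL v 0 ↔ F.Reachable u v)
    (hQ : ∀ τ, Frame checkSatisfied σ τ →
      (1 ≤ τ.nat FLAG 0 0 ↔ ¬ KeepsSatisfied J st F) → Q τ) :
    wp N checkSatisfied Q σ := by
  let bad : Fin n → Fin n → Prop := fun u v => (u, v) ∈ pairs J ∧
    st.status (u, v) u = Status.satisfied ∧ st.status (u, v) v = Status.satisfied ∧
    ¬ F.Reachable u v
  suffices wp N checkSatisfied (fun τ => 1 ≤ τ.nat FLAG 0 0 ↔ ∃ u v, bad u v) σ by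
    refine wp_call this fun τ h1 h2 => hQ τ h2 (h1.trans ?_)
    simp only [KeepsSatisfied, not_forall, bad]
    constructor
    · rintro ⟨u, v, h3, h4, h5, h6⟩; exact ⟨(u, v), h3, h4, h5, h6⟩
    · rintro ⟨i, h3, h4, h5, h6⟩; exact ⟨i.1, i.2, h3, h4, h5, h6⟩
  have hσ₁ : RepForest J st F (σ.setNat FLAG 0 0 0) :=
    h.congr (fun a ha => setNat_nat_of_ne _ _ _ _ (by omega)) fun _ _ => rfl
  have hs₁ := hσ₁.input.size
  refine wp_forPairs (fun i j τ => 1 ≤ τ.nat FLAG 0 0 ↔ ∃ u v : Fin n, Before i j u v ∧ bad u v)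
    (by simp) (by simp) (by simp) rfl rfl rfl (hs₁.le.trans hN) (fun _ _ _ _ hh => ⟨hh, hh⟩)
    ?_ ?_ ?_ ?_
  · simp [not_before_zero, Store.setNat, NatExp.eval]
  · intro i τ _ hI
    refine hI.trans (exists_congr fun u => exists_congr fun v => ?_)
    change Before i ((σ.setNat FLAG 0 0 0).nat SIZE 0 0) u v ∧ _ ↔ _
    rw [hs₁, before_row v.2]
  · intro i j τ hi hj hf hRX hRY hI
    have hi : i < n := hs₁ ▸ hi
    have hj : j < n := hs₁ ▸ hj
    set a : Fin n := ⟨i, hi⟩ with ha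
    set b : Fin n := ⟨j, hj⟩ with hb
    have hRX : τ.nat RX 0 0 = a := hRX
    have hRY : τ.nat RY 0 0 = b := hRY
    have hR : RepForest J st F τ := hσ₁.of_frame hf (by decide) (by decide)
    have hL : ∀ u v : Fin n, τ.nat LBL u 0 = τ.nat LBL v 0 ↔ F.Reachable u v := by
      rw [hf.nat LBL rfl]; exact hlbl
    have hg : Test.Holds τ (.both (natLt (reg RX) (reg RY))
        (.both (numPos (.cell HPEN (reg RX) (reg RY)))
        (.both (natEq (.cell LAB (reg RX) (reg RY)) (.const 1))
        (.both (natEq (.cell LAB (reg RY) (reg RX)) (.const 1))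
        (.neg (natEq (entry LBL (reg RX)) (entry LBL (reg RY)))))))) ↔ bad a b := by
      have hlt : (a : ℕ) + 1 ≤ b ↔ a < b := Iff.rfl
      simp only [Test.Holds, NatExp.eval, NumExp.eval, hRX, hRY, ← le_antisymm_iff, hlt,
        Nat.cast_zero, not_le, hR.input.hpen_pos, hL, bad]
      by_cases hab : a < b
      · simp only [hab, true_and]
        rw [hR.lab a b hab.ne, hR.lab b a hab.ne', pairOf_comm b a, pairOf_of_lt hab, enc_eq_one,
          enc_eq_one]
      · simp [hab, mem_pairs]
    have hex : (∃ u v : Fin n, Before i (j + 1) u v ∧ bad u v) ↔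
        (∃ u v : Fin n, Before i j u v ∧ bad u v) ∨ bad a b := by
      constructor
      · rintro ⟨u, v, h1, h2⟩
        rcases before_succ.1 h1 with h1 | ⟨h3, h4⟩
        · exact Or.inl ⟨u, v, h1, h2⟩
        · obtain rfl : u = a := Fin.ext h3
          obtain rfl : v = b := Fin.ext h4
          exact Or.inr h2
      · rintro (⟨u, v, h1, h2⟩ | h2)
        · exact ⟨u, v, before_succ.2 (Or.inl h1), h2⟩
        · exact ⟨a, b, before_succ.2 (Or.inr ⟨rfl, rfl⟩), h2⟩
    rw [hex]
    refine ⟨fun h1 => ?_, fun h1 => ?_⟩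
    · rw [hg] at h1
      simp [wp, Store.setNat, NatExp.eval, h1]
    · rw [hg] at h1
      simp only [h1, or_false]; exact hI
  · intro τ _ hI
    refine hI.trans (exists_congr fun u => exists_congr fun v => ?_)
    change Before ((σ.setNat FLAG 0 0 0).nat SIZE 0 0) 0 u v ∧ _ ↔ _
    rw [hs₁]
    exact ⟨fun hh => hh.2, fun hh => ⟨.of_lt u.2, hh⟩⟩

open Classical in
theorem prune_edgeSet_of_notMem (J : PCSF n) (st : State n) {e : Sym2 (Fin n)}
    (L : List (Sym2 (Fin n))) (he : e ∉ L) :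
    e ∈ (prune J st L).edgeSet ↔ e ∈ st.forest.edgeSet := by
  unfold prune
  generalize st.forest = F
  induction L generalizing F with
  | nil => rfl
  | cons x L ih =>
    rw [List.mem_cons, not_or] at he
    rw [List.foldl_cons, ih he.2]
    split_ifs
    · simp [SimpleGraph.edgeSet_deleteEdges, he.1]
    · rfl

open Classical in
theorem prune_concat (J : PCSF n) (st : State n) (L : List (Sym2 (Fin n))) (e : Sym2 (Fin n)) :
    prune J st (L ++ [e]) = if KeepsSatisfied J st ((prune J st L).deleteEdges {e})
      then (prune J st L).deleteEdges {e} else prune J st L := by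
  unfold prune
  rw [List.foldl_append]
  rfl

/-- The order in which the program inspects the edges is one of the admissible orders of the
deletion phase. -/
theorem wp_pruneAll {N : ℕ} {J : PCSF n} {st : State n} {σ : Store} {Q : Store → Prop}
    (h : RepForest J st st.forest σ) (hN : n ≤ N)
    (hQ : ∀ τ (L : List (Sym2 (Fin n))), L.Nodup → (∀ e, e ∈ L ↔ e ∈ st.forest.edgeSet) →
      τ.Represents (prune J st L) → Q τ) : wp N pruneAll Q σ := by
  classical
  have hs := h.input.size
  refine wp_forPairs (fun i j τ => ∃ L : List (Sym2 (Fin n)), L.Nodup ∧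
      (∀ e, e ∈ L ↔ ∃ u v : Fin n, e = s(u, v) ∧ u < v ∧ st.forest.Adj u v ∧ Before i j u v) ∧
      RepForest J st (prune J st L) τ)
    (by simp) (by simp) (by simp) rfl rfl rfl (hs.le.trans hN) ?_ ⟨[], List.nodup_nil, ?_, h⟩
    ?_ ?_ ?_
  · rintro i j τ x ⟨L, h1, h2, h3⟩
    have : ∀ a, 8 ≤ a → RepForest J st (prune J st L) (τ.setNat a 0 0 x) := fun a ha =>
      h3.congr (fun b hb => setNat_nat_of_ne _ _ _ _ (by omega)) fun _ _ => rfl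
    exact ⟨⟨L, h1, h2, this _ (by simp)⟩, ⟨L, h1, h2, this _ (by simp)⟩⟩
  · simp [not_before_zero]
  · rintro i τ - ⟨L, h1, h2, h3⟩
    rw [hs] at h2
    refine ⟨L, h1, fun e => ?_, h3⟩
    rw [h2]
    exact exists_congr fun u => exists_congr fun v => by rw [before_row v.2]
  · rintro i j τ hi hj hf hRU hRV ⟨L, hL, hLm, hR⟩
    rw [hs] at hi hj
    set a : Fin n := ⟨i, hi⟩ with ha
    set b : Fin n := ⟨j, hj⟩ with hb
    have hRU : τ.nat RU 0 0 = a := hRU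
    have hRV : τ.nat RV 0 0 = b := hRV
    set F := prune J st L with hF
    have hg : Test.Holds τ (.both (natLt (reg RU) (reg RV)) (isPos (.cell OUT (reg RU) (reg RV)))) ↔
        a < b ∧ F.Adj a b := by
      have hlt : (a : ℕ) + 1 ≤ b ↔ a < b := Iff.rfl
      simp only [Test.Holds, NatExp.eval, hRU, hRV, hlt]
      rw [Represents.one_le_iff hR.out]
    have hnb : ∀ u v : Fin n, u < v → s(u, v) = s(a, b) → a < b → u = a ∧ v = b := by
      intro u v huv he hab
      rcases Sym2.eq_iff.1 he with h1 | ⟨rfl, rfl⟩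
      · exact h1
      · exact absurd huv hab.not_gt
    have hnotin : a < b → s(a, b) ∉ L := by
      intro hab hmem
      obtain ⟨u, v, h1, h2, -, h3⟩ := (hLm _).1 hmem
      obtain ⟨rfl, rfl⟩ := hnb u v h2 h1.symm hab
      simp [Before, a, b] at h3
    have hadj : a < b → (F.Adj a b ↔ st.forest.Adj a b) := fun hab =>
      prune_edgeSet_of_notMem J st L (hnotin hab)
    refine ⟨fun hh => ?_, fun hh => ?_⟩
    · rw [hg] at hh
      obtain ⟨hab, hFab⟩ := hh
      have hout : ∀ (ρ : Store) (G : SimpleGraph (Fin n)) (x : ℕ), RepForest J st G ρ →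
          ρ.nat RU 0 0 = a → ρ.nat RV 0 0 = b → ∀ H : SimpleGraph (Fin n),
          (∀ u v, s(u, v) ≠ s(a, b) → (H.Adj u v ↔ G.Adj u v)) →
          (H.Adj a b → x = 1) → (¬ H.Adj a b → x = 0) → ∀ R : Store → Prop,
          (∀ π, Frame (setEdge x) ρ π → RepForest J st H π → R π) → wp N (setEdge x) R ρ := by
        intro ρ G x hG hρa hρb H hGH hx1 hx0 R hRR
        suffices wp N (setEdge x) (RepForest J st H) ρ from
          wp_call this fun π h1 h2 => hRR π h2 h1
        have e1 : ((ρ.setNat OUT a b x)).nat RU 0 0 = a := by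
          rw [setNat_nat_of_ne _ _ _ _ (by simp), hρa]
        have e2 : ((ρ.setNat OUT a b x)).nat RV 0 0 = b := by
          rw [setNat_nat_of_ne _ _ _ _ (by simp), hρb]
        simp only [setEdge, wp, NatExp.eval, hρa, hρb, e1, e2]
        have hne : ∀ c, c ≠ OUT → ((ρ.setNat OUT a b x).setNat OUT b a x).nat c = ρ.nat c :=
          fun c hc => by rw [setNat_nat_of_ne _ _ _ _ hc, setNat_nat_of_ne _ _ _ _ hc]
        refine ⟨hG.input.congr (fun c hc => hne c (by omega)) fun _ _ => rfl, ?_, fun u v => ?_⟩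
        · rw [hne LAB (by simp)]; exact hG.lab
        · have hval : ((ρ.setNat OUT a b x).setNat OUT b a x).nat OUT u v =
              if s(u, v) = s(a, b) then x else ρ.nat OUT u v := by
            simp only [Store.setNat, true_and, Fin.val_inj, Sym2.eq_iff]
            by_cases q1 : u = a ∧ v = b <;> by_cases q2 : u = b ∧ v = a <;> simp [q1, q2]
          rw [hval]
          by_cases he : s(u, v) = s(a, b)
          · rw [if_pos he]
            have : H.Adj u v ↔ H.Adj a b := by
              rw [← SimpleGraph.mem_edgeSet, he, SimpleGraph.mem_edgeSet]
            rw [this]; exact ⟨hx1, hx0⟩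
          · rw [if_neg he, hGH u v he]; exact hG.out u v
      have hdel : ∀ u v, s(u, v) ≠ s(a, b) →
          ((F.deleteEdges {s(a, b)}).Adj u v ↔ F.Adj u v) := by
        intro u v huv
        simp only [SimpleGraph.deleteEdges_adj, Set.mem_singleton_iff, huv, not_false_eq_true,
          and_true]
      have hdel' : ¬ (F.deleteEdges {s(a, b)}).Adj a b := by simp
      refine wp_seq (hout τ F 0 hR hRU hRV (F.deleteEdges {s(a, b)}) hdel
        (fun hh => absurd hh hdel') (fun _ => rfl) _ fun ρ₁ hf₁ h₁ => ?_)
      refine wp_seq (wp_components h₁.input.size hN (Represents.one_le_iff h₁.out)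
        fun ρ₂ hf₂ hlbl => ?_)
      have h₂ := h₁.of_frame hf₂ (by decide) (by decide)
      refine wp_seq (wp_checkSatisfied h₂ hN hlbl fun ρ₃ hf₃ hflag => ?_)
      have h₃ := h₂.of_frame hf₃ (by decide) (by decide)
      have hmem : ∀ e, e ∈ L ++ [s(a, b)] ↔ ∃ u v : Fin n, e = s(u, v) ∧ u < v ∧
          st.forest.Adj u v ∧ Before i (j + 1) u v := by
        intro e
        rw [List.mem_append, hLm, List.mem_singleton]
        constructor
        · rintro (⟨u, v, h1, h2, h3, h4⟩ | rfl)
          · exact ⟨u, v, h1, h2, h3, before_succ.2 (Or.inl h4)⟩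
          · exact ⟨a, b, rfl, hab, (hadj hab).1 hFab, before_succ.2 (Or.inr ⟨rfl, rfl⟩)⟩
        · rintro ⟨u, v, h1, h2, h3, h4⟩
          rcases before_succ.1 h4 with h4 | ⟨h5, h6⟩
          · exact Or.inl ⟨u, v, h1, h2, h3, h4⟩
          · obtain rfl : u = a := Fin.ext h5
            obtain rfl : v = b := Fin.ext h6
            exact Or.inr h1
      have hnd : (L ++ [s(a, b)]).Nodup := List.nodup_append.2 ⟨hL, by simp, by
        intro x hx y hy he
        rw [List.mem_singleton] at hy
        subst he; subst hy; exact hnotin hab hx⟩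
      have r1 : ρ₃.nat RU 0 0 = a := by
        rw [hf₃.nat RU rfl, hf₂.nat RU rfl, hf₁.nat RU rfl, hRU]
      have r2 : ρ₃.nat RV 0 0 = b := by
        rw [hf₃.nat RV rfl, hf₂.nat RV rfl, hf₁.nat RV rfl, hRV]
      refine ⟨fun hfl => ?_, fun hfl => ?_⟩
      · simp only [Test.Holds, NatExp.eval] at hfl
        refine hout ρ₃ _ 1 h₃ r1 r2 F (fun u v huv => (hdel u v huv).symm) (fun _ => rfl)
          (fun hh => absurd hFab hh) _ fun π _ hπ => ⟨L ++ [s(a, b)], hnd, hmem, ?_⟩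
        rw [prune_concat, if_neg (hflag.1 hfl)]
        exact hπ
      · simp only [Test.Holds, NatExp.eval] at hfl
        refine ⟨L ++ [s(a, b)], hnd, hmem, ?_⟩
        rw [prune_concat, if_pos (not_not.1 (mt hflag.2 hfl))]
        exact h₃
    · rw [hg] at hh
      refine ⟨L, hL, fun e => (hLm e).trans ⟨?_, ?_⟩, hR⟩
      · rintro ⟨u, v, h1, h2, h3, h4⟩
        exact ⟨u, v, h1, h2, h3, before_succ.2 (Or.inl h4)⟩
      · rintro ⟨u, v, h1, h2, h3, h4⟩
        rcases before_succ.1 h4 with h4 | ⟨h5, h6⟩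
        · exact ⟨u, v, h1, h2, h3, h4⟩
        · obtain rfl : u = a := Fin.ext h5
          obtain rfl : v = b := Fin.ext h6
          exact absurd ⟨h2, (hadj h2).2 h3⟩ hh
  · rintro τ - ⟨L, h1, h2, h3⟩
    rw [hs] at h2
    refine hQ τ L h1 (fun e => ?_) h3.out
    rw [h2]
    induction e with | _ x y
    constructor
    · rintro ⟨u, v, h4, -, h5, -⟩; rw [h4]; exact h5
    · intro hxy
      rcases lt_or_gt_of_ne (SimpleGraph.Adj.ne hxy) with hlt | hlt
      · exact ⟨x, y, rfl, hlt, hxy, .of_lt x.2⟩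
      · exact ⟨y, x, Sym2.eq_swap, hlt, SimpleGraph.Adj.symm hxy, .of_lt y.2⟩

end RAM

/-! ### The size of the input -/

theorem Polynomial.eval_le_eval_of_le (p : Polynomial ℕ) {a b : ℕ} (h : a ≤ b) :
    p.eval a ≤ p.eval b := by
  rw [Polynomial.eval_eq_sum_range, Polynomial.eval_eq_sum_range]
  exact Finset.sum_le_sum fun i _ => Nat.mul_le_mul_left _ (Nat.pow_le_pow_left h i)

namespace RAM

variable {n : ℕ}

/-- A rational input fits a number of linearly many bits. -/
theorem exists_storeFits_input (I : PCSF n) {ε : ℝ} (hε : 0 < ε) (h : I.IsRational ε) :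
    ∃ Q K p q : ℕ, Growth ε K p q ∧ 2 ≤ Q ∧ StoreFits ε Q (I.input ε) ∧
      Nat.size Q ≤ I.inputBits ε + 3 ∧ Nat.size K ≤ I.inputBits ε + 2 := by
  obtain ⟨⟨r, rfl⟩, hcp⟩ := h
  choose c hc using fun u v => (hcp u v).1
  choose d hd using fun u v => (hcp u v).2
  have hr : 0 < r := by exact_mod_cast hε
  have hnum : 0 < r.num := Rat.num_pos.2 hr
  set B := I.inputBits (r : ℝ) with hB
  let A : ℕ := ∏ x : Fin n × Fin n, ratScale (c x.1 x.2) * ratScale (d x.1 x.2)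
  have hfac : ∀ x : Fin n × Fin n, 0 < ratScale (c x.1 x.2) * ratScale (d x.1 x.2) :=
    fun x => Nat.mul_pos (ratScale_pos _) (ratScale_pos _)
  have hA : 0 < A := Finset.prod_pos fun x _ => hfac x
  set Q : ℕ := (n + 2) * (ratScale r * A) with hQ
  have hRA : 0 < ratScale r * A := Nat.mul_pos (ratScale_pos r) hA
  have hQn : n + 2 ≤ Q := Nat.le_mul_of_pos_right _ hRA
  have hQ0 : 0 < Q := by omega
  have hAB : Nat.size A ≤ ∑ u, ∑ v,
      (1 + realBits (I.costEntry u v) + realBits (I.penaltyEntry u v)) + 1 := by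
    refine (size_prod_le _ _).trans (Nat.add_le_add_right ?_ 1)
    rw [Fintype.sum_prod_type]
    refine Finset.sum_le_sum fun u _ => Finset.sum_le_sum fun v _ => ?_
    have h1 := size_mul_le (ratScale (c u v)) (ratScale (d u v))
    have h2 := size_ratScale_le (c u v)
    have h3 := size_ratScale_le (d u v)
    rw [← hc, ← hd, realBits_ratCast, realBits_ratCast]
    dsimp only
    omega
  have hBeq : B = n + ratBits r + ∑ u, ∑ v,
      (1 + realBits (I.costEntry u v) + realBits (I.penaltyEntry u v)) := by
    rw [hB, PCSF.inputBits, realBits_ratCast]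
  refine ⟨Q, 2 * r.num.natAbs * r.den, r.num.natAbs, r.den,
    ⟨Int.natAbs_pos.2 hnum.ne', r.den_pos, ?_, rfl⟩, by omega, ⟨rfl, fun a i j => ?_, fun a i j => ?_⟩,
    ?_, ?_⟩
  · have h1 : ((r.num.natAbs : ℕ) : ℝ) = (r.num : ℝ) := by
      rw [Nat.cast_natAbs, abs_of_pos hnum]
    rw [h1]
    exact_mod_cast (Rat.num_div_den r).symm
  · simp only [PCSF.input]
    split_ifs <;> omega
  · simp only [PCSF.input]
    have hdvd : ∀ u v, ratScale (c u v) * ratScale (d u v) ∣ Q := fun u v =>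
      (Finset.dvd_prod_of_mem (fun x : Fin n × Fin n => ratScale (c x.1 x.2) * ratScale (d x.1 x.2))
        (Finset.mem_univ (u, v))).trans ((Dvd.intro_left _ rfl).trans (Dvd.intro_left _ rfl))
    split_ifs
    · exact (fits_ratScale r).mono ((Dvd.intro _ rfl).trans (Dvd.intro_left _ rfl)) hQ0
    · rw [← hc]
      exact (fits_ratScale _).mono ((Dvd.intro _ rfl).trans (hdvd _ _)) hQ0
    · rw [← hd]
      exact (fits_ratScale _).mono ((Dvd.intro_left _ rfl).trans (hdvd _ _)) hQ0
    · exact ⟨⟨0, by simp⟩, by simp⟩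
  · have h1 := size_mul_le (n + 2) (ratScale r * A)
    have h2 := size_mul_le (ratScale r) A
    have h3 := size_ratScale_le r
    have h4 : Nat.size (n + 2) ≤ n + 2 := Nat.size_le.2 Nat.lt_two_pow_self
    rw [hQ]
    omega
  · have h1 := size_mul_le (2 * r.num.natAbs) r.den
    have h2 := size_mul_le 2 r.num.natAbs
    have h3 : Nat.size 2 = 2 := by decide
    have h4 : ratBits r = Nat.size r.num.natAbs + Nat.size r.den + 1 := rfl
    omega

/-- A program without divisions other than those by `ε` that halts in polynomial time has polynomial
logarithmic cost. -/
theorem Exec.bits_le_eval {P : Program} (hP : P.Small) {I : PCSF n} {ε : ℝ} (hε : 0 < ε)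
    (h : I.IsRational ε) {t b : ℕ} {τ : Store} (hex : Exec P (I.input ε) t b τ)
    {p : Polynomial ℕ} (ht : t ≤ p.eval n) :
    b ≤ (p * (3 * (.X + 3 + (p * (.X + 2) + 1)) + 2)).eval (I.inputBits ε) := by
  obtain ⟨Q, K, a, c, hG, hQ2, hσ, hsQ, hsK⟩ := exists_storeFits_input I hε h
  have h0 : level Q K 0 = Q := by simp [level]
  have hb := (hex.bits_le hG hQ2 0 hP (by rwa [h0])).2
  rw [zero_add] at hb
  set B := I.inputBits ε with hB
  have hnB : n ≤ B := by rw [hB, PCSF.inputBits]; omega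
  have htB : t ≤ p.eval B := ht.trans (p.eval_le_eval_of_le hnB)
  have hw := width_le Q K t
  have htK : t * Nat.size K ≤ p.eval B * (B + 2) := Nat.mul_le_mul htB hsK
  refine hb.trans ?_
  have e : (p * (3 * (.X + 3 + (p * (.X + 2) + 1)) + 2)).eval B =
      p.eval B * (3 * (B + 3 + (p.eval B * (B + 2) + 1)) + 2) := by
    simp
  rw [e]
  exact Nat.mul_le_mul htB (by omega)

/-- The program computes an output of Primal-Dual Forest. -/
theorem wp_primalDualForest (I : PCSF n) {ε : ℝ} (hε : 0 < ε) :
    wp (3 * n) primalDualForest (fun τ => ∃ F : SimpleGraph (Fin n), τ.Represents F ∧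
      PrimalDual.Output (I.scale (2 / ε) (div_nonneg zero_le_two hε.le)) F) (I.input ε) := by
  refine wp_seq (wp_setup I hε (by omega) fun σ hσ hcnt hrnd => ?_)
  refine wp_seq (wp_mainLoop hσ hcnt hrnd le_rfl fun τ st hst hact hτ => ?_)
  refine wp_pruneAll (J := I.scale (2 / ε) (div_nonneg zero_le_two hε.le)) (st := st)
    ⟨hτ.input, hτ.lab, fun u v => ?_⟩ (by omega) fun ρ L hL hLm hρ =>
      ⟨_, hρ, st, hst, hact, L, hL, hLm, rfl⟩
  have h1 := hτ.ids.out_le u v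
  have h2 := hτ.ids.out u v
  refine ⟨fun huv => ?_, fun huv => ?_⟩
  · have := h2.2 huv; omega
  · have := mt h2.1 huv; omega

end RAM

theorem theorem4 :
    ∃ (C : ℝ) (prog : RAM.Program) (p q : Polynomial ℕ),
      ∀ (n : ℕ) (I : PCSF n) (ε : ℝ) (hε : 0 < ε), ε ≤ 1 →
        ∃ (F : SimpleGraph (Fin n)) (t b : ℕ) (σ : RAM.Store),
          -- the program halts with output `F`, in polynomial time
          RAM.Exec prog (I.input ε) t b σ ∧ σ.Represents F ∧
          t ≤ p.eval n ∧
          (I.IsRational ε → b ≤ q.eval (I.inputBits ε)) ∧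
          -- it runs the primal-dual algorithm with scaled penalties
          PrimalDual.Output (I.scale (2 / ε) (div_nonneg zero_le_two hε.le)) F ∧
          -- `F` is a forest of cost `O(1/ε) OPT`
          I.IsForest F ∧
          I.totalCost F ≤ C / ε * I.opt ∧
          -- a near-optimal solution connects only pairs connected by `F`
          ∃ (F' : SimpleGraph (Fin n)) (P : Finset (Sym2 (Fin n))),
            I.IsPayingSolution F' P ∧
            I.payingCost F' P ≤ (1 + ε) * I.opt ∧
            ∀ pr, pr ∉ P → Joins F pr := by
  obtain ⟨p, hp⟩ := RAM.exists_polynomial_timeBound RAM.primalDualForest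
  set r : Polynomial ℕ := p.comp (3 * .X) with hr
  refine ⟨8, RAM.primalDualForest, r, r * (3 * (.X + 3 + (r * (.X + 2) + 1)) + 2), fun n I ε hε hε1 => ?_⟩
  obtain ⟨t, b, σ, hex, ht, F, hF, hout⟩ := RAM.wp_sound (RAM.wp_primalDualForest I hε)
  have ht' : t ≤ r.eval n := by
    rw [hr, Polynomial.eval_comp]
    simpa [hp] using ht
  obtain ⟨h1, h2, h3⟩ := hout.guarantees hε hε1
  exact ⟨F, t, b, σ, hex, hF, ht',
    fun hrat => hex.bits_le_eval RAM.small_primalDualForest hε hrat ht', hout, h1, h2, h3⟩
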